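/- Let $n\ge 3$ and $1<k\le n$ be integers. For a positive radial function $v(r)$, $r=|x|$, consider the metric $g=v(|x|)^{-2}|dx|^2=e^{-2\xi(t)}(dt^2+d\omega^2)$, where $t=\ln r$ and $v(r)=re^{\xi(\ln r)}$; its Schouten tensor is $A_{ij}=\frac{v_{ij}}{v}-\frac{|\nabla v|^2}{2v^2}\delta_{ij}$, and $\sigma_j(A_g)$ is the $j$-th elementary symmetric function of its eigenvalues with respect to $g$. $A_g\in\Gamma_k^+$ (resp. $\Gamma_k^-$) means $\sigma_j(A_g)>0$ (resp. $(-1)^j\sigma_j(A_g)>0$) for all $1\le j\le k$. Let $\xi$ be a $C^2$ solution, on its maximal interval of definition $(t_-,t_+)$, of $$2^{1-k}\binom nk(1-\xi_t^2)^{k-1}\Big[\tfrac kn\xi_{tt}+\big(\tfrac12-\tfrac kn\big)(1-\xi_t^2)\Big]e^{2k\xi}=2^{-k}\binom nk ,$$ and let $r_\pm=e^{t_\pm}\in[0,\infty]$. Then $\sigma_k(A_g)\equiv 2^{-k}\binom nk$; either $1-\xi_t^2>0$ throughout or $1-\xi_t^2<0$ throughout; and $h=e^{(2k-n)\xi}(1-\xi_t^2)^k-e^{-n\xi}$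 is constant. Below, $f\asymp g$ means that $f/g$ tends to a positive finite constant, and $f\sim g$ that $f/g\to1$. "Inversion" is the replacement of $\xi(t)$ by $\xi(-t)$, i.e. the pull-back of $g$ by $x\mapsto x/|x|^2$. When $2k>n$, we say that $v$ has expansion $E(a)$ at $0$ if, for some $\rho>0$, as $r\to0$, $$v^{-2}=\rho^{-2}\Big\{1+a\,\tfrac{k}{2k-n}\big(\tfrac r\rho\big)^{2-\frac nk}+o\big(r^{2-\frac nk}\big)\Big\},\qquad v\to\rho,\qquad |v_r|/r\to\infty,$$ and moreover $|v_{rr}|\to\infty$ if $k<n$. **Case I: $1-\xi_t^2>0$.** Then $A_g\in\Gamma_k^+$. 1. If $h=0$, then $v$ is defined for all $r>0$ and $v^{-2}=\big(\frac{2\rho}{|x|^2+\rho^2}\big)^2$ for some $\rho>0$; so $g$ extends to $\mathbb R^n$ and is the round metric of the unit sphere $\mathbb S^n=\mathbb R^n\cup\{\infty\}$. 2. If $h<0$, the domain is $0<r_-<|x|<r_+<\infty$; $v$ and $v_r$ are bounded, $v_r\to0$ as $r\to r_-$, $rv_r/v\to2$ as $r\to r_+$, and $|v_{rr}|\to\infty$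 at both ends. 3. If $h>0$, the domain is $0<|x|<\infty$, and: (a) if $2k<n$, then $h\le h^*=\frac{2k}{n-2k}\big(\frac{n-2k}n\big)^{\frac n{2k}}$, $\xi$ is periodic, and $g$ is complete on $\mathbb R^n\setminus\{0\}$; if $h=h^*$, then $g=\big(\frac{n-2k}{n}\big)^{1/k}\frac{|dx|^2}{|x|^2}$, a multiple of the cylindrical metric; (b) if $2k=n$, then $h<1$, $v^{-2}\asymp|x|^{-2(1-\sqrt{1-\sqrt[k]h})}$ as $|x|\to0$, $v^{-2}\asymp|x|^{-2(1+\sqrt{1-\sqrt[k]h})}$ as $|x|\to\infty$, and $g$ is incomplete with finite volume; (c) if $2k>n$, then $v$ and its inversion both have expansion $E(-\sqrt[k]h)$ at $0$, and $g$ extends to a metric on $\mathbb S^n$ with coefficients in the Hölder class $C^{0,2-\frac nk}$ (Lipschitz when $k=n$). **Case II: $1-\xi_t^2<0$, $k$ even.** Then $A_g\in\Gamma_k^-$. After an inversion if necessary, the domain is $0\le r_-<|x|<r_+<\infty$, and $v^{-2}\sim(r_+-r)^{-2}$ as $r\to r_+$. 1. If $h=0$, then $r_-=0$ and $v^{-2}=\big(\frac{2r_+}{r_+^2-|x|^2}\big)^2$,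 so that $g$ extends to the hyperbolic metric of the ball $|x|<r_+$. 2. If $h<0$, then $r_->0$; as $r\to r_-$, $v$ has a positive finite limit, $v_r\to0$ and $|v_{rr}|\to\infty$; $g$ is complete near $|x|=r_+$. 3. If $h>0$, then $g$ is complete near $|x|=r_+$, and: (a) if $2k<n$, then $r_->0$ and $v^{-2}\asymp(r-r_-)^{\frac{4k}{n-2k}}$ as $r\to r_-$; (b) if $2k=n$, then $r_-=0$ and $v^{-2}\asymp|x|^{2(\sqrt{1+\sqrt[k]h}-1)}$ as $|x|\to0$; (c) if $2k>n$, then $r_-=0$ and $v$ has expansion $E(\sqrt[k]h)$ at $0$. **Case III: $1-\xi_t^2<0$, $k$ odd.** Then $h<0$. After an inversion if necessary, the domain is $0\le r_-<|x|<r_+<\infty$, and as $r\to r_+$, $v$ and $v_r$ stay bounded while $|v_{rr}|\to\infty$. 1. If $2k<n$, then $r_->0$ and $v^{-2}\asymp(r-r_-)^{\frac{4k}{n-2k}}$ as $r\to r_-$. 2. If $2k=n$, then $r_-=0$ and $v^{-2}\asymp|x|^{2(\sqrt{1+\sqrt[k]{|h|}}-1)}$ as $|x|\to0$. 3. If $2k>n$,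 then $r_-=0$ and $v$ has expansion $E(\sqrt[k]{|h|})$ at $0$. -/

import Mathlib

open Set Filter Topology MeasureTheory

noncomputable section

/-! ### The equation in cylindrical coordinates -/

/-- The expression for `σ_k(A_g)`, `g = e^{-2ξ(t)} (dt² + dω²)`, at the values
`x = ξ(t)`, `p = ξ_t(t)`, `q = ξ_tt(t)`. -/
def sigmaODE (n k : ℕ) (x p q : ℝ) : ℝ :=
  2 ^ (1 - (k : ℝ)) * (n.choose k : ℝ) * (1 - p ^ 2) ^ (k - 1) *
    ((k : ℝ) / n * q + (1 / 2 - (k : ℝ) / n) * (1 - p ^ 2)) * Real.exp (2 * k * x)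

/-- `ξ` is a `C²` solution of `σ_k = 2^{-k} (n choose k)` on the set `s` (used for open `s`). -/
def IsSolutionOn (n k : ℕ) (ξ : ℝ → ℝ) (s : Set ℝ) : Prop :=
  ContDiffOn ℝ 2 ξ s ∧
    ∀ t ∈ s, sigmaODE n k (ξ t) (deriv ξ t) (deriv (deriv ξ) t) =
      2 ^ (-(k : ℝ)) * (n.choose k : ℝ)

/-- `ξ` is a `C²` solution on the nonempty open interval `s`, and `s` is its maximal domain of
definition: `ξ` does not extend to a solution on a larger open interval. -/
structure IsMaximalSolution (n k : ℕ) (ξ : ℝ → ℝ) (s : Set ℝ) : Prop where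
  isOpen : IsOpen s
  ordConnected : s.OrdConnected
  nonempty : s.Nonempty
  isSolutionOn : IsSolutionOn n k ξ s
  maximal : ∀ (η : ℝ → ℝ) (s' : Set ℝ), IsOpen s' → s'.OrdConnected → s ⊆ s' →
    IsSolutionOn n k η s' → EqOn ξ η s → s' = s

/-- The quantity `e^{(2k-n)ξ} (1 - ξ_t²)^k - e^{-nξ}`. -/
def firstIntegral (n k : ℕ) (ξ : ℝ → ℝ) (t : ℝ) : ℝ :=
  Real.exp ((2 * (k : ℝ) - n) * ξ t) * (1 - deriv ξ t ^ 2) ^ k - Real.exp (-(n : ℝ) * ξ t)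

/-! ### The radial function `v` and the metric `g = v(|x|)⁻² |dx|²` -/

/-- `v(r) = r e^{ξ(log r)}`, so that `v(|x|)⁻² |dx|² = e^{-2ξ} (dt² + dω²)` with `t = log |x|`. -/
def radialV (ξ : ℝ → ℝ) (r : ℝ) : ℝ := r * Real.exp (ξ (Real.log r))

/-- The set of radii `r = e^t`, `t ∈ s`. -/
def radii (s : Set ℝ) : Set ℝ := {r | 0 < r ∧ Real.log r ∈ s}

/-- Pulling `v(|x|)⁻² |dx|²` back by `x ↦ x / |x|²` gives `(invV v)(|x|)⁻² |dx|²`. -/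
def invV (v : ℝ → ℝ) (r : ℝ) : ℝ := r ^ 2 * v r⁻¹

/-- The radii of the inverted domain. -/
def invRadii (I : Set ℝ) : Set ℝ := {r | 0 < r ∧ r⁻¹ ∈ I}

/-- `(w, J)` is `(v, I)` or its inversion. -/
def EqOrInversion (v : ℝ → ℝ) (I : Set ℝ) (w : ℝ → ℝ) (J : Set ℝ) : Prop :=
  (w = v ∧ J = I) ∨ (w = invV v ∧ J = invRadii I)

/-- The rotationally symmetric domain `{x ∈ ℝⁿ : |x| ∈ I}`. -/
def shell (n : ℕ) (I : Set ℝ) : Set (EuclideanSpace ℝ (Fin n)) := {x | ‖x‖ ∈ I}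

/-! ### The Schouten tensor and the classes `Γ_k^±` -/

/-- The `i`-th partial derivative. -/
def partialD {n : ℕ} (i : Fin n) (u : EuclideanSpace ℝ (Fin n) → ℝ)
    (x : EuclideanSpace ℝ (Fin n)) : ℝ :=
  fderiv ℝ u x (EuclideanSpace.single i 1)

/-- The components `A_ij = u_ij / u - |∇u|² / (2 u²) δ_ij` of the Schouten tensor of the
metric `u⁻² |dx|²`. -/
def schouten {n : ℕ} (u : EuclideanSpace ℝ (Fin n) → ℝ) (x : EuclideanSpace ℝ (Fin n)) :
    Matrix (Fin n) (Fin n) ℝ :=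
  Matrix.of fun i j =>
    partialD i (partialD j u) x / u x
      - if i = j then (∑ l, partialD l u x ^ 2) / (2 * u x ^ 2) else 0

/-- `σ_j(A_g)` for `g = u⁻² |dx|²`: the `j`-th elementary symmetric function of the eigenvalues
of `A_g` with respect to `g`, i.e. of the eigenvalues of the matrix `u² A`. -/
def sigmaCurv {n : ℕ} (u : EuclideanSpace ℝ (Fin n) → ℝ) (j : ℕ)
    (x : EuclideanSpace ℝ (Fin n)) : ℝ :=
  ((u x ^ 2 • schouten u x).charpoly.roots).esymm j

/-- The Schouten tensor of `v(|x|)⁻² |dx|²` is in `Γ_k^+` on `|x| ∈ I`. -/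
def InGammaPlus (n k : ℕ) (v : ℝ → ℝ) (I : Set ℝ) : Prop :=
  ∀ x ∈ shell n I, ∀ j : ℕ, 1 ≤ j → j ≤ k → 0 < sigmaCurv (fun y => v ‖y‖) j x

/-- The Schouten tensor of `v(|x|)⁻² |dx|²` is in `Γ_k^-` on `|x| ∈ I`. -/
def InGammaMinus (n k : ℕ) (v : ℝ → ℝ) (I : Set ℝ) : Prop :=
  ∀ x ∈ shell n I, ∀ j : ℕ, 1 ≤ j → j ≤ k →
    0 < (-1 : ℝ) ^ j * sigmaCurv (fun y => v ‖y‖) j x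

/-! ### Distance, completeness and volume of `v(|x|)⁻² |dx|²` -/

/-- The length of the path `γ : [0, 1] → ℝⁿ` for `v(|x|)⁻² |dx|²`. -/
def pathLen {n : ℕ} (v : ℝ → ℝ) (γ : ℝ → EuclideanSpace ℝ (Fin n)) : ENNReal :=
  ∫⁻ τ in Icc (0 : ℝ) 1, ENNReal.ofReal (‖derivWithin γ (Icc 0 1) τ‖ / v ‖γ τ‖)

/-- The Riemannian distance of `v(|x|)⁻² |dx|²` on `{|x| ∈ I}`: the infimum of the lengths of the
`C¹` paths inside this domain. -/
def gDist {n : ℕ} (v : ℝ → ℝ) (I : Set ℝ) (x y : EuclideanSpace ℝ (Fin n)) : ENNReal :=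
  ⨅ (γ : ℝ → EuclideanSpace ℝ (Fin n)) (_ : ContDiffOn ℝ 1 γ (Icc 0 1) ∧
    MapsTo γ (Icc 0 1) (shell n I) ∧ γ 0 = x ∧ γ 1 = y), pathLen v γ

/-- The part `{|x| ∈ J}` of `{|x| ∈ I}` is complete for the Riemannian distance of
`v(|x|)⁻² |dx|²` on `{|x| ∈ I}`: Cauchy sequences converge. -/
def IsCompletePart (n : ℕ) (v : ℝ → ℝ) (I J : Set ℝ) : Prop :=
  ∀ x : ℕ → EuclideanSpace ℝ (Fin n), (∀ i, x i ∈ shell n J) →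
    (∀ ε : ENNReal, 0 < ε → ∃ N, ∀ i ≥ N, ∀ j ≥ N, gDist v I (x i) (x j) < ε) →
    ∃ y ∈ shell n J, Tendsto (fun i => gDist v I (x i) y) atTop (𝓝 0)

/-- `v(|x|)⁻² |dx|²` is a complete metric on `{|x| ∈ I}`. -/
def IsCompleteMetric (n : ℕ) (v : ℝ → ℝ) (I : Set ℝ) : Prop := IsCompletePart n v I I

/-- `v(|x|)⁻² |dx|²` is complete as `|x| → R`, where `R` is the right end point of `I`. -/
def IsCompleteNear (n : ℕ) (v : ℝ → ℝ) (I : Set ℝ) (R : ℝ) : Prop :=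
  ∀ r₀ ∈ I, IsCompletePart n v I (Ico r₀ R)

/-- The Riemannian volume of `{|x| ∈ I}` for `v(|x|)⁻² |dx|²`. -/
def gVolume (n : ℕ) (v : ℝ → ℝ) (I : Set ℝ) : ENNReal :=
  ∫⁻ x in shell n I, ENNReal.ofReal ((v ‖x‖)⁻¹ ^ n)

/-- `U(x) |dx|²` on `ℝⁿ` is the round metric of the unit sphere `𝕊ⁿ = ℝⁿ ∪ {∞}`: it is the
pull-back of that metric by a smooth bijection onto the sphere without the point `p = Φ(∞)`. -/
def IsRoundMetric (n : ℕ) (U : EuclideanSpace ℝ (Fin n) → ℝ) : Prop :=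
  ∃ (p : EuclideanSpace ℝ (Fin (n + 1)))
    (Φ : EuclideanSpace ℝ (Fin n) → EuclideanSpace ℝ (Fin (n + 1))),
    p ∈ Metric.sphere 0 1 ∧ ContDiff ℝ ((⊤ : ℕ∞) : WithTop ℕ∞) Φ ∧ Function.Injective Φ ∧
    range Φ = Metric.sphere 0 1 \ {p} ∧ Tendsto Φ (cocompact _) (𝓝 p) ∧
    ∀ x w, ‖fderiv ℝ Φ x w‖ ^ 2 = U x * ‖w‖ ^ 2

/-! ### Behaviour at an end of the domain -/

/-- `f ∼ g` up to a positive constant factor: `f / g` has a positive finite limit. -/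
def SimConst (l : Filter ℝ) (f g : ℝ → ℝ) : Prop :=
  ∃ c : ℝ, 0 < c ∧ Tendsto (fun r => f r / g r) l (𝓝 c)

/-- `|v_rr| → ∞`. -/
def BlowsUp2 (l : Filter ℝ) (v : ℝ → ℝ) : Prop :=
  Tendsto (fun r => |deriv (deriv v) r|) l atTop

/-- As `r → 0`, for some `ρ > 0`,
`v⁻² = ρ⁻² {1 + a k/(2k-n) (r/ρ)^{2-n/k} + o(r^{2-n/k})}` and `v → ρ`, while the second
derivatives of `x ↦ v(|x|)` blow up: its Hessian has the eigenvalues `v_r / r` (multiplicity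
`n - 1`) and `v_rr`; the first blows up, and so does the second if `k < n`. -/
def RootExpansion (n k : ℕ) (a : ℝ) (v : ℝ → ℝ) : Prop :=
  ∃ ρ : ℝ, 0 < ρ ∧
    (fun r : ℝ => v r ^ (-2 : ℤ) - ρ ^ (-2 : ℤ) *
      (1 + a * ((k : ℝ) / (2 * k - n)) * (r / ρ) ^ (2 - (n : ℝ) / k)))
      =o[𝓝[>] 0] (fun r : ℝ => r ^ (2 - (n : ℝ) / k)) ∧
    Tendsto v (𝓝[>] 0) (𝓝 ρ) ∧
    Tendsto (fun r => |deriv v r / r|) (𝓝[>] 0) atTop ∧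
    (k < n → BlowsUp2 (𝓝[>] 0) v)

/-- The conformal factor `v(|x|)⁻²`, `x ≠ 0`, extends to a positive function on `ℝⁿ` which is
Hölder continuous with exponent `α` on bounded sets. -/
def ExtendsHolder (n : ℕ) (α : ℝ) (v : ℝ → ℝ) : Prop :=
  ∃ U : EuclideanSpace ℝ (Fin n) → ℝ, (∀ x, 0 < U x) ∧
    (∀ x, x ≠ 0 → U x = v ‖x‖ ^ (-2 : ℤ)) ∧
    ∀ R : ℝ, ∃ C : NNReal, HolderOnWith C α.toNNReal U (Metric.closedBall 0 R)

/-- `v(|x|)⁻² |dx|²`, `x ≠ 0`, extends to a metric with `C^α` coefficients (`0 < α ≤ 1`) on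
`𝕊ⁿ = ℝⁿ ∪ {∞}`, in the two charts `x` and `x / |x|²`. -/
def ExtendsHolderSphere (n : ℕ) (α : ℝ) (v : ℝ → ℝ) : Prop :=
  ExtendsHolder n α v ∧ ExtendsHolder n α (invV v)

/-! ### The three cases -/

/-- The catalog of the solutions with `1 - ξ_t² > 0`. -/
def CatalogI (n k : ℕ) (ξ : ℝ → ℝ) (s : Set ℝ) (h : ℝ) : Prop :=
  let v := radialV ξ
  let I := radii s
  InGammaPlus n k v I ∧
  (h = 0 → I = Ioi 0 ∧ ∃ ρ : ℝ, 0 < ρ ∧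
    (∀ r ∈ I, v r ^ (-2 : ℤ) = (2 * ρ / (r ^ 2 + ρ ^ 2)) ^ 2) ∧
    IsRoundMetric n (fun x => (2 * ρ / (‖x‖ ^ 2 + ρ ^ 2)) ^ 2)) ∧
  (h < 0 → ∃ r₁ r₂ : ℝ, 0 < r₁ ∧ r₁ < r₂ ∧ I = Ioo r₁ r₂ ∧
    (∃ C : ℝ, ∀ r ∈ I, |v r| ≤ C ∧ |deriv v r| ≤ C) ∧
    Tendsto (deriv v) (𝓝[>] r₁) (𝓝 0) ∧
    Tendsto (fun r => r * deriv v r / v r) (𝓝[<] r₂) (𝓝 2) ∧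
    BlowsUp2 (𝓝[>] r₁) v ∧ BlowsUp2 (𝓝[<] r₂) v) ∧
  (0 < h → I = Ioi 0 ∧
    (2 * k < n →
      let hstar : ℝ := 2 * k / (n - 2 * k) * (((n : ℝ) - 2 * k) / n) ^ ((n : ℝ) / (2 * k))
      h ≤ hstar ∧ (∃ T : ℝ, 0 < T ∧ Function.Periodic ξ T) ∧ IsCompleteMetric n v I ∧
      (h = hstar → ∀ r ∈ I,
        v r ^ (-2 : ℤ) = (((n : ℝ) - 2 * k) / n) ^ (1 / (k : ℝ)) * r ^ (-2 : ℤ))) ∧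
    (2 * k = n → h < 1 ∧
      SimConst (𝓝[>] 0) (fun r => v r ^ (-2 : ℤ))
        (fun r => r ^ (-2 * (1 - √(1 - h ^ (1 / (k : ℝ)))))) ∧
      SimConst atTop (fun r => v r ^ (-2 : ℤ))
        (fun r => r ^ (-2 * (1 + √(1 - h ^ (1 / (k : ℝ)))))) ∧
      ¬ IsCompleteMetric n v I ∧ gVolume n v I < ⊤) ∧
    (n < 2 * k →
      RootExpansion n k (-h ^ (1 / (k : ℝ))) v ∧
      RootExpansion n k (-h ^ (1 / (k : ℝ))) (invV v) ∧
      ExtendsHolderSphere n (2 - (n : ℝ) / k) v))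

/-- The catalog of the solutions with `1 - ξ_t² < 0`, for even `k`. -/
def CatalogII (n k : ℕ) (ξ : ℝ → ℝ) (s : Set ℝ) (h : ℝ) : Prop :=
  InGammaMinus n k (radialV ξ) (radii s) ∧
  ∃ (v : ℝ → ℝ) (I : Set ℝ), EqOrInversion (radialV ξ) (radii s) v I ∧ ∃ R : ℝ, 0 < R ∧
  Asymptotics.IsEquivalent (𝓝[<] R) (fun r => v r ^ (-2 : ℤ)) (fun r => (R - r) ^ (-2 : ℤ)) ∧
  (h = 0 → I = Ioo 0 R ∧ ∀ r ∈ I, v r ^ (-2 : ℤ) = (2 * R / (R ^ 2 - r ^ 2)) ^ 2) ∧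
  (h < 0 → ∃ r₁ : ℝ, 0 < r₁ ∧ r₁ < R ∧ I = Ioo r₁ R ∧
    (∃ L : ℝ, 0 < L ∧ Tendsto v (𝓝[>] r₁) (𝓝 L)) ∧
    Tendsto (deriv v) (𝓝[>] r₁) (𝓝 0) ∧ BlowsUp2 (𝓝[>] r₁) v ∧ IsCompleteNear n v I R) ∧
  (0 < h →
    (2 * k < n → ∃ r₁ : ℝ, 0 < r₁ ∧ r₁ < R ∧ I = Ioo r₁ R ∧
      SimConst (𝓝[>] r₁) (fun r => v r ^ (-2 : ℤ))
        (fun r => (r - r₁) ^ (4 * (k : ℝ) / (n - 2 * k)))) ∧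
    (2 * k = n → I = Ioo 0 R ∧
      SimConst (𝓝[>] 0) (fun r => v r ^ (-2 : ℤ))
        (fun r => r ^ (2 * (√(1 + h ^ (1 / (k : ℝ))) - 1)))) ∧
    (n < 2 * k → I = Ioo 0 R ∧ RootExpansion n k (h ^ (1 / (k : ℝ))) v) ∧
    IsCompleteNear n v I R)

/-- The catalog of the solutions with `1 - ξ_t² < 0`, for odd `k`. -/
def CatalogIII (n k : ℕ) (ξ : ℝ → ℝ) (s : Set ℝ) (h : ℝ) : Prop :=
  h < 0 ∧
  ∃ (v : ℝ → ℝ) (I : Set ℝ), EqOrInversion (radialV ξ) (radii s) v I ∧ ∃ R : ℝ, 0 < R ∧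
  (∃ C : ℝ, ∀ᶠ r in 𝓝[<] R, |v r| ≤ C ∧ |deriv v r| ≤ C) ∧
  BlowsUp2 (𝓝[<] R) v ∧
  (2 * k < n → ∃ r₁ : ℝ, 0 < r₁ ∧ r₁ < R ∧ I = Ioo r₁ R ∧
    SimConst (𝓝[>] r₁) (fun r => v r ^ (-2 : ℤ))
      (fun r => (r - r₁) ^ (4 * (k : ℝ) / (n - 2 * k)))) ∧
  (2 * k = n → I = Ioo 0 R ∧
    SimConst (𝓝[>] 0) (fun r => v r ^ (-2 : ℤ))
      (fun r => r ^ (2 * (√(1 + |h| ^ (1 / (k : ℝ))) - 1)))) ∧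
  (n < 2 * k → I = Ioo 0 R ∧ RootExpansion n k (|h| ^ (1 / (k : ℝ))) v)

end

/-!
A solution `ξ` has the first integral `h = e^{(2k-n)ξ} (1 - p²)^k - e^{-nξ}`, `p = ξ_t`. In the
form `(1 - p²)^k e^{2kξ} = 1 + h e^{nξ}` it determines `|p|` as a function of `ξ`, through `gap`,
and removes the powers of `1 - p²` from the equation, which becomes `p_t = (1 - p²) (1 - n/(2k)
Y/(1+Y))`, `Y = h e^{nξ}`. A `Trajectory` records these facts. The right-hand side of the original
equation, solved for `ξ_tt`, is smooth where `p² ≠ 1`, so that a maximal solution cannot converge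
to a regular point at a finite end; hence at a finite end with bounded velocity `ξ` converges to a
zero of `1 + h e^{nx}` (`Trajectory.exists_tendsto_left`), and there `v_rr` blows up
(`Trajectory.blowsUp2_of_tendsto`).

The eigenvalues of the Schouten tensor of a radial conformal factor are explicit
(`sigmaCurv_radial`); in terms of `Y` one gets `σ_j` as a positive multiple of `(1 - p²)^j (1 -
(j/k) Y/(1+Y))`, which gives the value of `σ_k` and the classes `Γ_k^±`.

If `1 - p² > 0`, then `|p| < 1`. For `h ≥ 0` the solution is global, for `h < 0` both ends are
finite because `ξ` is bounded above while `e^{ξ - t} (1 + p)` increases. For `h = 0` the functions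
`e^{ξ ± t} (1 ∓ p)` are constant. For `h > 0` and `2k < n` Bernoulli's inequality bounds `h`, and
unless `ξ` is constant `p` has two zeros, which are centres of symmetry, so that twice their
distance is a period. For `h > 0` and `2k ≥ n` the velocity increases and is negative near `-∞`,
so that `ξ → ∞` at both ends.

If `1 - p² < 0`, one may assume `p < -1` after a reflection in `t`. To the left `ξ` then tends to
infinity, unless it reaches a zero of `1 + h e^{nx}`; for `h ≠ 0` it becomes infinite in finite
time exactly if `2k < n`. To the right `e^ξ` reaches `0` with slope `-1` if `k` is even, and `ξ`
reaches a zero of `1 + h e^{nx}` if `k` is odd.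

The behaviour of `v` at an end with `ξ → ∞`, `h ≠ 0`, follows from `gap(x) ~ |h|^{1/k}
e^{(n/k-2)x}`: it makes `ξ + t` (for `2k > n`) or `ξ + βt` (for `2k = n`) converge, and for `2k <
n` it gives the rate of blow-up in finite time (`Trajectory.rootExpansion`,
`Trajectory.simConst_of_eq`, `Trajectory.simConst_of_lt`).

Completeness is a question about `Φ` with `Φ' = 1/v`: distances are bounded from below by
differences of `Φ(|x|)` and, along rays, from above (`isCompletePart_of_isClosed_image`,
`not_isCompleteMetric`).
-/

/-! ### The equation as a first-order system -/

/-- The value of `ξ_tt` that the equation assigns to `x = ξ` and `p = ξ_t`, when `p² ≠ 1`. -/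
noncomputable def odeAccel (n k : ℕ) (x p : ℝ) : ℝ :=
  (n : ℝ) / (2 * k) * (Real.exp (-2 * k * x) / (1 - p ^ 2) ^ (k - 1) -
    (1 - 2 * k / n) * (1 - p ^ 2))

theorem sigmaODE_eq_iff {n k : ℕ} (hn : 0 < n) (hk : 1 < k) (hkn : k ≤ n) (x p q : ℝ) :
    sigmaODE n k x p q = 2 ^ (-(k : ℝ)) * (n.choose k : ℝ) ↔
      1 - p ^ 2 ≠ 0 ∧ q = odeAccel n k x p := by
  have hc : (n.choose k : ℝ) ≠ 0 := by exact_mod_cast (Nat.choose_pos hkn).ne'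
  have h2 : (2 : ℝ) ^ (-(k : ℝ)) ≠ 0 := (Real.rpow_pos_of_pos two_pos _).ne'
  have hn' : (n : ℝ) ≠ 0 := by positivity
  have hk' : (k : ℝ) ≠ 0 := by positivity
  have e : (2 : ℝ) ^ (1 - (k : ℝ)) = 2 * 2 ^ (-(k : ℝ)) := by
    rw [sub_eq_add_neg, Real.rpow_add two_pos, Real.rpow_one]
  have key : sigmaODE n k x p q = 2 ^ (-(k : ℝ)) * (n.choose k : ℝ) ↔
      2 * (1 - p ^ 2) ^ (k - 1) * ((k : ℝ) / n * q + (1 / 2 - (k : ℝ) / n) * (1 - p ^ 2)) *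
        Real.exp (2 * k * x) = 1 := by
    unfold sigmaODE
    rw [e]
    constructor
    · intro h
      have : (2 ^ (-(k : ℝ)) * (n.choose k : ℝ)) * (2 * (1 - p ^ 2) ^ (k - 1) *
        ((k : ℝ) / n * q + (1 / 2 - (k : ℝ) / n) * (1 - p ^ 2)) * Real.exp (2 * k * x)) =
        (2 ^ (-(k : ℝ)) * (n.choose k : ℝ)) * 1 := by linear_combination h
      exact mul_left_cancel₀ (mul_ne_zero h2 hc) this
    · intro h
      linear_combination (2 ^ (-(k : ℝ)) * (n.choose k : ℝ)) * h
  rw [key]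
  have hE : Real.exp (-2 * k * x) = (Real.exp (2 * k * x))⁻¹ := by
    rw [← Real.exp_neg]; congr 1; ring
  have hE0 := (Real.exp_pos (2 * k * x)).ne'
  unfold odeAccel
  rw [hE]
  constructor
  · intro h
    have hp : 1 - p ^ 2 ≠ 0 := by
      intro h0
      rw [h0, zero_pow (by omega)] at h
      simp at h
    refine ⟨hp, ?_⟩
    have hp' := pow_ne_zero (k - 1) hp
    have : (Real.exp (2 * k * x))⁻¹ / (1 - p ^ 2) ^ (k - 1) =
        2 * ((k : ℝ) / n * q + (1 / 2 - (k : ℝ) / n) * (1 - p ^ 2)) := by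
      rw [div_eq_iff hp', inv_eq_iff_eq_inv, eq_comm, inv_eq_iff_eq_inv, eq_comm]
      rw [eq_comm, ← div_eq_one_iff_eq (inv_ne_zero hE0), div_inv_eq_mul]
      linear_combination h
    rw [this]
    field_simp
    ring
  · rintro ⟨hp, rfl⟩
    have hp' := pow_ne_zero (k - 1) hp
    field_simp
    ring

theorem isSolutionOn_iff {n k : ℕ} (hn : 0 < n) (hk : 1 < k) (hkn : k ≤ n) {ξ : ℝ → ℝ}
    {s : Set ℝ} (hs : IsOpen s) :
    IsSolutionOn n k ξ s ↔ ∃ p : ℝ → ℝ, ∀ t ∈ s, 1 - p t ^ 2 ≠ 0 ∧ HasDerivAt ξ (p t) t ∧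
      HasDerivAt p (odeAccel n k (ξ t) (p t)) t := by
  have h2 : (2 : WithTop ℕ∞) = 1 + 1 := by norm_num
  have h1 : (1 : WithTop ℕ∞) = 0 + 1 := by norm_num
  constructor
  · rintro ⟨h, heq⟩
    rw [h2, contDiffOn_succ_iff_deriv_of_isOpen hs] at h
    obtain ⟨hd, -, hc⟩ := h
    rw [h1, contDiffOn_succ_iff_deriv_of_isOpen hs] at hc
    refine ⟨deriv ξ, fun t ht => ?_⟩
    have := heq t ht
    rw [sigmaODE_eq_iff hn hk hkn] at this
    refine ⟨this.1, ((hd t ht).differentiableAt (hs.mem_nhds ht)).hasDerivAt, ?_⟩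
    rw [← this.2]
    exact ((hc.1 t ht).differentiableAt (hs.mem_nhds ht)).hasDerivAt
  · rintro ⟨p, h⟩
    have e1 : ∀ t ∈ s, deriv ξ t = p t := fun t ht => (h t ht).2.1.deriv
    have e1' : ∀ t ∈ s, deriv ξ =ᶠ[𝓝 t] p := fun t ht =>
      Filter.eventually_of_mem (hs.mem_nhds ht) e1
    have e2 : ∀ t ∈ s, deriv (deriv ξ) t = odeAccel n k (ξ t) (p t) := fun t ht => by
      rw [(e1' t ht).deriv_eq]; exact (h t ht).2.2.deriv
    refine ⟨?_, fun t ht => ?_⟩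
    · rw [h2, contDiffOn_succ_iff_deriv_of_isOpen hs]
      refine ⟨fun t ht => (h t ht).2.1.differentiableAt.differentiableWithinAt, by simp, ?_⟩
      rw [contDiffOn_congr e1, h1, contDiffOn_succ_iff_deriv_of_isOpen hs]
      refine ⟨fun t ht => (h t ht).2.2.differentiableAt.differentiableWithinAt, by simp, ?_⟩
      rw [contDiffOn_zero]
      refine ContinuousOn.congr (f := fun t => odeAccel n k (ξ t) (p t)) ?_
        (fun t ht => (h t ht).2.2.deriv)
      intro t ht
      have c1 := (h t ht).2.1.continuousAt
      have c2 := (h t ht).2.2.continuousAt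
      have c3 := pow_ne_zero (k - 1) (h t ht).1
      refine ContinuousAt.continuousWithinAt ?_
      unfold odeAccel
      fun_prop (disch := assumption)
    · rw [sigmaODE_eq_iff hn hk hkn, e2 t ht, e1 t ht]
      exact ⟨(h t ht).1, rfl⟩

/-- Gluing at `b` of a function on the left with a function on the right, when the derivative
on the left has the right limit at `b`. -/
theorem hasDerivAt_glue {f g f' : ℝ → ℝ} {a b d : ℝ} (hab : a < b)
    (hf : ∀ t ∈ Ioo a b, HasDerivAt f (f' t) t) (hlim : Tendsto f (𝓝[<] b) (𝓝 (g b)))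
    (hlim' : Tendsto f' (𝓝[<] b) (𝓝 d)) (hg : HasDerivAt g d b) :
    HasDerivAt (fun t => if t < b then f t else g t) d b := by
  set F : ℝ → ℝ := fun t => if t < b then f t else g t with hF
  have hFl : ∀ t, t < b → F =ᶠ[𝓝 t] f := fun t ht =>
    Filter.eventually_of_mem (Iio_mem_nhds ht) fun u hu => by simp [hF, mem_Iio.1 hu]
  have hFd : ∀ t ∈ Ioo a b, HasDerivAt F (f' t) t := fun t ht =>
    (hf t ht).congr_of_eventuallyEq (hFl t ht.2)
  have hFb : F b = g b := by simp [hF]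
  have left : HasDerivWithinAt F d (Iic b) b := by
    refine hasDerivWithinAt_Iic_of_tendsto_deriv (s := Ioo a b)
      (fun t ht => (hFd t ht).differentiableAt.differentiableWithinAt) ?_
      (Ioo_mem_nhdsLT hab) ?_
    · unfold ContinuousWithinAt
      rw [hFb, nhdsWithin_Ioo_eq_nhdsLT hab]
      refine hlim.congr' ?_
      filter_upwards [self_mem_nhdsWithin] with t ht
      simp [hF, mem_Iio.1 ht]
    · refine hlim'.congr' ?_
      filter_upwards [Ioo_mem_nhdsLT hab] with t ht
      exact (hFd t ht).deriv.symm
  have right : HasDerivWithinAt F d (Ici b) b :=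
    hg.hasDerivWithinAt.congr (fun t ht => by simp [hF, not_lt.2 (mem_Ici.1 ht)]) hFb
  have := left.union right
  rwa [Iic_union_Ici, hasDerivWithinAt_univ] at this

theorem contDiffAt_odeAccel {n k : ℕ} {x₀ p₀ : ℝ} (h : 1 - p₀ ^ 2 ≠ 0) :
    ContDiffAt ℝ 1 (fun y : ℝ × ℝ => odeAccel n k y.1 y.2) (x₀, p₀) := by
  have := pow_ne_zero (k - 1) h
  unfold odeAccel
  fun_prop (disch := assumption)

theorem exists_local_solution (n k : ℕ) (b : ℝ) {x₀ p₀ : ℝ} (h : 1 - p₀ ^ 2 ≠ 0) :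
    ∃ ε > 0, ∃ X P : ℝ → ℝ, X b = x₀ ∧ P b = p₀ ∧ ∀ t ∈ Ioo (b - ε) (b + ε),
      1 - P t ^ 2 ≠ 0 ∧ HasDerivAt X (P t) t ∧ HasDerivAt P (odeAccel n k (X t) (P t)) t := by
  let V : ℝ × ℝ → ℝ × ℝ := fun y => (y.2, odeAccel n k y.1 y.2)
  have hV : ContDiffAt ℝ 1 V (x₀, p₀) := contDiffAt_snd.prodMk (contDiffAt_odeAccel h)
  obtain ⟨α, hα0, ε₁, hε₁, hα⟩ :=
    hV.exists_forall_mem_closedBall_exists_eq_forall_mem_Ioo_hasDerivAt₀ b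
  have hα1 : ContinuousAt α b := (hα b ⟨by linarith, by linarith⟩).continuousAt
  have hα2 : ∀ᶠ t in 𝓝 b, 1 - (α t).2 ^ 2 ≠ 0 := by
    have : ContinuousAt (fun t => 1 - (α t).2 ^ 2) b := by fun_prop
    exact this.eventually_ne (by rw [hα0]; exact h)
  obtain ⟨ε₂, hε₂, hα2⟩ := Metric.eventually_nhds_iff.1 hα2
  set ε := min ε₁ ε₂ with hεdef
  have hε : 0 < ε := lt_min hε₁ hε₂
  have hA : ∀ t ∈ Ioo (b - ε) (b + ε), 1 - (α t).2 ^ 2 ≠ 0 ∧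
      HasDerivAt (fun t => (α t).1) ((α t).2) t ∧
      HasDerivAt (fun t => (α t).2) (odeAccel n k (α t).1 (α t).2) t := by
    intro t ht
    have h1 := hα t ⟨by linarith [ht.1, min_le_left ε₁ ε₂], by linarith [ht.2, min_le_left ε₁ ε₂]⟩
    refine ⟨hα2 ?_, h1.fst, h1.snd⟩
    rw [Real.dist_eq, abs_lt]
    constructor <;> linarith [ht.1, ht.2, min_le_right ε₁ ε₂]
  exact ⟨ε, hε, fun t => (α t).1, fun t => (α t).2, by simp [hα0], by simp [hα0], hA⟩

/-- A maximal solution cannot converge, at a finite right end, to a point where the equation is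
regular. -/
theorem IsMaximalSolution.not_regular_right {n k : ℕ} (hn : 0 < n) (hk : 1 < k) (hkn : k ≤ n)
    {ξ : ℝ → ℝ} {s : Set ℝ} (hξ : IsMaximalSolution n k ξ s) {b : ℝ} (hb : IsLUB s b)
    {x₀ p₀ : ℝ} (hx : Tendsto ξ (𝓝[<] b) (𝓝 x₀)) (hp : Tendsto (deriv ξ) (𝓝[<] b) (𝓝 p₀)) :
    p₀ ^ 2 = 1 := by
  by_contra hne
  have hne' : 1 - p₀ ^ 2 ≠ 0 := fun h => hne (by linarith)
  obtain ⟨q, hq⟩ := (isSolutionOn_iff hn hk hkn hξ.isOpen).1 hξ.isSolutionOn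
  have hqd : ∀ t ∈ s, deriv ξ t = q t := fun t ht => (hq t ht).2.1.deriv
  have hbs : b ∉ s := fun h => by
    obtain ⟨ε, hε, hball⟩ := Metric.isOpen_iff.1 hξ.isOpen b h
    have : b + ε / 2 ∈ s := hball (by simp [abs_of_pos hε, hε])
    linarith [hb.1 this]
  have hlt : ∀ t ∈ s, t < b := fun t ht => lt_of_le_of_ne (hb.1 ht) (fun h => hbs (h ▸ ht))
  obtain ⟨t₀, ht₀⟩ := hξ.nonempty
  have hsub : Ico t₀ b ⊆ s := fun t ht => by
    obtain ⟨u, hu, htu, -⟩ := hb.exists_between ht.2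
    exact hξ.ordConnected.out ht₀ hu ⟨ht.1, htu.le⟩
  have hsmem : s ∈ 𝓝[<] b := mem_of_superset (Ico_mem_nhdsLT (hlt t₀ ht₀)) hsub
  have hq0 : Tendsto q (𝓝[<] b) (𝓝 p₀) :=
    hp.congr' (Filter.eventually_of_mem hsmem hqd)
  obtain ⟨ε, hε, X, P, hX0, hP0, hA⟩ := exists_local_solution n k b (x₀ := x₀) hne'
  -- the glued solution on `s ∪ [b, b + ε)`
  let η : ℝ → ℝ := fun t => if t < b then ξ t else X t
  let π : ℝ → ℝ := fun t => if t < b then q t else P t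
  have hglue : ∀ t ∈ s ∪ Ico b (b + ε), 1 - π t ^ 2 ≠ 0 ∧ HasDerivAt η (π t) t ∧
      HasDerivAt π (odeAccel n k (η t) (π t)) t := by
    intro t ht
    rcases lt_trichotomy t b with h | h | h
    · have hts : t ∈ s := ht.resolve_right fun h' => absurd h'.1 (not_le.2 h)
      have e1 : η =ᶠ[𝓝 t] ξ := Filter.eventually_of_mem (Iio_mem_nhds h) fun u hu => by
        simp [η, mem_Iio.1 hu]
      have e2 : π =ᶠ[𝓝 t] q := Filter.eventually_of_mem (Iio_mem_nhds h) fun u hu => by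
        simp [π, mem_Iio.1 hu]
      rw [e1.eq_of_nhds, e2.eq_of_nhds]
      obtain ⟨h1, h2, h3⟩ := hq t hts
      exact ⟨h1, h2.congr_of_eventuallyEq e1, h3.congr_of_eventuallyEq e2⟩
    · subst h
      have hη : η t = x₀ := by simp [η, hX0]
      have hπ : π t = p₀ := by simp [π, hP0]
      have hI : Ioo t₀ t ⊆ s := fun u hu => hsub ⟨hu.1.le, hu.2⟩
      obtain ⟨h1, h2, h3⟩ := hA t ⟨by linarith, by linarith⟩
      rw [hP0] at h1 h2
      rw [hX0, hP0] at h3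
      rw [hη, hπ]
      refine ⟨h1, ?_, ?_⟩
      · exact hasDerivAt_glue (f := ξ) (g := X) (f' := q) (hlt t₀ ht₀)
          (fun u hu => (hq u (hI hu)).2.1)
          (by rwa [hX0]) hq0 h2
      · refine hasDerivAt_glue (f := q) (g := P) (f' := fun u => odeAccel n k (ξ u) (q u))
          (hlt t₀ ht₀) (fun u hu => (hq u (hI hu)).2.2)
          (by rwa [hP0]) ?_ h3
        have hc : Tendsto (fun y : ℝ × ℝ => odeAccel n k y.1 y.2) (𝓝 (x₀, p₀))
            (𝓝 (odeAccel n k x₀ p₀)) := (contDiffAt_odeAccel hne').continuousAt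
        have hpair : Tendsto (fun u => (ξ u, q u)) (𝓝[<] t) (𝓝 (x₀, p₀)) := hx.prodMk_nhds hq0
        have hc' := hc.comp hpair
        simp only [Function.comp_def] at hc'
        exact hc'
    · have e1 : η =ᶠ[𝓝 t] X :=
        Filter.eventually_of_mem (Ioi_mem_nhds h) fun u hu => by
          simp [η, not_lt.2 (mem_Ioi.1 hu).le]
      have e2 : π =ᶠ[𝓝 t] P :=
        Filter.eventually_of_mem (Ioi_mem_nhds h) fun u hu => by
          simp [π, not_lt.2 (mem_Ioi.1 hu).le]
      have hts : t ∈ Ico b (b + ε) := ht.resolve_left fun h' => absurd (hlt t h') (not_lt.2 h.le)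
      rw [e1.eq_of_nhds, e2.eq_of_nhds]
      obtain ⟨h1, h2, h3⟩ := hA t ⟨by linarith, hts.2⟩
      exact ⟨h1, h2.congr_of_eventuallyEq e1, h3.congr_of_eventuallyEq e2⟩
  have hs'o : IsOpen (s ∪ Ico b (b + ε)) := by
    have : s ∪ Ico b (b + ε) = s ∪ Ioo t₀ (b + ε) := by
      ext u
      constructor
      · rintro (h | h)
        · exact Or.inl h
        · exact Or.inr ⟨(hlt t₀ ht₀).trans_le h.1, h.2⟩
      · rintro (h | h)
        · exact Or.inl h
        · rcases lt_or_ge u b with hu | hu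
          · exact Or.inl (hsub ⟨h.1.le, hu⟩)
          · exact Or.inr ⟨hu, h.2⟩
    rw [this]
    exact hξ.isOpen.union isOpen_Ioo
  have hs'c : (s ∪ Ico b (b + ε)).OrdConnected := by
    refine ⟨?_⟩
    rintro x (hx' | hx') y (hy' | hy') z hz
    · exact Or.inl (hξ.ordConnected.out hx' hy' hz)
    · rcases lt_or_ge z b with h | h
      · obtain ⟨u, hu, htu, -⟩ := hb.exists_between h
        exact Or.inl (hξ.ordConnected.out hx' hu ⟨hz.1, htu.le⟩)
      · exact Or.inr ⟨h, hz.2.trans_lt hy'.2⟩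
    · exact absurd (hlt y hy') (not_lt.2 (hx'.1.trans (hz.1.trans hz.2)))
    · exact Or.inr ⟨hx'.1.trans hz.1, hz.2.trans_lt hy'.2⟩
  have := hξ.maximal η (s ∪ Ico b (b + ε)) hs'o hs'c subset_union_left
    ((isSolutionOn_iff hn hk hkn hs'o).2 ⟨π, hglue⟩)
    (fun t ht => by simp [η, hlt t ht])
  exact hbs (this ▸ Or.inr ⟨le_rfl, by linarith⟩)

/-! ### Reflection in `t`, which is the inversion `x ↦ x / |x|²` -/

theorem IsSolutionOn.neg {n k : ℕ} {ξ : ℝ → ℝ} {s : Set ℝ} (h : IsSolutionOn n k ξ s) :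
    IsSolutionOn n k (fun t => ξ (-t)) (Neg.neg ⁻¹' s) := by
  refine ⟨h.1.comp contDiff_neg.contDiffOn fun t ht => ht, fun t ht => ?_⟩
  have e1 : deriv (fun t => ξ (-t)) = fun t => -deriv ξ (-t) := by
    ext u; exact deriv_comp_neg ξ u
  have e2 : deriv (deriv fun t => ξ (-t)) t = deriv (deriv ξ) (-t) := by
    rw [e1, deriv.fun_neg, deriv_comp_neg (deriv ξ) t, neg_neg]
  rw [e2, e1, ← h.2 (-t) ht]
  simp [sigmaODE]

theorem IsMaximalSolution.neg {n k : ℕ} {ξ : ℝ → ℝ} {s : Set ℝ} (h : IsMaximalSolution n k ξ s) :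
    IsMaximalSolution n k (fun t => ξ (-t)) (Neg.neg ⁻¹' s) := by
  have hoc : ∀ {u : Set ℝ}, u.OrdConnected → (Neg.neg ⁻¹' u).OrdConnected := fun hu =>
    ⟨fun x hx y hy z hz => hu.out hy hx ⟨neg_le_neg hz.2, neg_le_neg hz.1⟩⟩
  refine ⟨h.isOpen.preimage continuous_neg, hoc h.ordConnected, ?_, h.isSolutionOn.neg, ?_⟩
  · obtain ⟨t, ht⟩ := h.nonempty
    exact ⟨-t, by simpa using ht⟩
  · intro η s' ho hc hsub hs heq
    have := h.maximal (fun t => η (-t)) (Neg.neg ⁻¹' s') (ho.preimage continuous_neg) (hoc hc)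
      (fun t ht => hsub (by simpa using ht)) hs.neg
      (fun t ht => by have := heq (x := -t) (by simpa using ht); simpa using this)
    rw [← this]
    ext t; simp

theorem invV_radialV (ξ : ℝ → ℝ) : invV (radialV ξ) = radialV fun t => ξ (-t) := by
  ext r
  simp only [invV, radialV, Real.log_inv]
  rcases eq_or_ne r 0 with rfl | hr
  · simp
  · field_simp

theorem invRadii_radii (s : Set ℝ) : invRadii (radii s) = radii (Neg.neg ⁻¹' s) := by
  ext r
  simp only [invRadii, radii, mem_ofPred_eq, mem_preimage, Real.log_inv, inv_pos]
  tauto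

/-! ### Trajectories -/

/-- The quotient `Y / (1 + Y)`, `Y = h e^{nx}`, which measures the deviation of the equation from
`ξ_tt = 1 - ξ_t²`. -/
noncomputable def massRatio (n : ℕ) (h x : ℝ) : ℝ :=
  h * Real.exp (n * x) / (1 + h * Real.exp (n * x))

/-- `(ξ, p)`, `p = ξ_t`, is a maximal trajectory of the equation on the open interval `s`, with
first integral `h`. The first integral is used to eliminate the powers of `1 - p²` from the formula
for `ξ_tt`, and maximality is recorded as the impossibility of convergence to a regular point at a
finite end of `s`. -/
structure Trajectory (n k : ℕ) (h : ℝ) (ξ p : ℝ → ℝ) (s : Set ℝ) : Prop where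
  isOpen : IsOpen s
  ordConnected : s.OrdConnected
  nonempty : s.Nonempty
  hasDerivAt : ∀ t ∈ s, HasDerivAt ξ (p t) t
  hasDerivAt_vel : ∀ t ∈ s,
    HasDerivAt p ((1 - p t ^ 2) * (1 - n / (2 * k) * massRatio n h (ξ t))) t
  energy : ∀ t ∈ s, (1 - p t ^ 2) ^ k * Real.exp (2 * k * ξ t) = 1 + h * Real.exp (n * ξ t)
  ne_zero : ∀ t ∈ s, 1 - p t ^ 2 ≠ 0
  right_end : ∀ b x₀ p₀, IsLUB s b → Tendsto ξ (𝓝[<] b) (𝓝 x₀) → Tendsto p (𝓝[<] b) (𝓝 p₀) →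
    p₀ ^ 2 = 1
  left_end : ∀ a x₀ p₀, IsGLB s a → Tendsto ξ (𝓝[>] a) (𝓝 x₀) → Tendsto p (𝓝[>] a) (𝓝 p₀) →
    p₀ ^ 2 = 1

theorem Trajectory.neg {n k : ℕ} {h : ℝ} {ξ p : ℝ → ℝ} {s : Set ℝ}
    (H : Trajectory n k h ξ p s) :
    Trajectory n k h (fun t => ξ (-t)) (fun t => -p (-t)) (Neg.neg ⁻¹' s) where
  isOpen := H.isOpen.preimage continuous_neg
  ordConnected := ⟨fun x hx y hy z hz =>
    H.ordConnected.out hy hx ⟨neg_le_neg hz.2, neg_le_neg hz.1⟩⟩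
  nonempty := by
    obtain ⟨t, ht⟩ := H.nonempty
    exact ⟨-t, by simpa using ht⟩
  hasDerivAt t ht := by
    have := (H.hasDerivAt (-t) ht).scomp t (hasDerivAt_neg t)
    rwa [smul_eq_mul, neg_one_mul] at this
  hasDerivAt_vel t ht := by
    have := ((H.hasDerivAt_vel (-t) ht).scomp t (hasDerivAt_neg t)).fun_neg
    rwa [smul_eq_mul, neg_one_mul, neg_neg, ← neg_sq (p (-t))] at this
  energy t ht := by simpa using H.energy (-t) ht
  ne_zero t ht := by simpa using H.ne_zero (-t) ht
  right_end b x₀ p₀ hb hx hp := by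
    have := H.left_end (-b) x₀ (-p₀) (isLUB_neg.1 hb) ?_ ?_
    · simpa using this
    · simpa [Function.comp_def] using hx.comp (tendsto_neg_nhdsGT_neg (a := b))
    · simpa [Function.comp_def] using (hp.comp (tendsto_neg_nhdsGT_neg (a := b))).neg
  left_end b x₀ p₀ hb hx hp := by
    have := H.right_end (-b) x₀ (-p₀) (isGLB_neg.1 hb) ?_ ?_
    · simpa using this
    · simpa [Function.comp_def] using hx.comp (tendsto_neg_nhdsLT_neg (a := b))
    · simpa [Function.comp_def] using (hp.comp (tendsto_neg_nhdsLT_neg (a := b))).neg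

theorem IsMaximalSolution.exists_trajectory {n k : ℕ} (hn : 0 < n) (hk : 1 < k) (hkn : k ≤ n)
    {ξ : ℝ → ℝ} {s : Set ℝ} (hξ : IsMaximalSolution n k ξ s) :
    ∃ h, (∀ t ∈ s, firstIntegral n k ξ t = h) ∧ Trajectory n k h ξ (deriv ξ) s := by
  have hn' : (n : ℝ) ≠ 0 := by positivity
  have hk' : (k : ℝ) ≠ 0 := by positivity
  have hq : ∀ t ∈ s, 1 - deriv ξ t ^ 2 ≠ 0 ∧ HasDerivAt ξ (deriv ξ t) t ∧
      HasDerivAt (deriv ξ) (odeAccel n k (ξ t) (deriv ξ t)) t := by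
    obtain ⟨q, hq⟩ := (isSolutionOn_iff hn hk hkn hξ.isOpen).1 hξ.isSolutionOn
    intro t ht
    obtain ⟨h1, h2, h3⟩ := hq t ht
    have e : deriv ξ =ᶠ[𝓝 t] q :=
      Filter.eventually_of_mem (hξ.isOpen.mem_nhds ht) fun u hu => (hq u hu).2.1.deriv
    rw [e.eq_of_nhds]
    exact ⟨h1, h2, h3.congr_of_eventuallyEq e⟩
  have hd : ∀ t ∈ s, HasDerivAt (firstIntegral n k ξ) 0 t := by
    intro t ht
    obtain ⟨h1, h2, h3⟩ := hq t ht
    have A := (((h2.const_mul (2 * (k : ℝ) - n)).exp.mul ((h3.pow 2).const_sub 1 |>.pow k)).sub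
      (h2.const_mul (-(n : ℝ))).exp)
    refine A.congr_deriv ?_
    have e1 : Real.exp (-(n : ℝ) * ξ t) =
        Real.exp ((2 * (k : ℝ) - n) * ξ t) * Real.exp (-2 * k * ξ t) := by
      rw [← Real.exp_add]; congr 1; ring
    have e2 : (1 - deriv ξ t ^ 2) ^ k = (1 - deriv ξ t ^ 2) ^ (k - 1) * (1 - deriv ξ t ^ 2) := by
      rw [← pow_succ]; congr 1; omega
    simp only [Pi.pow_apply]
    rw [e1, e2]
    have h1' := pow_ne_zero (k - 1) h1
    generalize Real.exp ((2 * (k : ℝ) - n) * ξ t) = E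
    simp only [odeAccel]
    generalize Real.exp (-2 * k * ξ t) = F
    field_simp
    ring
  have hpre : IsPreconnected s := hξ.ordConnected.isPreconnected
  obtain ⟨h, hh⟩ := hξ.isOpen.exists_is_const_of_deriv_eq_zero hpre
    (fun t ht => (hd t ht).differentiableAt.differentiableWithinAt) (fun t ht => (hd t ht).deriv)
  have energy : ∀ t ∈ s, (1 - deriv ξ t ^ 2) ^ k * Real.exp (2 * k * ξ t) =
      1 + h * Real.exp (n * ξ t) := by
    intro t ht
    have e1 : Real.exp (2 * k * ξ t) =
        Real.exp ((2 * (k : ℝ) - n) * ξ t) * Real.exp (n * ξ t) := by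
      rw [← Real.exp_add]; ring_nf
    have e2 : Real.exp (-(n : ℝ) * ξ t) * Real.exp (n * ξ t) = 1 := by
      rw [← Real.exp_add]; simp
    rw [← hh t ht, firstIntegral, e1]
    linear_combination e2
  refine ⟨h, hh, hξ.isOpen, hξ.ordConnected, hξ.nonempty, fun t ht => (hq t ht).2.1, ?_, energy,
    fun t ht => (hq t ht).1, fun b x₀ p₀ hb hx hp => hξ.not_regular_right hn hk hkn hb hx hp, ?_⟩
  · intro t ht
    obtain ⟨h1, -, h3⟩ := hq t ht
    refine h3.congr_deriv ?_
    have en := energy t ht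
    have e2 : (1 - deriv ξ t ^ 2) ^ k = (1 - deriv ξ t ^ 2) ^ (k - 1) * (1 - deriv ξ t ^ 2) := by
      rw [← pow_succ]; congr 1; omega
    have e3 : Real.exp (-2 * k * ξ t) = (Real.exp (2 * k * ξ t))⁻¹ := by
      rw [← Real.exp_neg]; congr 1; ring
    have hE := (Real.exp_pos (2 * k * ξ t)).ne'
    have hY : 1 + h * Real.exp (n * ξ t) ≠ 0 := by
      rw [← en]; exact mul_ne_zero (pow_ne_zero _ h1) hE
    have h1' := pow_ne_zero (k - 1) h1
    rw [odeAccel, massRatio, e3]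
    have en' : h * Real.exp (n * ξ t) = (1 - deriv ξ t ^ 2) ^ (k - 1) * (1 - deriv ξ t ^ 2) *
        Real.exp (2 * k * ξ t) - 1 := by rw [← e2, en]; ring
    rw [en'] at hY ⊢
    rw [add_sub_cancel] at hY ⊢
    field_simp
    ring
  · intro a x₀ p₀ ha hx hp
    have := hξ.neg.not_regular_right hn hk hkn (b := -a) (x₀ := x₀) (p₀ := -p₀) ?_ ?_ ?_
    · simpa using this
    · exact isLUB_neg.2 (by simpa using ha)
    · exact hx.comp (tendsto_neg_nhdsLT_neg (a := a))
    · have e1 : deriv (fun t => ξ (-t)) = fun t => -deriv ξ (-t) := by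
        ext u; exact deriv_comp_neg ξ u
      rw [e1]
      exact (hp.comp (tendsto_neg_nhdsLT_neg (a := a))).neg

/-! ### The Schouten tensor of a radial conformal factor -/

theorem Multiset.esymm_succ_cons (a : ℝ) (m : Multiset ℝ) (j : ℕ) :
    (a ::ₘ m).esymm (j + 1) = m.esymm (j + 1) + a * m.esymm j := by
  simp [Multiset.esymm, Multiset.powersetCard_cons, Multiset.sum_map_mul_left]

theorem Multiset.esymm_replicate (a : ℝ) (m j : ℕ) :
    (Multiset.replicate m a).esymm j = m.choose j * a ^ j := by
  induction m generalizing j with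
  | zero => cases j <;> simp [Multiset.esymm, Multiset.powersetCard_zero_right]
  | succ m ih =>
    cases j with
    | zero => simp [Multiset.esymm]
    | succ j =>
      rw [Multiset.replicate_succ, Multiset.esymm_succ_cons, ih, ih, Nat.choose_succ_succ]
      push_cast
      ring

open Polynomial in
theorem charpoly_roots_smul_one_add_vecMulVec {m : ℕ} (a b : ℝ) (x : Fin (m + 1) → ℝ) :
    (Matrix.scalar (Fin (m + 1)) a + b • Matrix.vecMulVec x x).charpoly.roots =
      (a + b * (x ⬝ᵥ x)) ::ₘ Multiset.replicate m a := by
  have e1 : Matrix.scalar (Fin (m + 1)) a + b • Matrix.vecMulVec x x =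
      Matrix.vecMulVec (b • x) x - Matrix.scalar (Fin (m + 1)) (-a) := by
    rw [Matrix.smul_vecMulVec, map_neg]; abel
  rw [e1, Matrix.charpoly_sub_scalar, Matrix.charpoly_vecMulVec]
  have e2 : (X ^ Fintype.card (Fin (m + 1)) -
      ((b • x) ⬝ᵥ x) • X ^ (Fintype.card (Fin (m + 1)) - 1) : ℝ[X]).comp (X + C (-a)) =
      (X - C a) ^ m * (X - C (a + b * (x ⬝ᵥ x))) := by
    simp only [Fintype.card_fin, Nat.add_sub_cancel, sub_comp, pow_comp, X_comp,
      smul_dotProduct, C_neg, C_add, smul_eq_mul, C_mul, smul_eq_C_mul, mul_comp, C_comp]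
    ring
  rw [e2, roots_mul (mul_ne_zero (pow_ne_zero _ (X_sub_C_ne_zero _)) (X_sub_C_ne_zero _)),
    roots_pow, roots_X_sub_C, roots_X_sub_C, Multiset.nsmul_singleton, add_comm]
  rfl

theorem hasFDerivAt_norm {E : Type*} [NormedAddCommGroup E] [InnerProductSpace ℝ E] {x : E}
    (hx : x ≠ 0) : HasFDerivAt (fun y : E => ‖y‖) (‖x‖⁻¹ • innerSL ℝ x) x := by
  have h1 := (hasStrictFDerivAt_norm_sq x).hasFDerivAt.sqrt (by simpa using hx)
  have e : (fun y : E => √(‖y‖ ^ 2)) = fun y => ‖y‖ := by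
    ext y; exact Real.sqrt_sq (norm_nonneg y)
  rw [e, Real.sqrt_sq (norm_nonneg x)] at h1
  convert h1 using 1
  ext y
  simp
  have := norm_ne_zero_iff.2 hx
  field_simp

theorem inner_single_one {n : ℕ} (x : EuclideanSpace ℝ (Fin n)) (i : Fin n) :
    inner ℝ x (EuclideanSpace.single i (1 : ℝ)) = x i := by
  simp [EuclideanSpace.inner_single_right]

section Radial

variable {n : ℕ} {v v₁ : ℝ → ℝ} {v₂ : ℝ}

theorem partialD_radial {x : EuclideanSpace ℝ (Fin n)} (hx : x ≠ 0)
    (h : HasDerivAt v (v₁ ‖x‖) ‖x‖) (i : Fin n) :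
    partialD i (fun y => v ‖y‖) x = v₁ ‖x‖ * (‖x‖⁻¹ * x i) := by
  have := (h.comp_hasFDerivAt x (hasFDerivAt_norm hx)).fderiv
  unfold partialD
  change fderiv ℝ (v ∘ fun y => ‖y‖) x _ = _
  rw [this]
  simp [inner_single_one]

theorem schouten_radial {x : EuclideanSpace ℝ (Fin n)} (hx : x ≠ 0)
    (h : ∀ᶠ r in 𝓝 ‖x‖, HasDerivAt v (v₁ r) r) (h₁ : HasDerivAt v₁ v₂ ‖x‖) (hv : v ‖x‖ ≠ 0) :
    v ‖x‖ ^ 2 • schouten (fun y => v ‖y‖) x =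
      Matrix.scalar (Fin n) (v ‖x‖ * v₁ ‖x‖ / ‖x‖ - v₁ ‖x‖ ^ 2 / 2) +
        (v ‖x‖ * (v₂ - v₁ ‖x‖ / ‖x‖) / ‖x‖ ^ 2) • Matrix.vecMulVec x.ofLp x.ofLp := by
  have hr : ‖x‖ ≠ 0 := norm_ne_zero_iff.2 hx
  have h1 : ∀ i, ∀ᶠ y in 𝓝 x, partialD i (fun y => v ‖y‖) y = v₁ ‖y‖ * (‖y‖⁻¹ * y i) := by
    intro i
    filter_upwards [continuous_norm.continuousAt.eventually h, isOpen_ne.mem_nhds hx]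
      with y hy hy0
    exact partialD_radial hy0 hy i
  have hsum : ∑ l, partialD l (fun y => v ‖y‖) x ^ 2 = v₁ ‖x‖ ^ 2 := by
    have : ∀ l, partialD l (fun y => v ‖y‖) x ^ 2 = (v₁ ‖x‖ * ‖x‖⁻¹) ^ 2 * (x l) ^ 2 := by
      intro l
      rw [(h1 l).self_of_nhds]; ring
    simp_rw [this]
    rw [← Finset.mul_sum, ← EuclideanSpace.real_norm_sq_eq]
    field_simp
  have h2 : ∀ i j, partialD i (partialD j (fun y => v ‖y‖)) x =
      (v₂ - v₁ ‖x‖ / ‖x‖) / ‖x‖ ^ 2 * (x i * x j) + if i = j then v₁ ‖x‖ / ‖x‖ else 0 := by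
    intro i j
    have hN := hasFDerivAt_norm hx
    have d1 : HasFDerivAt (fun y : EuclideanSpace ℝ (Fin n) => v₁ ‖y‖)
        (v₂ • ‖x‖⁻¹ • innerSL ℝ x) x := h₁.comp_hasFDerivAt x hN
    have d2 : HasFDerivAt (fun y : EuclideanSpace ℝ (Fin n) => ‖y‖⁻¹)
        ((-(‖x‖ ^ 2)⁻¹) • ‖x‖⁻¹ • innerSL ℝ x) x := (hasDerivAt_inv hr).comp_hasFDerivAt x hN
    have d3 : HasFDerivAt (fun y : EuclideanSpace ℝ (Fin n) => y j)
        (EuclideanSpace.proj j : EuclideanSpace ℝ (Fin n) →L[ℝ] ℝ) x :=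
      (EuclideanSpace.proj j : EuclideanSpace ℝ (Fin n) →L[ℝ] ℝ).hasFDerivAt
    have d := (d1.mul (d2.mul d3)).congr_of_eventuallyEq (h1 j)
    unfold partialD at d ⊢
    rw [d.fderiv]
    have e : (EuclideanSpace.single i (1 : ℝ) : EuclideanSpace ℝ (Fin n)) j =
        if i = j then 1 else 0 := by
      rw [PiLp.single_apply]; simp [eq_comm]
    simp only [add_apply, smul_apply, innerSL_apply_apply,
      inner_single_one, PiLp.proj_apply, e, smul_eq_mul, Pi.mul_apply]
    by_cases hij : i = j
    · subst hij
      simp only [if_true]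
      field_simp
      ring
    · simp only [hij, if_false]
      field_simp
      ring
  ext i j
  simp only [Matrix.smul_apply, schouten, Matrix.of_apply, Matrix.add_apply, Matrix.scalar_apply,
    Matrix.vecMulVec_apply, smul_eq_mul, hsum, h2 i j, Matrix.diagonal_apply]
  by_cases hij : i = j
  · simp only [hij, if_true]
    field_simp
    ring
  · simp only [hij, if_false]
    field_simp
    ring

end Radial

theorem sigmaCurv_radial {n : ℕ} (hn : 0 < n) {v v₁ : ℝ → ℝ} {v₂ : ℝ}
    {x : EuclideanSpace ℝ (Fin n)} (hx : x ≠ 0)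
    (h : ∀ᶠ r in 𝓝 ‖x‖, HasDerivAt v (v₁ r) r) (h₁ : HasDerivAt v₁ v₂ ‖x‖) (hv : v ‖x‖ ≠ 0)
    {j : ℕ} (hj : 1 ≤ j) {a b : ℝ} (ha : a = v ‖x‖ * v₁ ‖x‖ / ‖x‖ - v₁ ‖x‖ ^ 2 / 2)
    (hb : b = v ‖x‖ * v₂ - v₁ ‖x‖ ^ 2 / 2) :
    sigmaCurv (fun y => v ‖y‖) j x =
      n.choose j * a ^ (j - 1) * ((1 - (j : ℝ) / n) * a + (j : ℝ) / n * b) := by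
  obtain ⟨m, rfl⟩ : ∃ m, n = m + 1 := ⟨n - 1, by omega⟩
  obtain ⟨i, rfl⟩ : ∃ i, j = i + 1 := ⟨j - 1, by omega⟩
  have hr : ‖x‖ ≠ 0 := norm_ne_zero_iff.2 hx
  have hdot : x.ofLp ⬝ᵥ x.ofLp = ‖x‖ ^ 2 := by
    rw [EuclideanSpace.real_norm_sq_eq]; simp [dotProduct, sq]
  unfold sigmaCurv
  rw [schouten_radial hx h h₁ hv, charpoly_roots_smul_one_add_vecMulVec, hdot, ← ha,
    Multiset.esymm_succ_cons, Multiset.esymm_replicate, Multiset.esymm_replicate]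
  have e1 : a + v ‖x‖ * (v₂ - v₁ ‖x‖ / ‖x‖) / ‖x‖ ^ 2 * ‖x‖ ^ 2 = b := by
    rw [ha, hb]; field_simp; ring
  rw [e1]
  have c1 : ((m : ℝ) + 1) * m.choose i = (m + 1).choose (i + 1) * (i + 1) := by
    exact_mod_cast Nat.add_one_mul_choose_eq m i
  have c2 : (((m + 1).choose (i + 1) : ℕ) : ℝ) = m.choose i + m.choose (i + 1) := by
    rw [Nat.choose_succ_succ]; push_cast; ring
  have hm : ((m : ℝ) + 1) ≠ 0 := by positivity
  have c3 : (m.choose i : ℝ) = (m + 1).choose (i + 1) * ((i + 1) / (m + 1)) := by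
    field_simp; linear_combination c1
  have c4 : (m.choose (i + 1) : ℝ) = (m + 1).choose (i + 1) * (1 - (i + 1) / (m + 1)) := by
    rw [mul_sub, ← c3, c2]; ring
  rw [c4, c3]
  push_cast
  ring

/-! ### The metric of a trajectory -/

theorem isOpen_radii {s : Set ℝ} (hs : IsOpen s) : IsOpen (radii s) := by
  have : radii s = Ioi 0 ∩ Real.log ⁻¹' s := rfl
  rw [this]
  exact (Real.continuousOn_log.mono fun x hx => (mem_Ioi.1 hx).ne').isOpen_inter_preimage
    isOpen_Ioi hs

namespace Trajectory

variable {n k : ℕ} {h : ℝ} {ξ p : ℝ → ℝ} {s : Set ℝ}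

theorem hasDerivAt_radialV (H : Trajectory n k h ξ p s) {r : ℝ} (hr : r ∈ radii s) :
    HasDerivAt (radialV ξ) (Real.exp (ξ (Real.log r)) * (1 + p (Real.log r))) r := by
  have h0 : r ≠ 0 := hr.1.ne'
  have := (hasDerivAt_id r).mul ((H.hasDerivAt _ hr.2).comp r (Real.hasDerivAt_log h0)).exp
  refine this.congr_deriv ?_
  simp only [id, Function.comp_apply]
  field_simp

theorem deriv_radialV (H : Trajectory n k h ξ p s) {r : ℝ} (hr : r ∈ radii s) :
    deriv (radialV ξ) r = Real.exp (ξ (Real.log r)) * (1 + p (Real.log r)) :=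
  (H.hasDerivAt_radialV hr).deriv

theorem hasDerivAt_deriv_radialV (H : Trajectory n k h ξ p s) {r : ℝ} (hr : r ∈ radii s) :
    HasDerivAt (deriv (radialV ξ)) (Real.exp (ξ (Real.log r)) / r * (1 + p (Real.log r) -
      n / (2 * k) * massRatio n h (ξ (Real.log r)) * (1 - p (Real.log r) ^ 2))) r := by
  have h0 : r ≠ 0 := hr.1.ne'
  have hl := Real.hasDerivAt_log h0
  have := (((H.hasDerivAt _ hr.2).comp r hl).exp).mul
    (((H.hasDerivAt_vel _ hr.2).comp r hl).const_add 1)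
  refine (this.congr_deriv ?_).congr_of_eventuallyEq ?_
  · simp only [Function.comp_apply]
    field_simp
    ring
  · filter_upwards [(isOpen_radii H.isOpen).mem_nhds hr] with u hu
    exact H.deriv_radialV hu

theorem deriv_deriv_radialV (H : Trajectory n k h ξ p s) {r : ℝ} (hr : r ∈ radii s) :
    deriv (deriv (radialV ξ)) r = Real.exp (ξ (Real.log r)) / r * (1 + p (Real.log r) -
      n / (2 * k) * massRatio n h (ξ (Real.log r)) * (1 - p (Real.log r) ^ 2)) :=
  (H.hasDerivAt_deriv_radialV hr).deriv

theorem one_add_ne_zero (H : Trajectory n k h ξ p s) {t : ℝ} (ht : t ∈ s) :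
    1 + h * Real.exp (n * ξ t) ≠ 0 := by
  rw [← H.energy t ht]
  exact mul_ne_zero (pow_ne_zero _ (H.ne_zero t ht)) (Real.exp_pos _).ne'

theorem one_sub_massRatio (H : Trajectory n k h ξ p s) {t : ℝ} (ht : t ∈ s) :
    1 - massRatio n h (ξ t) = (1 + h * Real.exp (n * ξ t))⁻¹ := by
  have := H.one_add_ne_zero ht
  unfold massRatio
  field_simp
  ring

theorem sigmaCurv_eq (H : Trajectory n k h ξ p s) (hn : 0 < n) (hk : 0 < k) {j : ℕ} (hj : 1 ≤ j)
    {x : EuclideanSpace ℝ (Fin n)} (hx : x ∈ shell n (radii s)) :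
    sigmaCurv (fun y => radialV ξ ‖y‖) j x = n.choose j *
      (Real.exp (ξ (Real.log ‖x‖)) ^ 2 * (1 - p (Real.log ‖x‖) ^ 2) / 2) ^ j *
        (1 - j / k * massRatio n h (ξ (Real.log ‖x‖))) := by
  have hr : ‖x‖ ∈ radii s := hx
  have hx0 : x ≠ 0 := norm_pos_iff.1 hr.1
  have h0 : ‖x‖ ≠ 0 := hr.1.ne'
  have hv : radialV ξ ‖x‖ ≠ 0 := mul_ne_zero h0 (Real.exp_pos _).ne'
  have hE : ∀ᶠ r in 𝓝 ‖x‖, HasDerivAt (radialV ξ) (deriv (radialV ξ) r) r := by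
    filter_upwards [(isOpen_radii H.isOpen).mem_nhds hr] with u hu
    exact (H.hasDerivAt_radialV hu).differentiableAt.hasDerivAt
  rw [sigmaCurv_radial hn hx0 hE (H.hasDerivAt_deriv_radialV hr) hv hj rfl rfl,
    H.deriv_radialV hr]
  obtain ⟨i, rfl⟩ : ∃ i, j = i + 1 := ⟨j - 1, by omega⟩
  have hn' : (n : ℝ) ≠ 0 := by positivity
  have hk' : (k : ℝ) ≠ 0 := by positivity
  rw [show i + 1 - 1 = i from rfl]
  have e1 : radialV ξ ‖x‖ * (Real.exp (ξ (Real.log ‖x‖)) * (1 + p (Real.log ‖x‖))) / ‖x‖ -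
      (Real.exp (ξ (Real.log ‖x‖)) * (1 + p (Real.log ‖x‖))) ^ 2 / 2 =
      Real.exp (ξ (Real.log ‖x‖)) ^ 2 * (1 - p (Real.log ‖x‖) ^ 2) / 2 := by
    unfold radialV
    field_simp
    ring
  rw [e1]
  unfold radialV
  generalize massRatio n h (ξ (Real.log ‖x‖)) = G
  generalize Real.exp (ξ (Real.log ‖x‖)) = E
  generalize p (Real.log ‖x‖) = P
  have e2 : (1 - ((i + 1 : ℕ) : ℝ) / n) * (E ^ 2 * (1 - P ^ 2) / 2) + ((i + 1 : ℕ) : ℝ) / n *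
      (‖x‖ * E * (E / ‖x‖ * (1 + P - n / (2 * k) * G * (1 - P ^ 2))) - (E * (1 + P)) ^ 2 / 2) =
      E ^ 2 * (1 - P ^ 2) / 2 * (1 - ((i + 1 : ℕ) : ℝ) / k * G) := by
    push_cast
    field_simp
    ring
  rw [e2]
  ring

theorem sigmaCurv_self (H : Trajectory n k h ξ p s) (hn : 0 < n) (hk : 0 < k)
    {x : EuclideanSpace ℝ (Fin n)} (hx : x ∈ shell n (radii s)) :
    sigmaCurv (fun y => radialV ξ ‖y‖) k x = 2 ^ (-(k : ℝ)) * (n.choose k : ℝ) := by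
  have hr : ‖x‖ ∈ radii s := hx
  have hk' : (k : ℝ) ≠ 0 := by positivity
  rw [H.sigmaCurv_eq hn hk hk hx, div_self hk', one_mul, H.one_sub_massRatio hr.2, div_pow,
    mul_pow, ← pow_mul, ← Real.exp_nat_mul]
  have e := H.energy _ hr.2
  rw [mul_comm] at e
  push_cast
  rw [e, Real.rpow_neg two_pos.le, Real.rpow_natCast]
  have := H.one_add_ne_zero hr.2
  field_simp

theorem massRatio_lt_one (H : Trajectory n k h ξ p s) {t : ℝ} (ht : t ∈ s)
    (hpos : 0 < 1 + h * Real.exp (n * ξ t)) {j : ℕ} (hj : j ≤ k) :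
    0 < 1 - (j : ℝ) / k * massRatio n h (ξ t) := by
  have h1 := H.one_sub_massRatio ht
  have h2 : 0 < (1 + h * Real.exp (n * ξ t))⁻¹ := inv_pos.2 hpos
  have h3 : (j : ℝ) / k ≤ 1 := div_le_one_of_le₀ (by exact_mod_cast hj) (by positivity)
  have h4 : (0 : ℝ) ≤ j / k := by positivity
  rcases le_or_gt (massRatio n h (ξ t)) 0 with hG | hG
  · nlinarith
  · nlinarith

theorem inGammaPlus (H : Trajectory n k h ξ p s) (hk : 0 < k) (hkn : k ≤ n)
    (hD : ∀ t ∈ s, 0 < 1 - p t ^ 2) : InGammaPlus n k (radialV ξ) (radii s) := by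
  intro x hx j hj hjk
  have hr : ‖x‖ ∈ radii s := hx
  rw [H.sigmaCurv_eq (by omega) hk hj hx]
  have h1 : (0 : ℝ) < n.choose j := by exact_mod_cast Nat.choose_pos (hjk.trans hkn)
  have h2 := hD _ hr.2
  have h3 : 0 < 1 + h * Real.exp (n * ξ (Real.log ‖x‖)) := by
    rw [← H.energy _ hr.2]; positivity
  have h4 := H.massRatio_lt_one hr.2 h3 hjk
  positivity

theorem inGammaMinus (H : Trajectory n k h ξ p s) (hk : 0 < k) (hkn : k ≤ n) (hke : Even k)
    (hD : ∀ t ∈ s, 1 - p t ^ 2 < 0) : InGammaMinus n k (radialV ξ) (radii s) := by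
  intro x hx j hj hjk
  have hr : ‖x‖ ∈ radii s := hx
  rw [H.sigmaCurv_eq (by omega) hk hj hx]
  have h1 : (0 : ℝ) < n.choose j := by exact_mod_cast Nat.choose_pos (hjk.trans hkn)
  have h2 := hD _ hr.2
  have h3 : 0 < 1 + h * Real.exp (n * ξ (Real.log ‖x‖)) := by
    rw [← H.energy _ hr.2]
    exact mul_pos (hke.pow_pos h2.ne) (Real.exp_pos _)
  have h4 := H.massRatio_lt_one hr.2 h3 hjk
  have h5 : 0 < -(Real.exp (ξ (Real.log ‖x‖)) ^ 2 * (1 - p (Real.log ‖x‖) ^ 2) / 2) := by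
    have := mul_pos (pow_pos (Real.exp_pos (ξ (Real.log ‖x‖))) 2) (neg_pos.2 h2)
    linarith
  have h6 := pow_pos h5 j
  rw [neg_pow] at h6
  have := mul_pos (mul_pos h1 h6) h4
  calc (0 : ℝ) < _ := this
    _ = _ := by ring

end Trajectory

/-! ### Riemannian distance of a radial metric -/

section RadialDistance

variable {n : ℕ} {v Φ : ℝ → ℝ} {I : Set ℝ}

theorem contDiffOn_one_of_hasDerivAt {f f' : ℝ → ℝ} (hI : IsOpen I)
    (h : ∀ r ∈ I, HasDerivAt f (f' r) r) (hf' : ContinuousOn f' I) : ContDiffOn ℝ 1 f I := by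
  rw [show (1 : WithTop ℕ∞) = 0 + 1 by norm_num, contDiffOn_succ_iff_deriv_of_isOpen hI]
  refine ⟨fun r hr => (h r hr).differentiableAt.differentiableWithinAt, by simp, ?_⟩
  exact contDiffOn_zero.2 (hf'.congr fun r hr => (h r hr).deriv)

/-- The function `Φ(|x|)`, `Φ' = 1 / v`, changes along a path by at most the length of the path. -/
theorem enorm_sub_le_pathLen (hI : IsOpen I) (hI0 : I ⊆ Ioi 0) (hv : ∀ r ∈ I, 0 < v r)
    (hvc : ContinuousOn v I) (hΦ : ∀ r ∈ I, HasDerivAt Φ (1 / v r) r)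
    {γ : ℝ → EuclideanSpace ℝ (Fin n)} (hγ : ContDiffOn ℝ 1 γ (Icc 0 1))
    (hγI : MapsTo γ (Icc 0 1) (shell n I)) {τ : ℝ} (hτ : τ ∈ Icc (0 : ℝ) 1) :
    ENNReal.ofReal |Φ ‖γ τ‖ - Φ ‖γ 0‖| ≤ pathLen v γ := by
  have hsub : Icc 0 τ ⊆ Icc (0 : ℝ) 1 := Icc_subset_Icc_right hτ.2
  have hΦc : ContDiffOn ℝ 1 Φ I := contDiffOn_one_of_hasDerivAt hI hΦ
    (continuousOn_const.div hvc fun r hr => (hv r hr).ne')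
  have h0 : ∀ t ∈ Icc (0 : ℝ) 1, γ t ≠ 0 := fun t ht =>
    norm_pos_iff.1 (hI0 (hγI ht))
  have hf : ContDiffOn ℝ 1 (fun t => Φ ‖γ t‖) (Icc 0 τ) :=
    hΦc.comp ((hγ.mono hsub).norm ℝ fun t ht => h0 t (hsub ht)) fun t ht => hγI (hsub ht)
  rw [← Real.norm_eq_abs, ofReal_norm]
  refine (enorm_sub_le_lintegral_deriv_of_contDiffOn_Icc hf hτ.1).trans ?_
  refine le_trans ?_ (lintegral_mono_set hsub)
  apply lintegral_mono_ae
  rw [← restrict_Ioo_eq_restrict_Icc]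
  filter_upwards [self_mem_ae_restrict measurableSet_Ioo] with t ht
  have htm : t ∈ Icc (0 : ℝ) 1 := hsub ⟨ht.1.le, ht.2.le⟩
  have hnb : Icc (0 : ℝ) 1 ∈ 𝓝 t := Icc_mem_nhds ht.1 (ht.2.trans_le hτ.2)
  have hd : HasDerivAt γ (derivWithin γ (Icc 0 1) t) t :=
    ((hγ.differentiableOn one_ne_zero t htm).hasDerivWithinAt).hasDerivAt hnb
  have hvt := hv _ (hγI htm)
  have hγ0 := h0 t htm
  have hd2 := (hΦ _ (hγI htm)).comp t ((hasFDerivAt_norm hγ0).comp_hasDerivAt t hd)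
  have hd3 : deriv (fun t => Φ ‖γ t‖) t = _ := hd2.deriv
  rw [hd3, ← ofReal_norm]
  apply ENNReal.ofReal_le_ofReal
  have hn0 : 0 < ‖γ t‖ := norm_pos_iff.2 hγ0
  have hin := abs_real_inner_le_norm (γ t) (derivWithin γ (Icc 0 1) t)
  simp only [smul_apply, innerSL_apply_apply, smul_eq_mul, norm_mul, norm_inv,
    norm_div, norm_one, Real.norm_eq_abs, abs_of_pos hvt]
  rw [one_div, div_eq_inv_mul]
  gcongr
  rw [abs_of_pos hn0, inv_mul_le_iff₀ hn0]
  exact hin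

theorem ofReal_norm_sub_div_le_pathLen {V : ℝ} (hV : 0 < V)
    {γ : ℝ → EuclideanSpace ℝ (Fin n)} (hγ : ContDiffOn ℝ 1 γ (Icc 0 1))
    (hγV : ∀ t ∈ Icc (0 : ℝ) 1, 0 < v ‖γ t‖ ∧ v ‖γ t‖ ≤ V) :
    ENNReal.ofReal (‖γ 1 - γ 0‖ / V) ≤ pathLen v γ := by
  have h1 := enorm_sub_le_lintegral_derivWithin_Icc_of_contDiffOn_Icc hγ zero_le_one
  have h2 : ENNReal.ofReal (1 / V) * ∫⁻ x in Icc (0 : ℝ) 1, ‖derivWithin γ (Icc 0 1) x‖ₑ ≤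
      pathLen v γ := by
    rw [← lintegral_const_mul' _ _ ENNReal.ofReal_ne_top]
    refine setLIntegral_mono' measurableSet_Icc fun t ht => ?_
    rw [← ofReal_norm, ← ENNReal.ofReal_mul (by positivity)]
    apply ENNReal.ofReal_le_ofReal
    rw [one_div, inv_mul_eq_div]
    exact div_le_div_of_nonneg_left (norm_nonneg _) (hγV t ht).1 (hγV t ht).2
  refine le_trans ?_ h2
  rw [div_eq_mul_one_div, mul_comm, ENNReal.ofReal_mul (by positivity), ofReal_norm]
  gcongr

theorem ofReal_abs_sub_le_gDist (hI : IsOpen I) (hI0 : I ⊆ Ioi 0) (hv : ∀ r ∈ I, 0 < v r)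
    (hvc : ContinuousOn v I) (hΦ : ∀ r ∈ I, HasDerivAt Φ (1 / v r) r)
    (x y : EuclideanSpace ℝ (Fin n)) :
    ENNReal.ofReal |Φ ‖y‖ - Φ ‖x‖| ≤ gDist v I x y := by
  refine le_iInf fun γ => le_iInf fun hγ => ?_
  obtain ⟨h1, h2, rfl, rfl⟩ := hγ
  exact enorm_sub_le_pathLen hI hI0 hv hvc hΦ h1 h2 ⟨zero_le_one, le_rfl⟩

theorem derivWithin_lineMap (x y : EuclideanSpace ℝ (Fin n)) {t : ℝ} (ht : t ∈ Icc (0 : ℝ) 1) :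
    derivWithin (AffineMap.lineMap x y : ℝ → EuclideanSpace ℝ (Fin n)) (Icc 0 1) t = y - x :=
  AffineMap.hasDerivWithinAt_lineMap.derivWithin (uniqueDiffOn_Icc zero_lt_one t ht)

theorem contDiffOn_lineMap (x y : EuclideanSpace ℝ (Fin n)) (s : Set ℝ) :
    ContDiffOn ℝ 1 (AffineMap.lineMap x y : ℝ → EuclideanSpace ℝ (Fin n)) s := by
  have : (AffineMap.lineMap x y : ℝ → EuclideanSpace ℝ (Fin n)) = fun t => t • (y - x) + x := by
    ext1 t; exact AffineMap.lineMap_apply_module' x y t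
  rw [this]
  fun_prop

theorem gDist_le_of_segment {m : ℝ} (hm : 0 < m) {x y : EuclideanSpace ℝ (Fin n)}
    (hseg : ∀ t ∈ Icc (0 : ℝ) 1, ‖AffineMap.lineMap x y t‖ ∈ I ∧
      m ≤ v ‖AffineMap.lineMap x y t‖) :
    gDist v I x y ≤ ENNReal.ofReal (‖y - x‖ / m) := by
  refine (iInf₂_le (AffineMap.lineMap x y : ℝ → EuclideanSpace ℝ (Fin n))
    ⟨contDiffOn_lineMap x y _, fun t ht => (hseg t ht).1, by simp, by simp⟩).trans ?_
  unfold pathLen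
  calc _ ≤ ∫⁻ t in Icc (0 : ℝ) 1, ENNReal.ofReal (‖y - x‖ / m) := by
        refine setLIntegral_mono' measurableSet_Icc fun t ht => ?_
        rw [derivWithin_lineMap x y ht]
        apply ENNReal.ofReal_le_ofReal
        exact div_le_div_of_nonneg_left (norm_nonneg _) hm (hseg t ht).2
    _ = _ := by simp

theorem gDist_radial_le (hIc : I.OrdConnected) (hI0 : I ⊆ Ioi 0)
    (hv : ∀ r ∈ I, 0 < v r) (hvc : ContinuousOn v I)
    (hΦ : ∀ r ∈ I, HasDerivAt Φ (1 / v r) r) {e : EuclideanSpace ℝ (Fin n)} (he : ‖e‖ = 1)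
    {r r' : ℝ} (hr : r ∈ I) (hr' : r' ∈ I) :
    gDist v I (r • e) (r' • e) ≤ ENNReal.ofReal |Φ r' - Φ r| := by
  have hmem : ∀ t ∈ Icc (0 : ℝ) 1, r + t * (r' - r) ∈ I := by
    intro t ht
    have hc := hIc.convex hr hr' (sub_nonneg.2 ht.2) ht.1 (by ring)
    have : (1 - t) • r + t • r' = r + t * (r' - r) := by simp only [smul_eq_mul]; ring
    rwa [this] at hc
  have hline : ∀ t, (AffineMap.lineMap (r • e) (r' • e) t : EuclideanSpace ℝ (Fin n)) =
      (r + t * (r' - r)) • e := by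
    intro t
    rw [AffineMap.lineMap_apply_module']
    module
  have hnorm : ∀ t ∈ Icc (0 : ℝ) 1,
      ‖(AffineMap.lineMap (r • e) (r' • e) t : EuclideanSpace ℝ (Fin n))‖ = r + t * (r' - r) := by
    intro t ht
    rw [hline, norm_smul, he, mul_one, Real.norm_eq_abs, abs_of_pos (hI0 (hmem t ht))]
  have hshell : MapsTo (AffineMap.lineMap (r • e) (r' • e) : ℝ → EuclideanSpace ℝ (Fin n))
      (Icc 0 1) (shell n I) := fun t ht => by
    change ‖(AffineMap.lineMap (r • e) (r' • e) t : EuclideanSpace ℝ (Fin n))‖ ∈ I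
    rw [hnorm t ht]; exact hmem t ht
  refine (iInf₂_le (AffineMap.lineMap (r • e) (r' • e) : ℝ → EuclideanSpace ℝ (Fin n))
    ⟨contDiffOn_lineMap _ _ _, hshell, by simp, by simp⟩).trans ?_
  obtain ⟨σ, hσ, hσ1⟩ : ∃ σ : ℝ, |r' - r| = σ * (r' - r) ∧ |σ| ≤ 1 := by
    rcases abs_choice (r' - r) with h | h
    · exact ⟨1, by rw [h, one_mul], by simp⟩
    · exact ⟨-1, by rw [h]; ring, by simp⟩
  have hd : ∀ t ∈ uIcc (0 : ℝ) 1, HasDerivAt (fun t => σ * Φ (r + t * (r' - r)))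
      (|r' - r| / v (r + t * (r' - r))) t := by
    intro t ht
    rw [uIcc_of_le zero_le_one] at ht
    have := ((hΦ _ (hmem t ht)).comp t
      (((hasDerivAt_id t).mul_const (r' - r)).const_add r)).const_mul σ
    refine this.congr_deriv ?_
    rw [hσ]
    ring
  have hcont : ContinuousOn (fun t => |r' - r| / v (r + t * (r' - r))) (Icc (0 : ℝ) 1) := by
    refine continuousOn_const.div (hvc.comp (by fun_prop) hmem) fun t ht => (hv _ (hmem t ht)).ne'
  have hint : IntervalIntegrable (fun t => |r' - r| / v (r + t * (r' - r))) volume 0 1 := by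
    apply ContinuousOn.intervalIntegrable
    rwa [uIcc_of_le zero_le_one]
  have hFTC := intervalIntegral.integral_eq_sub_of_hasDerivAt hd hint
  have e1 : pathLen v (AffineMap.lineMap (r • e) (r' • e) : ℝ → EuclideanSpace ℝ (Fin n)) =
      ∫⁻ t in Icc (0 : ℝ) 1, ENNReal.ofReal (|r' - r| / v (r + t * (r' - r))) := by
    refine setLIntegral_congr_fun measurableSet_Icc fun t ht => ?_
    rw [derivWithin_lineMap _ _ ht, hnorm t ht, ← sub_smul, norm_smul, he, mul_one,
      Real.norm_eq_abs]
  rw [e1, ← ofReal_integral_eq_lintegral_ofReal]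
  · apply ENNReal.ofReal_le_ofReal
    rw [integral_Icc_eq_integral_Ioc, ← intervalIntegral.integral_of_le zero_le_one, hFTC,
      one_mul, zero_mul, add_zero, add_sub_cancel, ← mul_sub]
    refine (le_abs_self _).trans ?_
    rw [abs_mul]
    exact mul_le_of_le_one_left (abs_nonneg _) hσ1
  · exact hcont.integrableOn_Icc
  · filter_upwards [self_mem_ae_restrict measurableSet_Icc] with t ht
    have := hv _ (hmem t ht)
    exact div_nonneg (abs_nonneg _) this.le

theorem strictMonoOn_of_hasDerivAt_one_div (hI : IsOpen I) (hIc : I.OrdConnected)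
    (hv : ∀ r ∈ I, 0 < v r) (hΦ : ∀ r ∈ I, HasDerivAt Φ (1 / v r) r) : StrictMonoOn Φ I := by
  refine strictMonoOn_of_deriv_pos hIc.convex
    (fun r hr => (hΦ r hr).continuousAt.continuousWithinAt) fun r hr => ?_
  rw [hI.interior_eq] at hr
  rw [(hΦ r hr).deriv]
  exact one_div_pos.2 (hv r hr)

/-- A part `{|x| ∈ J}` of `{|x| ∈ I}` is complete as soon as `Φ(J)` is closed, `Φ' = 1 / v`: the
radius of a Cauchy sequence then converges in `J`, and near the limit radius the metric is uniformly
equivalent to the Euclidean one. -/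
theorem isCompletePart_of_isClosed_image (hI : IsOpen I) (hIc : I.OrdConnected) (hI0 : I ⊆ Ioi 0)
    (hv : ∀ r ∈ I, 0 < v r) (hvc : ContinuousOn v I)
    (hΦ : ∀ r ∈ I, HasDerivAt Φ (1 / v r) r) {J : Set ℝ} (hJI : J ⊆ I) (hJ : IsClosed (Φ '' J)) :
    IsCompletePart n v I J := by
  intro x hx hC
  have hmono := strictMonoOn_of_hasDerivAt_one_div hI hIc hv hΦ
  have hlow := ofReal_abs_sub_le_gDist (n := n) hI hI0 hv hvc hΦ
  have hcau : CauchySeq fun i => Φ ‖x i‖ := by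
    rw [Metric.cauchySeq_iff]
    intro ε hε
    obtain ⟨N, hN⟩ := hC (ENNReal.ofReal ε) (by simpa using hε)
    refine ⟨N, fun i hi j hj => ?_⟩
    have := (hlow (x j) (x i)).trans_lt (hN j hj i hi)
    rwa [ENNReal.ofReal_lt_ofReal_iff hε] at this
  obtain ⟨c, hc⟩ := cauchySeq_tendsto_of_complete hcau
  obtain ⟨R, hRJ, rfl⟩ := hJ.mem_of_tendsto hc
    (Eventually.of_forall fun i => mem_image_of_mem Φ (hx i))
  have hRI := hJI hRJ
  obtain ⟨δ, hδ, hball⟩ := Metric.nhds_basis_closedBall.mem_iff.1 (hI.mem_nhds hRI)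
  rw [Real.closedBall_eq_Icc] at hball
  have hb1 : R - δ ∈ I := hball ⟨le_rfl, by linarith⟩
  have hb2 : R + δ ∈ I := hball ⟨by linarith, le_rfl⟩
  have hne : (Icc (R - δ) (R + δ)).Nonempty := ⟨R, by constructor <;> linarith⟩
  obtain ⟨rm, hrm, hm⟩ := isCompact_Icc.exists_isMinOn hne (hvc.mono hball)
  obtain ⟨rM, hrM, hM⟩ := isCompact_Icc.exists_isMaxOn hne (hvc.mono hball)
  have hmpos := hv _ (hball hrm)
  have hMpos := hv _ (hball hrM)
  set ε₀ := min (Φ (R + δ) - Φ R) (Φ R - Φ (R - δ)) with hε₀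
  have hε₀pos : 0 < ε₀ := lt_min (sub_pos.2 (hmono hRI hb2 (by linarith)))
    (sub_pos.2 (hmono hb1 hRI (by linarith)))
  have hloc : ∀ r ∈ I, |Φ r - Φ R| < ε₀ → r ∈ Icc (R - δ) (R + δ) := by
    intro r hr h
    rw [abs_lt] at h
    constructor
    · refine ((hmono.lt_iff_lt hb1 hr).1 ?_).le
      linarith [min_le_right (Φ (R + δ) - Φ R) (Φ R - Φ (R - δ))]
    · refine ((hmono.lt_iff_lt hr hb2).1 ?_).le
      linarith [min_le_left (Φ (R + δ) - Φ R) (Φ R - Φ (R - δ))]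
  obtain ⟨N₁, hN₁⟩ := Metric.tendsto_atTop.1 hc (ε₀ / 2) (by linarith)
  -- Cauchy for the Euclidean distance
  have hcau2 : CauchySeq x := by
    rw [Metric.cauchySeq_iff]
    intro ε hε
    have hε' : 0 < min (ε₀ / 2) (ε / v rM) := lt_min (by linarith) (by positivity)
    obtain ⟨N₂, hN₂⟩ := hC (ENNReal.ofReal (min (ε₀ / 2) (ε / v rM))) (by simpa using hε')
    refine ⟨max N₁ N₂, fun i hi j hj => ?_⟩
    have hlt := hN₂ i (le_of_max_le_right hi) j (le_of_max_le_right hj)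
    unfold gDist at hlt
    simp only [iInf_lt_iff] at hlt
    obtain ⟨γ, ⟨hγ1, hγ2, hγ3, hγ4⟩, hlen⟩ := hlt
    have hγV : ∀ t ∈ Icc (0 : ℝ) 1, 0 < v ‖γ t‖ ∧ v ‖γ t‖ ≤ v rM := by
      intro t ht
      refine ⟨hv _ (hγ2 ht), hM (hloc _ (hγ2 ht) ?_)⟩
      have h1 := (enorm_sub_le_pathLen hI hI0 hv hvc hΦ hγ1 hγ2 ht).trans_lt hlen
      rw [ENNReal.ofReal_lt_ofReal_iff hε', hγ3] at h1
      have h2 := hN₁ i (le_of_max_le_left hi)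
      rw [Real.dist_eq] at h2
      calc |Φ ‖γ t‖ - Φ R| ≤ |Φ ‖γ t‖ - Φ ‖x i‖| + |Φ ‖x i‖ - Φ R| := abs_sub_le _ _ _
        _ < ε₀ / 2 + ε₀ / 2 := add_lt_add (h1.trans_le (min_le_left _ _)) h2
        _ = ε₀ := by ring
    have h3 := (ofReal_norm_sub_div_le_pathLen hMpos hγ1 hγV).trans_lt hlen
    rw [ENNReal.ofReal_lt_ofReal_iff hε', hγ3, hγ4] at h3
    have h4 := h3.trans_le (min_le_right _ _)
    rw [div_lt_div_iff_of_pos_right hMpos] at h4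
    rwa [dist_comm, dist_eq_norm]
  obtain ⟨y, hy⟩ := cauchySeq_tendsto_of_complete hcau2
  have hxy : Tendsto (fun i => ‖x i‖) atTop (𝓝 ‖y‖) := hy.norm
  have hyIcc : ‖y‖ ∈ Icc (R - δ) (R + δ) := by
    refine isClosed_Icc.mem_of_tendsto hxy ?_
    filter_upwards [eventually_ge_atTop N₁] with i hi
    refine hloc _ (hJI (hx i)) ?_
    have h2 := hN₁ i hi
    rw [Real.dist_eq] at h2
    linarith
  have hyR : ‖y‖ = R := by
    refine hmono.injOn (hball hyIcc) hRI ?_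
    exact tendsto_nhds_unique (((hΦ _ (hball hyIcc)).continuousAt.tendsto).comp hxy) hc
  refine ⟨y, by change ‖y‖ ∈ J; rwa [hyR], ?_⟩
  have hz : Tendsto (fun i => ENNReal.ofReal (‖y - x i‖ / v rm)) atTop (𝓝 0) := by
    have h1 : Tendsto (fun i => ‖y - x i‖ / v rm) atTop (𝓝 (‖y - y‖ / v rm)) :=
      ((tendsto_const_nhds.sub hy).norm).div_const _
    simpa [Function.comp_def] using (ENNReal.continuous_ofReal.tendsto _).comp h1
  refine tendsto_of_tendsto_of_tendsto_of_le_of_le' tendsto_const_nhds hz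
    (Eventually.of_forall fun _ => zero_le) ?_
  filter_upwards [Metric.tendsto_nhds.1 hy δ hδ] with i hi
  refine gDist_le_of_segment hmpos fun t ht => ?_
  have hmem : ‖(AffineMap.lineMap (x i) y t : EuclideanSpace ℝ (Fin n))‖ ∈
      Icc (R - δ) (R + δ) := by
    have h1 : dist (AffineMap.lineMap (x i) y t : EuclideanSpace ℝ (Fin n)) y ≤ δ := by
      rw [dist_lineMap_right, Real.norm_eq_abs, abs_of_nonneg (sub_nonneg.2 ht.2)]
      nlinarith [ht.1, dist_nonneg (x := x i) (y := y)]
    rw [dist_eq_norm] at h1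
    have h2 := (abs_norm_sub_norm_le (AffineMap.lineMap (x i) y t) y).trans h1
    rw [hyR, abs_le] at h2
    constructor <;> linarith
  exact ⟨hball hmem, hm hmem⟩

/-- If the radius `0` is at finite distance, the metric on `ℝⁿ ∖ {0}` is incomplete. -/
theorem not_isCompleteMetric (hn : 0 < n) (hv : ∀ r ∈ Ioi (0 : ℝ), 0 < v r)
    (hvc : ContinuousOn v (Ioi 0)) (hΦ : ∀ r ∈ Ioi (0 : ℝ), HasDerivAt Φ (1 / v r) r) {L : ℝ}
    (hL : Tendsto Φ (𝓝[>] 0) (𝓝 L)) : ¬ IsCompleteMetric n v (Ioi 0) := by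
  intro hcomp
  have hmono := strictMonoOn_of_hasDerivAt_one_div isOpen_Ioi ordConnected_Ioi hv hΦ
  have hlow := ofReal_abs_sub_le_gDist (n := n) isOpen_Ioi Subset.rfl hv hvc hΦ
  let e : EuclideanSpace ℝ (Fin n) := EuclideanSpace.single ⟨0, hn⟩ 1
  have he : ‖e‖ = 1 := by simp [e]
  let ρ : ℕ → ℝ := fun i => 1 / ((i : ℝ) + 1)
  have hρ : ∀ i, 0 < ρ i := fun i => by simp only [ρ]; positivity
  have hρ0 : Tendsto ρ atTop (𝓝[>] 0) := by
    rw [tendsto_nhdsWithin_iff]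
    exact ⟨tendsto_one_div_add_atTop_nhds_zero_nat, Eventually.of_forall hρ⟩
  have hΦρ := hL.comp hρ0
  have hnorm : ∀ i, ‖ρ i • e‖ = ρ i := fun i => by
    rw [norm_smul, he, mul_one, Real.norm_eq_abs, abs_of_pos (hρ i)]
  obtain ⟨y, hy, hlim⟩ := hcomp (fun i => ρ i • e) (fun i => by
      change ‖ρ i • e‖ ∈ Ioi 0; rw [hnorm]; exact hρ i) (by
    intro ε hε
    obtain ⟨ε', hε', hεε⟩ := ENNReal.lt_iff_exists_real_btwn.1 hε
    have hpos : 0 < ε' := by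
      rcases lt_or_ge 0 ε' with h | h
      · exact h
      · rw [ENNReal.ofReal_of_nonpos h] at hεε; exact absurd hεε.1 (lt_irrefl _)
    obtain ⟨N, hN⟩ := Metric.cauchySeq_iff.1 hΦρ.cauchySeq ε' hpos
    refine ⟨N, fun i hi j hj => ?_⟩
    refine (gDist_radial_le ordConnected_Ioi Subset.rfl hv hvc hΦ he (hρ i)
      (hρ j)).trans_lt (lt_trans ?_ hεε.2)
    rw [ENNReal.ofReal_lt_ofReal_iff hpos]
    exact hN j hj i hi)
  have hy0 : 0 < ‖y‖ := hy
  have h1 : Tendsto (fun i => ENNReal.ofReal |Φ ‖y‖ - Φ (ρ i)|) atTop (𝓝 0) := by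
    refine tendsto_of_tendsto_of_tendsto_of_le_of_le tendsto_const_nhds hlim
      (fun _ => zero_le) fun i => ?_
    have := hlow (ρ i • e) y
    rwa [hnorm] at this
  have h2 : Tendsto (fun i => ENNReal.ofReal |Φ ‖y‖ - Φ (ρ i)|) atTop
      (𝓝 (ENNReal.ofReal |Φ ‖y‖ - L|)) :=
    (ENNReal.continuous_ofReal.tendsto _).comp ((tendsto_const_nhds.sub hΦρ).abs)
  have h3 := tendsto_nhds_unique h2 h1
  have h4 : Φ ‖y‖ = L := by
    have : |Φ ‖y‖ - L| ≤ 0 := by simpa using h3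
    linarith [abs_nonpos_iff.1 this]
  have h5 : L ≤ Φ (‖y‖ / 2) := by
    refine le_of_tendsto hL ?_
    filter_upwards [Ioo_mem_nhdsGT (half_pos hy0)] with r hr
    exact (hmono (mem_Ioi.2 hr.1) (mem_Ioi.2 (half_pos hy0)) hr.2).le
  have h6 := hmono (mem_Ioi.2 (half_pos hy0)) (mem_Ioi.2 hy0) (half_lt_self hy0)
  linarith

end RadialDistance

/-! ### Stereographic projection -/

/-- Stereographic projection of the unit sphere from `p`, with the scale `ρ`, is the restriction of
an inversion with center `p` to a hyperplane orthogonal to `p`. -/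
theorem isRoundMetric_of_pos {n : ℕ} {ρ : ℝ} (hρ : 0 < ρ) :
    IsRoundMetric n (fun x => (2 * ρ / (‖x‖ ^ 2 + ρ ^ 2)) ^ 2) := by
  let F := EuclideanSpace ℝ (Fin (n + 1))
  let p : F := EuclideanSpace.single (Fin.last n) 1
  have hp : ‖p‖ = 1 := (PiLp.norm_single 2 _ _ _).trans norm_one
  have hpp : inner ℝ p p = (1 : ℝ) := by rw [real_inner_self_eq_norm_sq, hp, one_pow]
  have hp0 : p ≠ 0 := by rw [← norm_pos_iff, hp]; exact one_pos
  have : Fact (Module.finrank ℝ F = n + 1) := ⟨by simp [F]⟩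
  let B := OrthonormalBasis.fromOrthogonalSpanSingleton n hp0 (𝕜 := ℝ)
  let L : EuclideanSpace ℝ (Fin n) →ₗᵢ[ℝ] F :=
    (Submodule.subtypeₗᵢ (ℝ ∙ p)ᗮ).comp B.repr.symm.toLinearIsometry
  have hLp : ∀ x, inner ℝ p (L x) = (0 : ℝ) := fun x =>
    Submodule.mem_orthogonal_singleton_iff_inner_right.1 (B.repr.symm x).2
  have hLr : ∀ y : F, inner ℝ p y = (0 : ℝ) → ∃ x, L x = y := fun y hy =>
    ⟨B.repr ⟨y, Submodule.mem_orthogonal_singleton_iff_inner_right.2 hy⟩, by simp [L]⟩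
  let c : EuclideanSpace ℝ (Fin n) → F := fun x => L x + (1 - ρ) • p
  have hcp : ∀ x, c x - p = L x - ρ • p := fun x => by simp only [c]; module
  have hN : ∀ x, ‖c x - p‖ ^ 2 = ‖x‖ ^ 2 + ρ ^ 2 := fun x => by
    rw [hcp, norm_sub_sq_real, inner_smul_right, real_inner_comm, hLp, norm_smul, hp, L.norm_map,
      Real.norm_eq_abs, mul_one, sq_abs]
    ring
  have hNpos : ∀ x : EuclideanSpace ℝ (Fin n), 0 < ‖x‖ ^ 2 + ρ ^ 2 := fun x => by positivity
  have hne : ∀ x, c x ≠ p := fun x h => by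
    have := hN x
    rw [h, sub_self, norm_zero] at this
    linarith [hNpos x]
  have hR : √(2 * ρ) ^ 2 = 2 * ρ := Real.sq_sqrt (by positivity)
  have hR0 : √(2 * ρ) ≠ 0 := (Real.sqrt_pos.2 (by positivity)).ne'
  let Φ : EuclideanSpace ℝ (Fin n) → F := fun x => EuclideanGeometry.inversion p √(2 * ρ) (c x)
  have hcinj : Function.Injective c := fun x y h => L.injective (add_right_cancel h)
  have hinv : ∀ y : F, EuclideanGeometry.inversion p √(2 * ρ) y =
      (2 * ρ / ‖y - p‖ ^ 2) • (y - p) + p := fun y => by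
    rw [EuclideanGeometry.inversion, div_pow, hR, dist_eq_norm, vsub_eq_sub, vadd_eq_add]
  refine ⟨p, Φ, by simpa using hp, ?_, ?_, ?_, ?_, ?_⟩
  · exact ContDiff.inversion contDiff_const contDiff_const
      (L.contDiff.add contDiff_const) fun x => hne x
  · exact (EuclideanGeometry.inversion_injective p hR0).comp hcinj
  · ext y
    constructor
    · rintro ⟨x, rfl⟩
      refine ⟨?_, ?_⟩
      · rw [mem_sphere_zero_iff_norm]
        have h1 : ‖Φ x‖ ^ 2 = 1 := by
          simp only [Φ]
          rw [hinv, norm_add_sq_real, norm_smul, mul_pow, inner_smul_left, hN, hcp, inner_sub_left,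
            inner_smul_left, hpp, real_inner_comm, hLp, hp, Real.norm_eq_abs, sq_abs]
          have := (hNpos x).ne'
          simp
          field_simp
          ring
        exact (pow_eq_one_iff_of_nonneg (norm_nonneg _) two_ne_zero).1 h1
      · rw [mem_singleton_iff]
        exact fun h => hne x ((EuclideanGeometry.inversion_eq_center hR0).1 h)
    · rintro ⟨hy1, hy2⟩
      rw [mem_sphere_zero_iff_norm] at hy1
      rw [mem_singleton_iff] at hy2
      have hy0 : ‖y - p‖ ≠ 0 := norm_ne_zero_iff.2 (sub_ne_zero.2 hy2)
      have hyp : ‖y - p‖ ^ 2 = 2 - 2 * inner ℝ p y := by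
        rw [norm_sub_sq_real, hy1, hp, real_inner_comm]; ring
      obtain ⟨x, hx⟩ := hLr (EuclideanGeometry.inversion p √(2 * ρ) y - (1 - ρ) • p) (by
        rw [hinv, inner_sub_right, inner_add_right, inner_smul_right, inner_smul_right,
          inner_sub_right, hpp]
        have h2 : inner ℝ p y - 1 = -(‖y - p‖ ^ 2) / 2 := by rw [hyp]; ring
        rw [h2]
        field_simp
        ring)
      refine ⟨x, ?_⟩
      have : c x = EuclideanGeometry.inversion p √(2 * ρ) y := by simp only [c]; rw [hx]; abel
      simp only [Φ]
      rw [this]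
      exact EuclideanGeometry.inversion_inversion p hR0 y
  · rw [tendsto_iff_dist_tendsto_zero]
    have h1 : ∀ x, dist (Φ x) p = 2 * ρ / √(‖x‖ ^ 2 + ρ ^ 2) := fun x => by
      simp only [Φ]
      rw [EuclideanGeometry.dist_inversion_center, hR, dist_eq_norm, ← hN,
        Real.sqrt_sq (norm_nonneg _)]
    have h2 : Tendsto (fun x : EuclideanSpace ℝ (Fin n) => 2 * ρ / ‖x‖) (cocompact _) (𝓝 0) :=
      tendsto_const_nhds.div_atTop tendsto_norm_cocompact_atTop
    refine squeeze_zero' (Eventually.of_forall fun x => dist_nonneg) ?_ h2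
    filter_upwards [tendsto_norm_cocompact_atTop.eventually_gt_atTop 0] with x hx
    rw [h1]
    have : ‖x‖ ≤ √(‖x‖ ^ 2 + ρ ^ 2) := Real.le_sqrt_of_sq_le (by nlinarith)
    gcongr
  · intro x w
    have hc' : HasFDerivAt c (L.toContinuousLinearMap) x :=
      L.toContinuousLinearMap.hasFDerivAt.add_const _
    have hd := ((EuclideanGeometry.hasFDerivAt_inversion (R := √(2 * ρ)) (hne x)).comp x hc').fderiv
    have hd' : fderiv ℝ Φ x = _ := hd
    rw [hd']
    simp only [ContinuousLinearMap.comp_apply, smul_apply]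
    rw [norm_smul, mul_pow, div_pow, hR, dist_eq_norm, hN, Real.norm_eq_abs, sq_abs]
    congr 2
    exact (LinearIsometryEquiv.norm_map _ _).trans (L.norm_map w)

/-! ### Ends of an open interval -/

section Ends

variable {s : Set ℝ}

theorem IsOpen.lt_of_isLUB (hs : IsOpen s) {b : ℝ} (hb : IsLUB s b) {t : ℝ} (ht : t ∈ s) :
    t < b := by
  refine lt_of_le_of_ne (hb.1 ht) ?_
  rintro rfl
  obtain ⟨u, hu, hsub⟩ := exists_Ico_subset_of_mem_nhds (hs.mem_nhds ht) ⟨t + 1, by linarith⟩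
  have : (t + u) / 2 ∈ s := hsub ⟨by linarith, by linarith⟩
  linarith [hb.1 this]

theorem IsOpen.lt_of_isGLB (hs : IsOpen s) {a : ℝ} (ha : IsGLB s a) {t : ℝ} (ht : t ∈ s) :
    a < t := by
  refine lt_of_le_of_ne (ha.1 ht) ?_
  rintro rfl
  obtain ⟨u, hu, hsub⟩ := exists_Ioc_subset_of_mem_nhds (hs.mem_nhds ht) ⟨a - 1, by linarith⟩
  have : (a + u) / 2 ∈ s := hsub ⟨by linarith, by linarith⟩
  linarith [ha.1 this]

theorem Set.OrdConnected.Ico_subset_of_isLUB (hc : s.OrdConnected) {b : ℝ} (hb : IsLUB s b)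
    {t : ℝ} (ht : t ∈ s) : Ico t b ⊆ s := fun u hu => by
  obtain ⟨w, hw, huw, -⟩ := hb.exists_between hu.2
  exact hc.out ht hw ⟨hu.1, huw.le⟩

theorem Set.OrdConnected.Ioc_subset_of_isGLB (hc : s.OrdConnected) {a : ℝ} (ha : IsGLB s a)
    {t : ℝ} (ht : t ∈ s) : Ioc a t ⊆ s := fun u hu => by
  obtain ⟨w, hw, -, huw⟩ := ha.exists_between hu.1
  exact hc.out hw ht ⟨huw.le, hu.2⟩

theorem Set.OrdConnected.Ici_subset_or_isLUB (hc : s.OrdConnected) (hne : s.Nonempty) :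
    (∀ t ∈ s, Ici t ⊆ s) ∨ ∃ b, IsLUB s b := by
  by_cases h : BddAbove s
  · exact Or.inr ⟨_, isLUB_csSup hne h⟩
  · refine Or.inl fun t ht u hu => ?_
    obtain ⟨w, hw, huw⟩ := not_bddAbove_iff.1 h u
    exact hc.out ht hw ⟨hu, huw.le⟩

theorem Set.OrdConnected.Iic_subset_or_isGLB (hc : s.OrdConnected) (hne : s.Nonempty) :
    (∀ t ∈ s, Iic t ⊆ s) ∨ ∃ a, IsGLB s a := by
  by_cases h : BddBelow s
  · exact Or.inr ⟨_, isGLB_csInf hne h⟩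
  · refine Or.inl fun t ht u hu => ?_
    obtain ⟨w, hw, huw⟩ := not_bddBelow_iff.1 h u
    exact hc.out hw ht ⟨huw.le, hu⟩

theorem eq_Ioo_of_isGLB_isLUB (ho : IsOpen s) (hc : s.OrdConnected) (hne : s.Nonempty) {a b : ℝ}
    (ha : IsGLB s a) (hb : IsLUB s b) : s = Ioo a b := by
  obtain ⟨t, ht⟩ := hne
  ext u
  refine ⟨fun hu => ⟨ho.lt_of_isGLB ha hu, ho.lt_of_isLUB hb hu⟩, fun hu => ?_⟩
  rcases le_total u t with h | h
  · exact hc.Ioc_subset_of_isGLB ha ht ⟨hu.1, h⟩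
  · exact hc.Ico_subset_of_isLUB hb ht ⟨h, hu.2⟩

theorem eq_Iio_of_isLUB (ho : IsOpen s) (hc : s.OrdConnected) (hne : s.Nonempty) {b : ℝ}
    (ha : ∀ t ∈ s, Iic t ⊆ s) (hb : IsLUB s b) : s = Iio b := by
  obtain ⟨t, ht⟩ := hne
  ext u
  refine ⟨fun hu => ho.lt_of_isLUB hb hu, fun hu => ?_⟩
  rcases le_total u t with h | h
  · exact ha t ht h
  · exact hc.Ico_subset_of_isLUB hb ht ⟨h, hu⟩

theorem eq_univ_of_Iic_Ici (hne : s.Nonempty) (ha : ∀ t ∈ s, Iic t ⊆ s)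
    (hb : ∀ t ∈ s, Ici t ⊆ s) : s = univ := by
  obtain ⟨t, ht⟩ := hne
  ext u
  refine ⟨fun _ => mem_univ _, fun _ => ?_⟩
  rcases le_total u t with h | h
  · exact ha t ht h
  · exact hb t ht h

theorem radii_univ : radii univ = Ioi 0 := by ext r; simp [radii]

theorem radii_Iio (b : ℝ) : radii (Iio b) = Ioo 0 (Real.exp b) := by
  ext r
  simp only [radii, mem_ofPred_eq, mem_Iio, mem_Ioo]
  refine and_congr_right fun hr => Real.log_lt_iff_lt_exp hr

theorem radii_Ioo (a b : ℝ) : radii (Ioo a b) = Ioo (Real.exp a) (Real.exp b) := by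
  ext r
  simp only [radii, mem_ofPred_eq, mem_Ioo]
  constructor
  · rintro ⟨hr, h1, h2⟩
    exact ⟨(Real.lt_log_iff_exp_lt hr).1 h1, (Real.log_lt_iff_lt_exp hr).1 h2⟩
  · rintro ⟨h1, h2⟩
    have hr := (Real.exp_pos a).trans h1
    exact ⟨hr, (Real.lt_log_iff_exp_lt hr).2 h1, (Real.log_lt_iff_lt_exp hr).2 h2⟩

theorem tendsto_log_nhdsGT_exp (a : ℝ) : Tendsto Real.log (𝓝[>] Real.exp a) (𝓝[>] a) := by
  rw [tendsto_nhdsWithin_iff]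
  constructor
  · have := (Real.continuousAt_log (Real.exp_pos a).ne').tendsto
    rw [Real.log_exp] at this
    exact this.mono_left nhdsWithin_le_nhds
  · filter_upwards [self_mem_nhdsWithin] with r hr
    exact (Real.lt_log_iff_exp_lt ((Real.exp_pos a).trans hr)).2 hr

theorem tendsto_log_nhdsLT_exp (b : ℝ) : Tendsto Real.log (𝓝[<] Real.exp b) (𝓝[<] b) := by
  rw [tendsto_nhdsWithin_iff]
  constructor
  · have := (Real.continuousAt_log (Real.exp_pos b).ne').tendsto
    rw [Real.log_exp] at this
    exact this.mono_left nhdsWithin_le_nhds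
  · filter_upwards [Ioo_mem_nhdsLT (Real.exp_pos b)] with r hr
    exact (Real.log_lt_iff_lt_exp hr.1).2 hr.2

end Ends

/-! ### Limits from bounds on the derivative -/

theorem exists_tendsto_nhdsGT_of_bounded_deriv {f f' : ℝ → ℝ} {a c C : ℝ} (hac : a < c)
    (hf : ∀ t ∈ Ioo a c, HasDerivAt f (f' t) t) (hC : ∀ t ∈ Ioo a c, |f' t| ≤ C) :
    ∃ l, Tendsto f (𝓝[>] a) (𝓝 l) := by
  have hC0 : 0 ≤ C := (abs_nonneg _).trans (hC ((a + c) / 2) ⟨by linarith, by linarith⟩)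
  have hL : LipschitzOnWith C.toNNReal f (Ioo a c) :=
    (convex_Ioo a c).lipschitzOnWith_of_nnnorm_hasDerivWithin_le
      (fun t ht => (hf t ht).hasDerivWithinAt) fun t ht => by
        rw [← NNReal.coe_le_coe, coe_nnnorm, Real.coe_toNNReal _ hC0]; exact hC t ht
  obtain ⟨g, hg, hfg⟩ := hL.extend_real
  refine ⟨g a, (hg.continuous.continuousAt.mono_left nhdsWithin_le_nhds).congr' ?_⟩
  filter_upwards [Ioo_mem_nhdsGT hac] with t ht
  exact (hfg ht).symm

theorem exists_tendsto_atBot_of_exp_bound {f f' : ℝ → ℝ} {c C δ : ℝ} (hδ : 0 < δ)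
    (hf : ∀ t ≤ c, HasDerivAt f (f' t) t) (hf'c : ContinuousOn f' (Iic c))
    (hC : ∀ t ≤ c, |f' t| ≤ C * Real.exp (δ * t)) : ∃ l, Tendsto f atBot (𝓝 l) := by
  refine ⟨_, tendsto_limUnder_of_hasDerivAt_of_integrableOn_Iic (a := c) (f' := f')
    (fun t ht => hf t ht) ?_⟩
  refine Integrable.mono' ((integrableOn_exp_mul_Iic hδ c).const_mul C)
    (hf'c.aestronglyMeasurable measurableSet_Iic) ?_
  filter_upwards [self_mem_ae_restrict measurableSet_Iic] with t ht
  exact hC t ht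

/-! ### Behaviour of a trajectory at a finite end -/

/-- The value `|1 - ξ_t²| = |1 + h e^{nξ}|^{1/k} e^{-2ξ}` that the first integral assigns to
`x = ξ`. -/
noncomputable def gap (n k : ℕ) (h x : ℝ) : ℝ :=
  |1 + h * Real.exp (n * x)| ^ (1 / (k : ℝ)) * Real.exp (-2 * x)

theorem gap_nonneg (n k : ℕ) (h x : ℝ) : 0 ≤ gap n k h x := by unfold gap; positivity

theorem continuous_gap (n k : ℕ) (h : ℝ) : Continuous (gap n k h) := by
  unfold gap
  have : Continuous fun x => |1 + h * Real.exp (n * x)| := by fun_prop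
  exact (this.rpow_const fun x => Or.inr (by positivity)).mul (by fun_prop)

theorem gap_eq_zero_iff {n k : ℕ} (hk : 0 < k) {h x : ℝ} :
    gap n k h x = 0 ↔ 1 + h * Real.exp (n * x) = 0 := by
  have hk' : (1 / (k : ℝ)) ≠ 0 := by positivity
  unfold gap
  rw [mul_eq_zero, or_iff_left (Real.exp_pos _).ne', Real.rpow_eq_zero (abs_nonneg _) hk',
    abs_eq_zero]

theorem gap_mul_exp {n k : ℕ} (hk : 0 < k) (h x : ℝ) :
    gap n k h x * Real.exp ((2 - (n : ℝ) / k) * x) =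
      |Real.exp (-n * x) + h| ^ (1 / (k : ℝ)) := by
  have hk' : (k : ℝ) ≠ 0 := by positivity
  have e1 : Real.exp (-n * x) + h = Real.exp (-n * x) * (1 + h * Real.exp (n * x)) := by
    rw [mul_add, mul_one, mul_left_comm, ← Real.exp_add]; simp
  rw [e1, abs_mul, abs_of_pos (Real.exp_pos _), Real.mul_rpow (Real.exp_pos _).le (abs_nonneg _),
    ← Real.exp_mul]
  unfold gap
  rw [mul_assoc, ← Real.exp_add, mul_comm]
  congr 2
  field_simp
  ring

namespace Trajectory

variable {n k : ℕ} {h : ℝ} {ξ p : ℝ → ℝ} {s : Set ℝ}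

theorem abs_one_sub_sq (H : Trajectory n k h ξ p s) (hk : 0 < k) {t : ℝ} (ht : t ∈ s) :
    |1 - p t ^ 2| = gap n k h (ξ t) := by
  have e := H.energy t ht
  unfold gap
  rw [← e, abs_mul, abs_pow, abs_of_pos (Real.exp_pos _),
    Real.mul_rpow (by positivity) (Real.exp_pos _).le, ← Real.exp_mul, one_div,
    Real.pow_rpow_inv_natCast (abs_nonneg _) hk.ne', mul_assoc, ← Real.exp_add]
  have hk' : (k : ℝ) ≠ 0 := by positivity
  rw [show 2 * (k : ℝ) * ξ t * (k : ℝ)⁻¹ + -2 * ξ t = 0 by field_simp; ring]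
  simp

theorem eq_gap_of_pos (H : Trajectory n k h ξ p s) (hk : 0 < k) (hD : ∀ t ∈ s, 0 < 1 - p t ^ 2)
    {t : ℝ} (ht : t ∈ s) : 1 - p t ^ 2 = 1 * gap n k h (ξ t) := by
  rw [one_mul, ← H.abs_one_sub_sq hk ht, abs_of_pos (hD t ht)]

theorem eq_gap_of_neg (H : Trajectory n k h ξ p s) (hk : 0 < k) (hD : ∀ t ∈ s, 1 - p t ^ 2 < 0)
    {t : ℝ} (ht : t ∈ s) : 1 - p t ^ 2 = (-1) * gap n k h (ξ t) := by
  rw [← H.abs_one_sub_sq hk ht, abs_of_neg (hD t ht)]; ring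

theorem continuousOn_vel (H : Trajectory n k h ξ p s) : ContinuousOn p s :=
  fun t ht => (H.hasDerivAt_vel t ht).continuousAt.continuousWithinAt

theorem continuousOn (H : Trajectory n k h ξ p s) : ContinuousOn ξ s :=
  fun t ht => (H.hasDerivAt t ht).continuousAt.continuousWithinAt

/-- At a finite end near which the velocity is bounded, `ξ` converges to a point where the
coefficient of `ξ_tt` in the equation degenerates. -/
theorem exists_tendsto_left (H : Trajectory n k h ξ p s) (hk : 0 < k) {σ : ℝ}
    (hσ : ∀ t ∈ s, 1 - p t ^ 2 = σ * gap n k h (ξ t)) {a c C : ℝ} (ha : IsGLB s a) (hc : c ∈ s)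
    (hC : ∀ t ∈ Ioo a c, |p t| ≤ C) :
    ∃ x₀, Tendsto ξ (𝓝[>] a) (𝓝 x₀) ∧ 1 + h * Real.exp (n * x₀) = 0 := by
  have hac := H.isOpen.lt_of_isGLB ha hc
  have hsub : Ioo a c ⊆ s := fun t ht => H.ordConnected.Ioc_subset_of_isGLB ha hc ⟨ht.1, ht.2.le⟩
  have hsm : s ∈ 𝓝[>] a := mem_of_superset (Ioo_mem_nhdsGT hac) hsub
  obtain ⟨x₀, hx₀⟩ := exists_tendsto_nhdsGT_of_bounded_deriv hac
    (fun t ht => H.hasDerivAt t (hsub ht)) hC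
  refine ⟨x₀, hx₀, ?_⟩
  by_contra hne
  have hD : Tendsto (fun t => 1 - p t ^ 2) (𝓝[>] a) (𝓝 (σ * gap n k h x₀)) :=
    (((continuous_gap n k h).tendsto x₀).comp hx₀ |>.const_mul σ).congr' (by
      filter_upwards [hsm] with t ht
      exact (hσ t ht).symm)
  have hG : ContinuousAt (massRatio n h) x₀ := by
    unfold massRatio
    fun_prop (disch := assumption)
  have hp' := hD.mul (((hG.tendsto.comp hx₀).const_mul ((n : ℝ) / (2 * k))).const_sub 1)
  obtain ⟨M, hM⟩ := hp'.abs.isBoundedUnder_le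
  obtain ⟨d, hd, hdM⟩ := (mem_nhdsGT_iff_exists_Ioo_subset' hac).1 (eventually_map.1 hM)
  have hd' : a < min c d := lt_min hac hd
  obtain ⟨p₀, hp₀⟩ := exists_tendsto_nhdsGT_of_bounded_deriv (C := M) hd'
    (fun t ht => H.hasDerivAt_vel t (hsub ⟨ht.1, ht.2.trans_le (min_le_left _ _)⟩))
    (fun t ht => hdM ⟨ht.1, ht.2.trans_le (min_le_right _ _)⟩)
  have h1 := H.left_end a x₀ p₀ ha hx₀ hp₀
  have h2 : σ * gap n k h x₀ = 1 - p₀ ^ 2 := tendsto_nhds_unique hD ((hp₀.pow 2).const_sub 1)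
  rw [h1, sub_self, mul_eq_zero, gap_eq_zero_iff hk, or_iff_left hne] at h2
  have := hσ c hc
  rw [h2, zero_mul] at this
  exact H.ne_zero c hc this

theorem exists_tendsto_right (H : Trajectory n k h ξ p s) (hk : 0 < k) {σ : ℝ}
    (hσ : ∀ t ∈ s, 1 - p t ^ 2 = σ * gap n k h (ξ t)) {b c C : ℝ} (hb : IsLUB s b) (hc : c ∈ s)
    (hC : ∀ t ∈ Ioo c b, |p t| ≤ C) :
    ∃ x₀, Tendsto ξ (𝓝[<] b) (𝓝 x₀) ∧ 1 + h * Real.exp (n * x₀) = 0 := by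
  obtain ⟨x₀, hx₀, h0⟩ := H.neg.exists_tendsto_left hk (σ := σ) (a := -b) (c := -c) (C := C)
    (fun t ht => by simpa using hσ (-t) ht) (isGLB_neg.2 (by simpa using hb)) (by simpa using hc)
    (fun t ht => by
      rw [abs_neg]; exact hC (-t) ⟨by linarith [ht.2], by linarith [ht.1]⟩)
  refine ⟨x₀, ?_, h0⟩
  simpa [Function.comp_def] using hx₀.comp (tendsto_neg_nhdsLT (a := b))

end Trajectory

/-! ### Asymptotics where `ξ → ∞` -/

theorem le_of_deriv_le_neg {f f' : ℝ → ℝ} {c m : ℝ} (hf : ∀ t ≤ c, HasDerivAt f (f' t) t)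
    (hm : ∀ t ≤ c, f' t ≤ -m) {t : ℝ} (ht : t ≤ c) : f c + m * (c - t) ≤ f t := by
  have hd : ∀ u ≤ c, HasDerivAt (fun u => f u + m * u) (f' u + m) u := fun u hu => by
    exact ((hf u hu).add ((hasDerivAt_id u).const_mul m)).congr_deriv (by ring)
  have hanti : AntitoneOn (fun u => f u + m * u) (Iic c) := by
    refine antitoneOn_of_deriv_nonpos (convex_Iic c)
      (fun u hu => (hd u hu).continuousAt.continuousWithinAt)
      (fun u hu => (hd u (mem_Iic.1 (interior_subset hu))).differentiableAt.differentiableWithinAt)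
      fun u hu => ?_
    have hu' : u ≤ c := mem_Iic.1 (interior_subset hu)
    rw [(hd u hu').deriv]
    linarith [hm u hu']
  have := hanti (mem_Iic.2 ht) (mem_Iic.2 le_rfl) ht
  simp only at this
  linarith

theorem tendsto_exp_neg_mul_atTop {n : ℝ} (hn : 0 < n) :
    Tendsto (fun x => Real.exp (-n * x)) atTop (𝓝 0) :=
  Real.tendsto_exp_atBot.comp (tendsto_id.const_mul_atTop_of_neg (neg_lt_zero.2 hn))

theorem tendsto_gap_mul_exp {n k : ℕ} (hn : 0 < n) (hk : 0 < k) (h : ℝ) :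
    Tendsto (fun x => gap n k h x * Real.exp ((2 - (n : ℝ) / k) * x)) atTop
      (𝓝 (|h| ^ (1 / (k : ℝ)))) := by
  simp only [gap_mul_exp hk]
  have h1 : Tendsto (fun x => |Real.exp (-(n : ℝ) * x) + h|) atTop (𝓝 |h|) := by
    simpa using ((tendsto_exp_neg_mul_atTop (Nat.cast_pos.2 hn)).add_const h).abs
  exact h1.rpow_const (Or.inr (by positivity))

theorem tendsto_massRatio_atTop {n : ℕ} (hn : 0 < n) {h : ℝ} (hh : h ≠ 0) :
    Tendsto (massRatio n h) atTop (𝓝 1) := by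
  have h1 : Tendsto (fun x => h / (Real.exp (-(n : ℝ) * x) + h)) atTop (𝓝 (h / (0 + h))) :=
    tendsto_const_nhds.div ((tendsto_exp_neg_mul_atTop (Nat.cast_pos.2 hn)).add_const h)
      (by simpa using hh)
  rw [zero_add, div_self hh] at h1
  refine h1.congr fun x => ?_
  have e : Real.exp (-(n : ℝ) * x) = (Real.exp (n * x))⁻¹ := by rw [← Real.exp_neg]; ring_nf
  have e0 := (Real.exp_pos ((n : ℝ) * x)).ne'
  unfold massRatio
  rw [e]
  by_cases h0 : 1 + h * Real.exp (n * x) = 0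
  · have : (Real.exp (n * x))⁻¹ + h = 0 := by
      have : (Real.exp (n * x))⁻¹ + h = (1 + h * Real.exp (n * x)) * (Real.exp (n * x))⁻¹ := by
        field_simp
      rw [this, h0, zero_mul]
    rw [this, h0]; simp
  · have h2 : (Real.exp (n * x))⁻¹ + h ≠ 0 := by
      have : (Real.exp (n * x))⁻¹ + h = (1 + h * Real.exp (n * x)) * (Real.exp (n * x))⁻¹ := by
        field_simp
      rw [this]; exact mul_ne_zero h0 (inv_ne_zero e0)
    field_simp

theorem exp_zpow_neg_two (y : ℝ) : Real.exp y ^ (-2 : ℤ) = Real.exp (-2 * y) := by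
  rw [show -2 * y = -(y + y) by ring, Real.exp_neg, Real.exp_add, zpow_neg]
  norm_cast
  rw [sq]

theorem radialV_zpow {ξ : ℝ → ℝ} {r : ℝ} (hr : 0 < r) :
    radialV ξ r ^ (-2 : ℤ) = Real.exp (-2 * (ξ (Real.log r) + Real.log r)) := by
  have : radialV ξ r = Real.exp (ξ (Real.log r) + Real.log r) := by
    rw [Real.exp_add, Real.exp_log hr, radialV, mul_comm]
  rw [this, exp_zpow_neg_two]

namespace Trajectory

variable {n k : ℕ} {h : ℝ} {ξ p : ℝ → ℝ} {s : Set ℝ}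

theorem tendsto_vel_of_neg {l : Filter ℝ} {σ g : ℝ} (hs : ∀ᶠ t in l, t ∈ s)
    (hσ : ∀ t ∈ s, 1 - p t ^ 2 = σ * gap n k h (ξ t))
    (hg : Tendsto (fun t => gap n k h (ξ t)) l (𝓝 g)) (hp : ∀ᶠ t in l, p t ≤ 0) :
    Tendsto p l (𝓝 (-√(1 - σ * g))) := by
  have h1 : Tendsto (fun t => -√(1 - σ * gap n k h (ξ t))) l (𝓝 (-√(1 - σ * g))) :=
    ((hg.const_mul σ).const_sub 1).sqrt.neg
  refine h1.congr' ?_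
  filter_upwards [hs, hp] with t ht htp
  rw [← hσ t ht, sub_sub_cancel, Real.sqrt_sq_eq_abs, abs_of_nonpos htp, neg_neg]

theorem tendsto_gap_atTop_zero (hn : 0 < n) (hk : 0 < k) (h2k : n < 2 * k) :
    Tendsto (gap n k h) atTop (𝓝 0) := by
  have hα : 0 < 2 - (n : ℝ) / k := by
    have : (n : ℝ) < 2 * k := by exact_mod_cast h2k
    rw [sub_pos, div_lt_iff₀ (by positivity)]; exact this
  have := (tendsto_gap_mul_exp hn hk h).mul (tendsto_exp_neg_mul_atTop hα)
  rw [mul_zero] at this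
  refine this.congr fun x => ?_
  rw [mul_assoc, ← Real.exp_add, neg_mul, add_neg_cancel, Real.exp_zero, mul_one]

/-- If `2k > n` and `ξ → ∞` at `-∞`, then `ξ + t` converges, and `1 - ξ_t²` decays exactly like
`e^{(2 - n/k) t}`. -/
theorem exists_tendsto_add_id (H : Trajectory n k h ξ p s) (hn : 0 < n) (hk : 0 < k)
    (h2k : n < 2 * k) {σ c : ℝ} (hσ : ∀ t ∈ s, 1 - p t ^ 2 = σ * gap n k h (ξ t))
    (hs : Iic c ⊆ s) (hξ : Tendsto ξ atBot atTop) (hp : ∀ᶠ t in atBot, p t ≤ 0) :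
    Tendsto p atBot (𝓝 (-1)) ∧ ∃ l, Tendsto (fun t => ξ t + t) atBot (𝓝 l) ∧
      Tendsto (fun t => (1 - p t ^ 2) * Real.exp (-(2 - (n : ℝ) / k) * t)) atBot
        (𝓝 (σ * |h| ^ (1 / (k : ℝ)) * Real.exp (-(2 - (n : ℝ) / k) * l))) := by
  set α := 2 - (n : ℝ) / k with hαdef
  have hα : 0 < α := by
    have : (n : ℝ) < 2 * k := by exact_mod_cast h2k
    rw [hαdef, sub_pos, div_lt_iff₀ (by positivity)]; exact this
  have hsb : ∀ᶠ t in atBot, t ∈ s := Filter.eventually_of_mem (Iic_mem_atBot c) fun t ht => hs ht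
  have hp1 : Tendsto p atBot (𝓝 (-1)) := by
    have := tendsto_vel_of_neg hsb hσ ((tendsto_gap_atTop_zero hn hk h2k).comp hξ) hp
    simpa using this
  have hge : Tendsto (fun t => gap n k h (ξ t) * Real.exp (α * ξ t)) atBot
      (𝓝 (|h| ^ (1 / (k : ℝ)))) := (tendsto_gap_mul_exp hn hk h).comp hξ
  refine ⟨hp1, ?_⟩
  have hev : ∀ᶠ t in atBot, t ∈ s ∧ p t ≤ -(1 / 2) ∧
      gap n k h (ξ t) * Real.exp (α * ξ t) ≤ |h| ^ (1 / (k : ℝ)) + 1 :=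
    hsb.and ((hp1.eventually_le_const (by norm_num)).and
      (hge.eventually_le_const (by linarith)))
  obtain ⟨d, hd⟩ := eventually_atBot.1 hev
  have hlow : ∀ t ≤ d, ξ d + 1 / 2 * (d - t) ≤ ξ t := fun t ht =>
    le_of_deriv_le_neg (fun u hu => H.hasDerivAt u (hd u hu).1) (fun u hu => (hd u hu).2.1) ht
  obtain ⟨l, hl⟩ := exists_tendsto_atBot_of_exp_bound (f := fun t => ξ t + t)
    (f' := fun t => p t + 1) (c := d) (δ := α / 2)
    (C := |σ| * ((|h| ^ (1 / (k : ℝ)) + 1) * Real.exp (-α * (ξ d + d / 2)))) (by positivity)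
    (fun t ht => (H.hasDerivAt t (hd t ht).1).add (hasDerivAt_id t))
    ((H.continuousOn_vel.mono fun t ht => (hd t ht).1).add continuousOn_const)
    (fun t ht => by
      obtain ⟨hts, h1, h2⟩ := hd t ht
      have e1 : p t + 1 = (1 - p t ^ 2) / (1 - p t) := by
        rw [eq_div_iff (by linarith)]; ring
      have hgp := gap_nonneg n k h (ξ t)
      have h3 : gap n k h (ξ t) ≤ (|h| ^ (1 / (k : ℝ)) + 1) * Real.exp (-α * ξ t) := by
        rw [neg_mul, Real.exp_neg, ← div_eq_mul_inv, le_div_iff₀ (Real.exp_pos _)]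
        exact h2
      have h4 : Real.exp (-α * ξ t) ≤ Real.exp (-α * (ξ d + d / 2)) * Real.exp (α / 2 * t) := by
        rw [← Real.exp_add]
        apply Real.exp_le_exp.2
        nlinarith [hlow t ht]
      rw [e1, abs_div, hσ t hts, abs_mul, abs_of_nonneg hgp, abs_of_pos (by linarith : 0 < 1 - p t)]
      calc |σ| * gap n k h (ξ t) / (1 - p t) ≤ |σ| * gap n k h (ξ t) :=
            div_le_self (by positivity) (by linarith)
        _ ≤ |σ| * ((|h| ^ (1 / (k : ℝ)) + 1) *
            (Real.exp (-α * (ξ d + d / 2)) * Real.exp (α / 2 * t))) := by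
          gcongr
          exact h3.trans (by gcongr)
        _ = _ := by ring)
  refine ⟨l, hl, ?_⟩
  have h5 := (hge.mul ((Real.continuous_exp.tendsto _).comp (hl.const_mul (-α)))).const_mul σ
  rw [← mul_assoc] at h5
  refine h5.congr' ?_
  filter_upwards [hsb] with t ht
  simp only [Function.comp_apply]
  rw [hσ t ht]
  have : Real.exp (α * ξ t) * Real.exp (-α * (ξ t + t)) = Real.exp (-α * t) := by
    rw [← Real.exp_add]; ring_nf
  rw [← this]
  ring

/-- The expansion of `v⁻² = e^{-2(ξ + t)}` is obtained by integrating the asymptotics of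
`(v⁻²)_t = -2 v⁻² (1 - ξ_t²) / (1 - ξ_t)`, in which `1 - ξ_t²` is an exact multiple of `r^{2 - n/k}`
up to a factor tending to `1`; the derivatives of `v` are read off from the same asymptotics. -/
theorem rootExpansion (H : Trajectory n k h ξ p s) (hk : 0 < k) (hkn : k ≤ n)
    (h2k : n < 2 * k) {σ c : ℝ} (hσ0 : σ ≠ 0)
    (hσ : ∀ t ∈ s, 1 - p t ^ 2 = σ * gap n k h (ξ t)) (hh : h ≠ 0)
    (hs : Iic c ⊆ s) (hξ : Tendsto ξ atBot atTop) (hp : ∀ᶠ t in atBot, p t ≤ 0) :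
    RootExpansion n k (-σ * |h| ^ (1 / (k : ℝ))) (radialV ξ) := by
  have hn : 0 < n := hk.trans_le hkn
  obtain ⟨hp1, l, hl, hD⟩ := H.exists_tendsto_add_id hn hk h2k hσ hs hξ hp
  set α := 2 - (n : ℝ) / k with hαdef
  have hk0 : (0 : ℝ) < k := by positivity
  have h2k' : (n : ℝ) < 2 * k := by exact_mod_cast h2k
  have hα : 0 < α := by
    rw [hαdef, sub_pos, div_lt_iff₀ hk0]; exact h2k'
  have hα2 : α ≤ 1 := by
    have : 1 ≤ (n : ℝ) / k := by rw [one_le_div hk0]; exact_mod_cast hkn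
    linarith
  have hsb : ∀ᶠ t in atBot, t ∈ s := Filter.eventually_of_mem (Iic_mem_atBot c) fun t ht => hs ht
  have hlog : Tendsto Real.log (𝓝[>] 0) atBot := Real.tendsto_log_nhdsGT_zero
  set K := σ * |h| ^ (1 / (k : ℝ)) * Real.exp (-α * l) with hK
  have hK0 : K ≠ 0 := mul_ne_zero (mul_ne_zero hσ0
    (Real.rpow_pos_of_pos (abs_pos.2 hh) _).ne') (Real.exp_pos _).ne'
  have hpos : ∀ᶠ r in 𝓝[>] (0 : ℝ), 0 < r := self_mem_nhdsWithin
  have hrad : ∀ᶠ r in 𝓝[>] (0 : ℝ), r ∈ radii s := by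
    filter_upwards [hpos, hlog.eventually hsb] with r h1 h2
    exact ⟨h1, h2⟩
  refine ⟨Real.exp l, Real.exp_pos l, ?_, ?_, ?_, ?_⟩
  · -- the expansion, by l'Hôpital's rule in the variable `t`
    have hW : Tendsto (fun t => Real.exp (-2 * (ξ t + t))) atBot (𝓝 (Real.exp (-2 * l))) :=
      (Real.continuous_exp.tendsto _).comp (hl.const_mul (-2))
    have hhop : Tendsto (fun t => (Real.exp (-2 * (ξ t + t)) - Real.exp (-2 * l)) /
        Real.exp (α * t)) atBot (𝓝 (-K * Real.exp (-2 * l) / α)) := by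
      refine HasDerivAt.lhopital_zero_atBot
        (f' := fun t => Real.exp (-2 * (ξ t + t)) * (-2 * (p t + 1)))
        (g' := fun t => Real.exp (α * t) * α) ?_ ?_ ?_ ?_ ?_ ?_
      · filter_upwards [hsb] with t ht
        exact (((H.hasDerivAt t ht).add (hasDerivAt_id t)).const_mul (-2)).exp.sub_const _
      · refine Eventually.of_forall fun t => ?_
        simpa using ((hasDerivAt_id t).const_mul α).exp
      · exact Eventually.of_forall fun t => by positivity
      · simpa using hW.sub_const (Real.exp (-2 * l))
      · exact Real.tendsto_exp_atBot.comp (tendsto_id.const_mul_atBot hα)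
      · have h1 : Tendsto (fun t => (1 - p t ^ 2) * Real.exp (-α * t) *
            Real.exp (-2 * (ξ t + t)) * (-2 / (1 - p t) / α)) atBot
            (𝓝 (K * Real.exp (-2 * l) * (-2 / (1 - (-1)) / α))) := by
          refine (hD.mul hW).mul (Tendsto.div_const ?_ _)
          exact tendsto_const_nhds.div (hp1.const_sub 1) (by norm_num)
        have e0 : K * Real.exp (-2 * l) * (-2 / (1 - (-1)) / α) = -K * Real.exp (-2 * l) / α := by
          ring
        rw [e0] at h1
        refine h1.congr' ?_
        filter_upwards [hp] with t ht
        have h3 : 1 - p t ≠ 0 := by linarith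
        rw [neg_mul α t, Real.exp_neg]
        have := (Real.exp_pos (α * t)).ne'
        field_simp
        ring
    refine Asymptotics.isLittleO_of_tendsto' ?_ ?_
    · filter_upwards [hpos] with r hr h0
      exact absurd h0 (Real.rpow_pos_of_pos hr _).ne'
    · have h2 := (hhop.comp hlog).sub_const (-K * Real.exp (-2 * l) / α)
      rw [sub_self] at h2
      refine h2.congr' ?_
      filter_upwards [hpos] with r hr
      have e1 : Real.exp (α * Real.log r) = r ^ α := by
        rw [Real.rpow_def_of_pos hr, mul_comm]
      have e2 : (r / Real.exp l) ^ α = r ^ α * Real.exp (-α * l) := by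
        rw [Real.div_rpow hr.le (Real.exp_pos l).le, ← Real.exp_mul, neg_mul, Real.exp_neg,
          div_eq_mul_inv, mul_comm l]
      have e4 : (k : ℝ) / (2 * k - n) = 1 / α := by
        have : (2 : ℝ) * k - n ≠ 0 := by linarith
        rw [hαdef]; field_simp
      have hr' := (Real.rpow_pos_of_pos hr α).ne'
      simp only [Function.comp_apply]
      rw [← hαdef, radialV_zpow hr, e1, e2, exp_zpow_neg_two, e4, hK]
      generalize r ^ α = Q at hr'
      field_simp
      ring
  · refine ((Real.continuous_exp.tendsto l).comp (hl.comp hlog)).congr' ?_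
    filter_upwards [hpos] with r hr
    simp only [Function.comp_apply]
    rw [Real.exp_add, Real.exp_log hr, radialV, mul_comm]
  · have h1 : Tendsto (fun t => |Real.exp (ξ t + t) * ((1 - p t ^ 2) * Real.exp (-α * t)) /
        (1 - p t)| * Real.exp ((α - 2) * t)) atBot atTop := by
      refine Tendsto.pos_mul_atTop (C := |Real.exp l * K / (1 - (-1))|) ?_ ?_ ?_
      · have := (Real.exp_pos l).ne'
        rw [abs_pos]
        exact div_ne_zero (mul_ne_zero this hK0) (by norm_num)
      · exact ((((Real.continuous_exp.tendsto l).comp hl).mul hD).div (hp1.const_sub 1)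
          (by norm_num)).abs
      · exact Real.tendsto_exp_atTop.comp (tendsto_id.const_mul_atBot_of_neg (by linarith))
    refine (h1.comp hlog).congr' ?_
    filter_upwards [hrad, hlog.eventually hp] with r hr htp
    simp only [Function.comp_apply]
    rw [H.deriv_radialV hr]
    have h3 : 1 - p (Real.log r) ≠ 0 := by linarith
    have hr0 := hr.1
    rw [← abs_of_pos (Real.exp_pos ((α - 2) * Real.log r)), ← abs_mul]
    congr 1
    have e1 : Real.exp (-α * Real.log r) * Real.exp ((α - 2) * Real.log r) = r⁻¹ * r⁻¹ := by
      rw [← Real.exp_add, show -α * Real.log r + (α - 2) * Real.log r =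
        -Real.log r + -Real.log r by ring, Real.exp_add, Real.exp_neg, Real.exp_log hr0]
    calc _ = Real.exp (ξ (Real.log r) + Real.log r) * (1 - p (Real.log r) ^ 2) /
          (1 - p (Real.log r)) * (Real.exp (-α * Real.log r) * Real.exp ((α - 2) * Real.log r)) := by
            ring
      _ = _ := by
        rw [e1, Real.exp_add, Real.exp_log hr0]
        field_simp
        ring
  · intro hkn'
    have hc0 : (1 / 2 : ℝ) - n / (2 * k) * 1 ≠ 0 := by
      have : (1 : ℝ) < n / k := by rw [one_lt_div hk0]; exact_mod_cast hkn'
      have e : (n : ℝ) / (2 * k) = n / k / 2 := by field_simp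
      rw [e]; linarith
    have h1 : Tendsto (fun t => |Real.exp (ξ t + t) * ((1 - p t ^ 2) * Real.exp (-α * t)) *
        (1 / (1 - p t) - n / (2 * k) * massRatio n h (ξ t))| * Real.exp ((α - 2) * t))
        atBot atTop := by
      refine Tendsto.pos_mul_atTop
        (C := |Real.exp l * K * (1 / (1 - (-1)) - n / (2 * k) * 1)|) ?_ ?_ ?_
      · have := (Real.exp_pos l).ne'
        rw [abs_pos]
        refine mul_ne_zero (mul_ne_zero this hK0) ?_
        norm_num at hc0 ⊢
        exact hc0
      · refine ((((Real.continuous_exp.tendsto l).comp hl).mul hD).mul (Tendsto.sub ?_ ?_)).abs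
        · exact tendsto_const_nhds.div (hp1.const_sub 1) (by norm_num)
        · exact ((tendsto_massRatio_atTop hn hh).comp hξ).const_mul _
      · exact Real.tendsto_exp_atTop.comp (tendsto_id.const_mul_atBot_of_neg (by linarith))
    refine (h1.comp hlog).congr' ?_
    filter_upwards [hrad, hlog.eventually hp] with r hr htp
    simp only [Function.comp_apply]
    rw [H.deriv_deriv_radialV hr]
    have h3 : 1 - p (Real.log r) ≠ 0 := by linarith
    have hr0 := hr.1
    rw [← abs_of_pos (Real.exp_pos ((α - 2) * Real.log r)), ← abs_mul]
    congr 1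
    have e1 : Real.exp (-α * Real.log r) * Real.exp ((α - 2) * Real.log r) = r⁻¹ * r⁻¹ := by
      rw [← Real.exp_add, show -α * Real.log r + (α - 2) * Real.log r =
        -Real.log r + -Real.log r by ring, Real.exp_add, Real.exp_neg, Real.exp_log hr0]
    generalize massRatio n h (ξ (Real.log r)) = G
    calc _ = Real.exp (ξ (Real.log r) + Real.log r) * (1 - p (Real.log r) ^ 2) *
          (1 / (1 - p (Real.log r)) - n / (2 * k) * G) *
          (Real.exp (-α * Real.log r) * Real.exp ((α - 2) * Real.log r)) := by
            ring
      _ = _ := by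
        rw [e1, Real.exp_add, Real.exp_log hr0]
        field_simp
        ring

end Trajectory

namespace Trajectory

variable {n k : ℕ} {h : ℝ} {ξ p : ℝ → ℝ} {s : Set ℝ}

/-- If `2k = n` and `ξ → ∞` at `-∞`, then `ξ_t` converges exponentially fast to `-β`. -/
theorem simConst_of_eq (H : Trajectory n k h ξ p s) (hk : 0 < k) (h2k : 2 * k = n)
    {σ c β : ℝ} (hσ : ∀ t ∈ s, 1 - p t ^ 2 = σ * gap n k h (ξ t)) (hh : h ≠ 0)
    (hβ : 0 < β) (hβ2 : β ^ 2 = 1 - σ * |h| ^ (1 / (k : ℝ)))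
    (hs : Iic c ⊆ s) (hξ : Tendsto ξ atBot atTop) (hp : ∀ᶠ t in atBot, p t ≤ 0) :
    SimConst (𝓝[>] 0) (fun r => radialV ξ r ^ (-2 : ℤ)) (fun r => r ^ (2 * (β - 1))) := by
  have hn : 0 < n := by omega
  have hk0 : (0 : ℝ) < k := by positivity
  have hn0 : (0 : ℝ) < n := by positivity
  have hnk : 2 - (n : ℝ) / k = 0 := by
    rw [← h2k]; push_cast; field_simp; ring
  have hgap : ∀ x, gap n k h x = |Real.exp (-n * x) + h| ^ (1 / (k : ℝ)) := fun x => by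
    have := gap_mul_exp (n := n) hk h x
    rwa [hnk, zero_mul, Real.exp_zero, mul_one] at this
  have hsb : ∀ᶠ t in atBot, t ∈ s := Filter.eventually_of_mem (Iic_mem_atBot c) fun t ht => hs ht
  have hg : Tendsto (gap n k h) atTop (𝓝 (|h| ^ (1 / (k : ℝ)))) := by
    have := tendsto_gap_mul_exp hn hk h
    simpa only [hnk, zero_mul, Real.exp_zero, mul_one] using this
  have hp1 : Tendsto p atBot (𝓝 (-β)) := by
    have := tendsto_vel_of_neg hsb hσ (hg.comp hξ) hp
    rwa [← hβ2, Real.sqrt_sq hβ.le] at this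
  -- differentiability of `y ↦ |y + h|^{1/k}` at `0` turns the decay of `e^{-nξ}` into that of `ξ_t + β`
  have hO : (fun y : ℝ => |y + h| ^ (1 / (k : ℝ)) - |0 + h| ^ (1 / (k : ℝ))) =O[𝓝 0]
      fun y => y - 0 := by
    have h0 : (0 : ℝ) + h ≠ 0 := by simpa using hh
    have hd : DifferentiableAt ℝ (fun y : ℝ => |y + h| ^ (1 / (k : ℝ))) 0 := by
      have h1 : DifferentiableAt ℝ (fun y : ℝ => y + h) 0 := by fun_prop
      exact (h1.abs h0).rpow_const (Or.inl (abs_pos.2 h0).ne')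
    exact hd.isBigO_sub
  obtain ⟨M, hM⟩ := hO.bound
  have hM' : ∀ᶠ t in atBot, |gap n k h (ξ t) - |h| ^ (1 / (k : ℝ))| ≤
      M * Real.exp (-n * ξ t) := by
    filter_upwards [((tendsto_exp_neg_mul_atTop hn0).comp hξ).eventually hM] with t ht
    simpa [hgap, Real.norm_eq_abs] using ht
  have hM0 : 0 ≤ |M| := abs_nonneg M
  obtain ⟨d, hd⟩ := eventually_atBot.1 (hsb.and ((hp1.eventually_le_const
    (show -β < -(β / 2) by linarith)).and hM'))
  have hlow : ∀ t ≤ d, ξ d + β / 2 * (d - t) ≤ ξ t := fun t ht =>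
    le_of_deriv_le_neg (fun u hu => H.hasDerivAt u (hd u hu).1) (fun u hu => (hd u hu).2.1) ht
  obtain ⟨l, hl⟩ := exists_tendsto_atBot_of_exp_bound (f := fun t => ξ t + β * t)
    (f' := fun t => p t + β) (c := d) (δ := n * β / 2)
    (C := |σ| * (|M| * Real.exp (-n * (ξ d + β / 2 * d))) / β) (by positivity)
    (fun t ht => ((H.hasDerivAt t (hd t ht).1).add ((hasDerivAt_id t).const_mul β)).congr_deriv
      (by ring))
    ((H.continuousOn_vel.mono fun t ht => (hd t ht).1).add continuousOn_const)
    (fun t ht => by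
      obtain ⟨hts, h1, h2⟩ := hd t ht
      have e1 : p t + β = σ * (gap n k h (ξ t) - |h| ^ (1 / (k : ℝ))) / (β - p t) := by
        rw [eq_div_iff (by linarith)]
        linear_combination hβ2 + hσ t hts
      have h4 : Real.exp (-n * ξ t) ≤
          Real.exp (-n * (ξ d + β / 2 * d)) * Real.exp (n * β / 2 * t) := by
        rw [← Real.exp_add]
        apply Real.exp_le_exp.2
        nlinarith [hlow t ht]
      have h5 : M * Real.exp (-n * ξ t) ≤ |M| * Real.exp (-n * ξ t) := by
        gcongr; exact le_abs_self M
      rw [e1, abs_div, abs_mul, abs_of_pos (by linarith : 0 < β - p t)]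
      calc |σ| * |gap n k h (ξ t) - |h| ^ (1 / (k : ℝ))| / (β - p t)
          ≤ |σ| * (|M| * (Real.exp (-n * (ξ d + β / 2 * d)) * Real.exp (n * β / 2 * t))) / β := by
            gcongr
            · exact h2.trans (h5.trans (by gcongr))
            · linarith
        _ = _ := by ring)
  refine ⟨Real.exp (-2 * l), Real.exp_pos _, ?_⟩
  have hlog : Tendsto Real.log (𝓝[>] 0) atBot := Real.tendsto_log_nhdsGT_zero
  refine (((Real.continuous_exp.tendsto _).comp (hl.const_mul (-2))).comp hlog).congr' ?_
  filter_upwards [self_mem_nhdsWithin] with r hr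
  have hr0 : 0 < r := hr
  simp only [Function.comp_apply]
  rw [radialV_zpow hr0, Real.rpow_def_of_pos hr0, ← Real.exp_sub]
  ring_nf

/-- If `2k < n` and `1 - ξ_t² < 0`, then `e^{-(n-2k)ξ/(2k)}` has a positive finite derivative where
`ξ → ∞`, so `ξ` blows up at a finite end. -/
theorem simConst_of_lt (H : Trajectory n k h ξ p s) (hk : 0 < k) (h2k : 2 * k < n)
    (hσ : ∀ t ∈ s, 1 - p t ^ 2 = (-1) * gap n k h (ξ t)) (hh : h ≠ 0) {a : ℝ} (ha : IsGLB s a)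
    (hξ : Tendsto ξ (𝓝[>] a) atTop) (hp : ∀ t ∈ s, p t ≤ 0) :
    SimConst (𝓝[>] Real.exp a) (fun r => radialV ξ r ^ (-2 : ℤ))
      (fun r => (r - Real.exp a) ^ (4 * (k : ℝ) / (n - 2 * k))) := by
  have hn : 0 < n := by omega
  have hk0 : (0 : ℝ) < k := by positivity
  have hn0 : (0 : ℝ) < n := by positivity
  have h2k' : (2 : ℝ) * k < n := by exact_mod_cast h2k
  obtain ⟨c, hc⟩ := H.nonempty
  have hac := H.isOpen.lt_of_isGLB ha hc
  have hsub : Ioo a c ⊆ s := fun t ht => H.ordConnected.Ioc_subset_of_isGLB ha hc ⟨ht.1, ht.2.le⟩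
  have hsm : ∀ᶠ t in 𝓝[>] a, t ∈ s := mem_of_superset (Ioo_mem_nhdsGT hac) hsub
  set m : ℝ := (n - 2 * k) / (2 * k) with hm
  have hm0 : 0 < m := div_pos (by linarith) (by positivity)
  have hnk : 2 - (n : ℝ) / k = -2 * m := by rw [hm]; field_simp; ring
  have hy0 : Tendsto (fun t => Real.exp (-m * ξ t)) (𝓝[>] a) (𝓝 0) :=
    (tendsto_exp_neg_mul_atTop hm0).comp hξ
  set κ := √(|h| ^ (1 / (k : ℝ))) with hκ
  have hκ0 : 0 < κ := Real.sqrt_pos.2 (Real.rpow_pos_of_pos (abs_pos.2 hh) _)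
  have hpy : Tendsto (fun t => -p t * Real.exp (-m * ξ t)) (𝓝[>] a) (𝓝 κ) := by
    have h1 : Tendsto (fun t => √(Real.exp (-m * ξ t) ^ 2 +
        gap n k h (ξ t) * Real.exp ((2 - (n : ℝ) / k) * ξ t))) (𝓝[>] a) (𝓝 κ) := by
      have := ((hy0.pow 2).add ((tendsto_gap_mul_exp hn hk h).comp hξ)).sqrt
      rw [zero_pow two_ne_zero, zero_add] at this
      exact this
    refine h1.congr' ?_
    filter_upwards [hsm] with t ht
    have e : Real.exp (-m * ξ t) ^ 2 + gap n k h (ξ t) * Real.exp ((2 - (n : ℝ) / k) * ξ t) =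
        (-p t * Real.exp (-m * ξ t)) ^ 2 := by
      have e2 : Real.exp ((2 - (n : ℝ) / k) * ξ t) = Real.exp (-m * ξ t) ^ 2 := by
        rw [hnk, ← Real.exp_nat_mul]; push_cast; ring_nf
      rw [e2]
      linear_combination (Real.exp (-m * ξ t) ^ 2) * hσ t ht
    rw [e, Real.sqrt_sq]
    exact mul_nonneg (neg_nonneg.2 (hp t ht)) (Real.exp_pos _).le
  have hquot : Tendsto (fun t => Real.exp (-m * ξ t) / (t - a)) (𝓝[>] a) (𝓝 (m * κ)) := by
    refine HasDerivAt.lhopital_zero_nhdsGT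
      (f' := fun t => Real.exp (-m * ξ t) * (-m * p t)) (g' := fun _ => 1) ?_ ?_ ?_ hy0 ?_ ?_
    · filter_upwards [hsm] with t ht
      exact ((H.hasDerivAt t ht).const_mul (-m)).exp
    · exact Eventually.of_forall fun t => (hasDerivAt_id t).sub_const a
    · exact Eventually.of_forall fun t => one_ne_zero
    · have : Tendsto (fun t : ℝ => t - a) (𝓝 a) (𝓝 (a - a)) := tendsto_id.sub_const a
      rw [sub_self] at this
      exact this.mono_left nhdsWithin_le_nhds
    · refine (hpy.const_mul m).congr fun t => ?_
      rw [div_one]; ring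
  have hr1 := Real.exp_pos a
  have hslope : Tendsto (fun r => (Real.log r - a) / (r - Real.exp a)) (𝓝[>] Real.exp a)
      (𝓝 (Real.exp a)⁻¹) := by
    have := (hasDerivAt_iff_tendsto_slope.1 (Real.hasDerivAt_log hr1.ne')).mono_left
      (nhdsWithin_mono (Real.exp a) (fun r (hr : Real.exp a < r) => hr.ne'))
    refine this.congr fun r => ?_
    rw [slope_def_field, Real.log_exp]
  have hmain := (hquot.comp (tendsto_log_nhdsGT_exp a)).mul hslope
  have hexp : 4 * (k : ℝ) / (n - 2 * k) = 2 / m := by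
    rw [hm]
    have : (n : ℝ) - 2 * k ≠ 0 := by linarith
    field_simp
    norm_num
  have hinv : Tendsto (fun r : ℝ => r ^ (-2 : ℤ)) (𝓝[>] Real.exp a) (𝓝 (Real.exp a ^ (-2 : ℤ))) :=
    ((continuousAt_zpow₀ _ _ (Or.inl hr1.ne')).tendsto).mono_left nhdsWithin_le_nhds
  refine ⟨Real.exp a ^ (-2 : ℤ) * (m * κ * (Real.exp a)⁻¹) ^ (2 / m), by positivity, ?_⟩
  refine (hinv.mul (hmain.rpow_const (Or.inl (by positivity)))).congr' ?_
  filter_upwards [self_mem_nhdsWithin] with r hr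
  have hr' : Real.exp a < r := hr
  have hr0 : 0 < r := hr1.trans hr'
  have hla : 0 < Real.log r - a := sub_pos.2 ((Real.lt_log_iff_exp_lt hr0).2 hr')
  have hra : 0 < r - Real.exp a := sub_pos.2 hr'
  simp only [Function.comp_apply]
  have e1 : Real.exp (-m * ξ (Real.log r)) / (Real.log r - a) *
      ((Real.log r - a) / (r - Real.exp a)) =
      Real.exp (-m * ξ (Real.log r)) / (r - Real.exp a) := by
    field_simp
  rw [e1, Real.div_rpow (Real.exp_pos _).le hra.le, ← Real.exp_mul, hexp, radialV, mul_zpow,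
    exp_zpow_neg_two, ← mul_div_assoc]
  congr 3
  field_simp

end Trajectory

/-! ### Blow-up of the second derivative, and the solutions with `h = 0` -/

namespace Trajectory

variable {n k : ℕ} {h : ℝ} {ξ p : ℝ → ℝ} {s : Set ℝ}

/-- At a degenerate end, `1 - ξ_t² → 0` while `(1 - ξ_t²)^{k-1} v_rr` has a nonzero limit. -/
theorem blowsUp2_of_tendsto (H : Trajectory n k h ξ p s) (hn : 0 < n) (hk : 1 < k)
    {l l' : Filter ℝ} {r₀ x₀ P : ℝ} (hr₀ : 0 < r₀) (hl : Tendsto id l (𝓝 r₀))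
    (hlog : Tendsto Real.log l l') (hrad : ∀ᶠ r in l, r ∈ radii s)
    (hξ : Tendsto ξ l' (𝓝 x₀)) (h0 : 1 + h * Real.exp (n * x₀) = 0)
    (hp : Tendsto p l' (𝓝 P)) (hP : P ^ 2 = 1) : BlowsUp2 l (radialV ξ) := by
  have hE : ∀ m : ℝ, Tendsto (fun r => Real.exp (m * ξ (Real.log r))) l
      (𝓝 (Real.exp (m * x₀))) := fun m =>
    (Real.continuous_exp.tendsto _).comp ((hξ.comp hlog).const_mul m)
  have hpl := hp.comp hlog
  have hD : Tendsto (fun r => (1 - p (Real.log r) ^ 2) ^ (k - 1)) l (𝓝 0) := by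
    have := ((hpl.pow 2).const_sub 1).pow (k - 1)
    rwa [hP, sub_self, zero_pow (by omega)] at this
  have hDinv : Tendsto (fun r => |(1 - p (Real.log r) ^ 2) ^ (k - 1)|⁻¹) l atTop := by
    refine tendsto_inv_nhdsGT_zero.comp (tendsto_nhdsWithin_iff.2 ⟨?_, ?_⟩)
    · simpa using hD.abs
    · filter_upwards [hrad] with r hr
      exact abs_pos.2 (pow_ne_zero _ (H.ne_zero _ hr.2))
  have hB : Tendsto (fun r => |Real.exp (1 * ξ (Real.log r)) / r *
      ((1 + p (Real.log r)) * (1 - p (Real.log r) ^ 2) ^ (k - 1) -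
        n / (2 * k) * (h * Real.exp (n * ξ (Real.log r)) *
          Real.exp (-(2 * k) * ξ (Real.log r))))|) l
      (𝓝 |Real.exp (1 * x₀) / r₀ * ((1 + P) * 0 -
        n / (2 * k) * (h * Real.exp (n * x₀) * Real.exp (-(2 * k) * x₀)))|) :=
    (((hE 1).div hl hr₀.ne').mul (((hpl.const_add 1).mul hD).sub
      ((((hE n).const_mul h).mul (hE _)).const_mul _))).abs
  refine (Tendsto.pos_mul_atTop ?_ hB hDinv).congr' ?_
  · rw [abs_pos]
    have h1 : h * Real.exp (n * x₀) = -1 := by linarith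
    rw [h1]
    have : (0 : ℝ) < n / (2 * k) * Real.exp (-(2 * k) * x₀) := by positivity
    refine mul_ne_zero (by positivity) ?_
    intro h2
    linarith
  · filter_upwards [hrad] with r hr
    rw [H.deriv_deriv_radialV hr, ← abs_inv, ← abs_mul]
    congr 1
    have en := H.energy _ hr.2
    have hne := H.one_add_ne_zero hr.2
    have hDk : (1 - p (Real.log r) ^ 2) ^ (k - 1) ≠ 0 := pow_ne_zero _ (H.ne_zero _ hr.2)
    have e2 : (1 - p (Real.log r) ^ 2) ^ k =
        (1 - p (Real.log r) ^ 2) ^ (k - 1) * (1 - p (Real.log r) ^ 2) := by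
      rw [← pow_succ]; congr 1; omega
    have e3 : massRatio n h (ξ (Real.log r)) * (1 - p (Real.log r) ^ 2) =
        h * Real.exp (n * ξ (Real.log r)) * Real.exp (-(2 * k) * ξ (Real.log r)) *
          ((1 - p (Real.log r) ^ 2) ^ (k - 1))⁻¹ := by
      rw [massRatio, ← en, neg_mul, Real.exp_neg, e2]
      have := H.ne_zero _ hr.2
      field_simp
    rw [mul_assoc _ (massRatio _ _ _), e3, one_mul]
    field_simp

/-- For `h = 0` the equation says that `e^ξ` is a combination of `e^t` and `e^{-t}`. -/
theorem radialV_of_mass_zero (H : Trajectory n k 0 ξ p s) {σ : ℝ}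
    (hσ0 : σ ≠ 0) (hσ : ∀ t ∈ s, 1 - p t ^ 2 = σ * gap n k 0 (ξ t)) :
    ∃ B : ℝ, B ≠ 0 ∧ (∀ t ∈ s, Real.exp (ξ t + t) * (1 - p t) = B) ∧
      ∀ r ∈ radii s, radialV ξ r = (σ * r ^ 2 + B ^ 2) / (2 * B) := by
  have hvel : ∀ t ∈ s, HasDerivAt p (1 - p t ^ 2) t := fun t ht =>
    (H.hasDerivAt_vel t ht).congr_deriv (by simp [massRatio])
  have hd : ∀ t ∈ s, HasDerivAt (fun t => Real.exp (ξ t + t) * (1 - p t)) 0 t := fun t ht =>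
    (((H.hasDerivAt t ht).add (hasDerivAt_id t)).exp.mul ((hvel t ht).const_sub 1)).congr_deriv
      (by simp only [Pi.add_apply, id]; ring)
  obtain ⟨B, hB⟩ := H.isOpen.exists_is_const_of_deriv_eq_zero H.ordConnected.isPreconnected
    (fun t ht => (hd t ht).differentiableAt.differentiableWithinAt) (fun t ht => (hd t ht).deriv)
  have hB0 : B ≠ 0 := by
    obtain ⟨t, ht⟩ := H.nonempty
    rw [← hB t ht]
    refine mul_ne_zero (Real.exp_pos _).ne' fun h1 => H.ne_zero t ht ?_
    rw [show p t = 1 by linarith]; norm_num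
  refine ⟨B, hB0, hB, fun r hr => ?_⟩
  have h1 := hσ _ hr.2
  have h2 := hB _ hr.2
  have hv : Real.exp (ξ (Real.log r) + Real.log r) = radialV ξ r := by
    rw [Real.exp_add, Real.exp_log hr.1, radialV, mul_comm]
  have hg : gap n k 0 (ξ (Real.log r)) = r ^ 2 * (radialV ξ r ^ 2)⁻¹ := by
    rw [gap, zero_mul, add_zero, abs_one, Real.one_rpow, one_mul, ← hv, ← Real.exp_nat_mul,
      ← Real.exp_neg]
    nth_rw 2 [← Real.exp_log hr.1]
    rw [← Real.exp_nat_mul, ← Real.exp_add]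
    push_cast; ring_nf
  have hv0 : radialV ξ r ≠ 0 := by rw [← hv]; exact (Real.exp_pos _).ne'
  rw [hv] at h2
  rw [hg] at h1
  have h3 : (radialV ξ r) ^ 2 * (1 - p (Real.log r) ^ 2) = σ * r ^ 2 := by
    rw [h1]; field_simp
  rw [eq_div_iff (by simpa using hB0)]
  linear_combination -2 * (radialV ξ r) * h2 + h3 + (B + radialV ξ r * (1 - p (Real.log r))) * h2

end Trajectory

/-! ### Case I: the sphere and the solutions with `h < 0` -/

namespace Trajectory

variable {n k : ℕ} {h : ℝ} {ξ p : ℝ → ℝ} {s : Set ℝ}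

theorem abs_vel_lt_one (hD : ∀ t ∈ s, 0 < 1 - p t ^ 2) {t : ℝ} (ht : t ∈ s) : |p t| < 1 := by
  rw [← sq_lt_one_iff_abs_lt_one]; linarith [hD t ht]

theorem pos_neg (hD : ∀ t ∈ s, 0 < 1 - p t ^ 2) :
    ∀ t ∈ Neg.neg ⁻¹' s, 0 < 1 - (-p (-t)) ^ 2 := fun t ht => by
  rw [neg_sq]; exact hD (-t) ht

/-- For `h ≥ 0` the equation does not degenerate, and the velocity is bounded by `1`: there are no
finite ends. -/
theorem eq_univ_of_nonneg (H : Trajectory n k h ξ p s) (hk : 0 < k)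
    (hD : ∀ t ∈ s, 0 < 1 - p t ^ 2) (hh : 0 ≤ h) : s = univ := by
  have hpos : ∀ x, 1 + h * Real.exp (n * x) ≠ 0 := fun x => by positivity
  refine eq_univ_of_Iic_Ici H.nonempty ?_ ?_
  · refine (H.ordConnected.Iic_subset_or_isGLB H.nonempty).resolve_right ?_
    rintro ⟨a, ha⟩
    obtain ⟨c, hc⟩ := H.nonempty
    obtain ⟨x₀, -, hx₀⟩ := H.exists_tendsto_left hk (fun t ht => H.eq_gap_of_pos hk hD ht) ha hc
      (C := 1) fun t ht =>
        (abs_vel_lt_one hD (H.ordConnected.Ioc_subset_of_isGLB ha hc ⟨ht.1, ht.2.le⟩)).le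
    exact hpos x₀ hx₀
  · refine (H.ordConnected.Ici_subset_or_isLUB H.nonempty).resolve_right ?_
    rintro ⟨b, hb⟩
    obtain ⟨c, hc⟩ := H.nonempty
    obtain ⟨x₀, -, hx₀⟩ := H.exists_tendsto_right hk (fun t ht => H.eq_gap_of_pos hk hD ht) hb hc
      (C := 1) fun t ht =>
        (abs_vel_lt_one hD (H.ordConnected.Ico_subset_of_isLUB hb hc ⟨ht.1.le, ht.2⟩)).le
    exact hpos x₀ hx₀

theorem round_of_mass_zero (H : Trajectory n k 0 ξ p s) (hk : 0 < k)
    (hD : ∀ t ∈ s, 0 < 1 - p t ^ 2) :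
    ∃ ρ : ℝ, 0 < ρ ∧ ∀ r ∈ radii s, radialV ξ r ^ (-2 : ℤ) = (2 * ρ / (r ^ 2 + ρ ^ 2)) ^ 2 := by
  obtain ⟨B, -, hB, hv⟩ := H.radialV_of_mass_zero one_ne_zero
    (fun t ht => H.eq_gap_of_pos hk hD ht)
  refine ⟨B, ?_, fun r hr => ?_⟩
  · obtain ⟨t, ht⟩ := H.nonempty
    rw [← hB t ht]
    have := (abs_lt.1 (abs_vel_lt_one hD ht)).2
    have h2 : 0 < 1 - p t := by linarith
    positivity
  · rw [hv r hr, one_mul, zpow_neg, ← inv_zpow, inv_div]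
    norm_cast

/-- For `h < 0` the velocity increases, and `e^{ξ - t} (1 + ξ_t)` does too, so that `ξ`, which is
bounded above, cannot live for all positive times. -/
theorem right_end_of_mass_neg (H : Trajectory n k h ξ p s) (hn : 0 < n) (hk : 1 < k)
    (hD : ∀ t ∈ s, 0 < 1 - p t ^ 2) (hh : h < 0) :
    ∃ b x₀, IsLUB s b ∧ Tendsto ξ (𝓝[<] b) (𝓝 x₀) ∧ 1 + h * Real.exp (n * x₀) = 0 ∧
      Tendsto p (𝓝[<] b) (𝓝 1) := by
  have hk0 : 0 < k := by omega
  have hY : ∀ t ∈ s, 0 < 1 + h * Real.exp (n * ξ t) := fun t ht => by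
    rw [← H.energy t ht]; have := hD t ht; positivity
  have hG : ∀ t ∈ s, n / (2 * k) * massRatio n h (ξ t) ≤ 0 := fun t ht =>
    mul_nonpos_of_nonneg_of_nonpos (by positivity) (div_nonpos_of_nonpos_of_nonneg
      (mul_nonpos_of_nonpos_of_nonneg hh.le (Real.exp_pos _).le) (hY t ht).le)
  have hconv : Convex ℝ s := H.ordConnected.convex
  have hpmono : StrictMonoOn p s := by
    refine strictMonoOn_of_deriv_pos hconv H.continuousOn_vel fun t ht => ?_
    have ht := interior_subset ht
    rw [(H.hasDerivAt_vel t ht).deriv]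
    exact mul_pos (hD t ht) (by linarith [hG t ht])
  have hAd : ∀ t ∈ s, HasDerivAt (fun t => Real.exp (ξ t - t) * (1 + p t))
      (Real.exp (ξ t - t) * ((1 - p t ^ 2) * -(n / (2 * k) * massRatio n h (ξ t)))) t :=
    fun t ht => (((H.hasDerivAt t ht).sub (hasDerivAt_id t)).exp.mul
      ((H.hasDerivAt_vel t ht).const_add 1)).congr_deriv
        (by simp only [Pi.sub_apply, id]; ring)
  have hAmono : MonotoneOn (fun t => Real.exp (ξ t - t) * (1 + p t)) s := by
    refine monotoneOn_of_deriv_nonneg hconv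
      (fun t ht => (hAd t ht).continuousAt.continuousWithinAt)
      (fun t ht => (hAd t (interior_subset ht)).differentiableAt.differentiableWithinAt)
      fun t ht => ?_
    have ht := interior_subset ht
    rw [(hAd t ht).deriv]
    exact mul_nonneg (Real.exp_pos _).le (mul_nonneg (hD t ht).le (by linarith [hG t ht]))
  obtain ⟨c, hc⟩ := H.nonempty
  have hpc : 0 < 1 + p c := by linarith [(abs_lt.1 (abs_vel_lt_one hD hc)).1]
  obtain ⟨b, hb⟩ := (H.ordConnected.Ici_subset_or_isLUB H.nonempty).resolve_left (by
    intro hall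
    have hlim : Tendsto (fun t => (-h) * (Real.exp (ξ c - c) * (1 + p c) / 2 * Real.exp t) ^ n)
        atTop atTop :=
      ((tendsto_pow_atTop hn.ne').comp
        (Real.tendsto_exp_atTop.const_mul_atTop (by positivity))).const_mul_atTop (by linarith)
    obtain ⟨t, ht1, ht2⟩ := ((hlim.eventually_ge_atTop 1).and (eventually_ge_atTop c)).exists
    have hts := hall c hc ht2
    have h1 := hAmono hc hts ht2
    have h2 := (abs_lt.1 (abs_vel_lt_one hD hts)).2
    have h3 : Real.exp (ξ c - c) * (1 + p c) / 2 * Real.exp t ≤ Real.exp (ξ t) := by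
      have e : Real.exp (ξ t) = Real.exp (ξ t - t) * Real.exp t := by
        rw [← Real.exp_add, sub_add_cancel]
      rw [e]
      refine mul_le_mul_of_nonneg_right ?_ (Real.exp_pos _).le
      have := Real.exp_pos (ξ t - t)
      simp only at h1
      nlinarith
    have h4 : (-h) * (Real.exp (ξ c - c) * (1 + p c) / 2 * Real.exp t) ^ n ≤
        (-h) * Real.exp (n * ξ t) := by
      rw [Real.exp_nat_mul]
      have : 0 ≤ -h := by linarith
      gcongr
    linarith [hY t hts])
  obtain ⟨x₀, hx₀, h0⟩ := H.exists_tendsto_right hk0 (fun t ht => H.eq_gap_of_pos hk0 hD ht) hb hc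
      (C := 1) fun t ht =>
        (abs_vel_lt_one hD (H.ordConnected.Ico_subset_of_isLUB hb hc ⟨ht.1.le, ht.2⟩)).le
  refine ⟨b, x₀, hb, hx₀, h0, ?_⟩
  have hcb := H.isOpen.lt_of_isLUB hb hc
  have hmem : ∀ᶠ t in 𝓝[<] b, t ∈ s ∧ c ≤ t := by
    filter_upwards [Ioo_mem_nhdsLT hcb] with t ht
    exact ⟨H.ordConnected.Ico_subset_of_isLUB hb hc ⟨ht.1.le, ht.2⟩, ht.1.le⟩
  have hg : Tendsto (fun t => gap n k h (ξ t)) (𝓝[<] b) (𝓝 0) := by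
    have := ((continuous_gap n k h).tendsto x₀).comp hx₀
    rwa [(gap_eq_zero_iff hk0).2 h0] at this
  -- `0 ≤ 1 - p = (1 - p²) / (1 + p) ≤ (1 - p²) / (1 + p(c))`
  have hsq : Tendsto (fun t => 1 - p t) (𝓝[<] b) (𝓝 0) := by
    refine squeeze_zero' (g := fun t => gap n k h (ξ t) / (1 + p c)) ?_ ?_
      (by simpa using hg.div_const (1 + p c))
    · filter_upwards [hmem] with t ht
      linarith [(abs_lt.1 (abs_vel_lt_one hD ht.1)).2]
    · filter_upwards [hmem] with t ht
      have h1 := H.eq_gap_of_pos hk0 hD ht.1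
      have h2 := hpmono.monotoneOn hc ht.1 ht.2
      have h3 := (abs_lt.1 (abs_vel_lt_one hD ht.1)).2
      rw [le_div_iff₀ hpc]
      nlinarith
  simpa using hsq.const_sub 1

theorem catalog_of_mass_neg (H : Trajectory n k h ξ p s) (hn : 0 < n) (hk : 1 < k)
    (hD : ∀ t ∈ s, 0 < 1 - p t ^ 2) (hh : h < 0) :
    ∃ r₁ r₂ : ℝ, 0 < r₁ ∧ r₁ < r₂ ∧ radii s = Ioo r₁ r₂ ∧
    (∃ C : ℝ, ∀ r ∈ radii s, |radialV ξ r| ≤ C ∧ |deriv (radialV ξ) r| ≤ C) ∧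
    Tendsto (deriv (radialV ξ)) (𝓝[>] r₁) (𝓝 0) ∧
    Tendsto (fun r => r * deriv (radialV ξ) r / radialV ξ r) (𝓝[<] r₂) (𝓝 2) ∧
    BlowsUp2 (𝓝[>] r₁) (radialV ξ) ∧ BlowsUp2 (𝓝[<] r₂) (radialV ξ) := by
  obtain ⟨b, x₀, hb, hx₀, h0, hp1⟩ := H.right_end_of_mass_neg hn hk hD hh
  obtain ⟨a, y₀, ha, hy₀, h0', hp1'⟩ := H.neg.right_end_of_mass_neg hn hk (pos_neg hD) hh
  have ha' : IsGLB s (-a) := isLUB_neg.1 ha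
  have hy : Tendsto ξ (𝓝[>] (-a)) (𝓝 y₀) := by
    simpa [Function.comp_def] using hy₀.comp (tendsto_neg_nhdsGT_neg (a := a))
  have hpa : Tendsto p (𝓝[>] (-a)) (𝓝 (-1)) := by
    simpa [Function.comp_def] using (hp1'.comp (tendsto_neg_nhdsGT_neg (a := a))).neg
  have hs : s = Ioo (-a) b := eq_Ioo_of_isGLB_isLUB H.isOpen H.ordConnected H.nonempty ha' hb
  obtain ⟨c, hc⟩ := H.nonempty
  have hcI : c ∈ Ioo (-a) b := hs ▸ hc
  have hab : -a < b := hcI.1.trans hcI.2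
  have hIoo : Ioo (Real.exp (-a)) (Real.exp b) = radii s := by rw [hs, radii_Ioo]
  have hr1 : radii s ∈ 𝓝[>] (Real.exp (-a)) :=
    hIoo ▸ Ioo_mem_nhdsGT (Real.exp_lt_exp.2 hab)
  have hr2 : radii s ∈ 𝓝[<] (Real.exp b) :=
    hIoo ▸ Ioo_mem_nhdsLT (Real.exp_lt_exp.2 hab)
  have hmass : ∀ t ∈ s, Real.exp (ξ t) ≤ Real.exp x₀ := fun t ht => by
    have h1 : 0 < 1 + h * Real.exp (n * ξ t) := by
      rw [← H.energy t ht]; have := hD t ht; positivity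
    have h2 : Real.exp (n * ξ t) < Real.exp (n * x₀) := by nlinarith
    have h3 := Real.exp_lt_exp.1 h2
    exact Real.exp_le_exp.2 (le_of_mul_le_mul_left h3.le (by positivity))
  refine ⟨Real.exp (-a), Real.exp b, Real.exp_pos _, Real.exp_lt_exp.2 hab, hIoo.symm,
    ⟨max (Real.exp b * Real.exp x₀) (Real.exp x₀ * 2), fun r hr => ⟨?_, ?_⟩⟩, ?_, ?_, ?_, ?_⟩
  · have hr' : r ∈ Ioo (Real.exp (-a)) (Real.exp b) := hIoo ▸ hr
    have := hr.1
    rw [radialV, abs_of_pos (by positivity)]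
    refine le_max_of_le_left ?_
    gcongr
    · exact hr'.2.le
    · exact Real.exp_le_exp.1 (hmass _ hr.2)
  · rw [H.deriv_radialV hr, abs_mul, abs_of_pos (Real.exp_pos _)]
    refine le_max_of_le_right ?_
    have := abs_lt.1 (abs_vel_lt_one hD hr.2)
    gcongr
    · exact Real.exp_le_exp.1 (hmass _ hr.2)
    · rw [abs_le]; constructor <;> linarith
  · have h1 : Tendsto (fun t => Real.exp (ξ t) * (1 + p t)) (𝓝[>] (-a))
        (𝓝 (Real.exp y₀ * (1 + -1))) :=
      ((Real.continuous_exp.tendsto _).comp hy).mul (hpa.const_add 1)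
    rw [add_neg_cancel, mul_zero] at h1
    refine (h1.comp (tendsto_log_nhdsGT_exp (-a))).congr' ?_
    filter_upwards [hr1] with r hr
    exact (H.deriv_radialV hr).symm
  · have h1 := (hp1.comp (tendsto_log_nhdsLT_exp b)).const_add 1
    norm_num at h1
    refine h1.congr' ?_
    filter_upwards [hr2] with r hr
    rw [H.deriv_radialV hr, radialV]
    have := hr.1
    have := Real.exp_pos (ξ (Real.log r))
    field_simp
  · exact H.blowsUp2_of_tendsto hn hk (Real.exp_pos _) (tendsto_id.mono_left nhdsWithin_le_nhds)
      (tendsto_log_nhdsGT_exp _) hr1 hy h0' hpa (by norm_num)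
  · exact H.blowsUp2_of_tendsto hn hk (Real.exp_pos _) (tendsto_id.mono_left nhdsWithin_le_nhds)
      (tendsto_log_nhdsLT_exp _) hr2 hx₀ h0 hp1 (by norm_num)

end Trajectory

/-! ### Case I with `h > 0` and `2k ≥ n`: both ends -/

theorem exists_hasDerivAt_of_continuousOn {f : ℝ → ℝ} {s : Set ℝ} (ho : IsOpen s)
    (hc : s.OrdConnected) (hf : ContinuousOn f s) : ∃ F, ∀ t ∈ s, HasDerivAt F (f t) t := by
  rcases s.eq_empty_or_nonempty with rfl | ⟨c, hcs⟩
  · exact ⟨0, fun t ht => ht.elim⟩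
  refine ⟨fun t => ∫ u in c..t, f u, fun t ht => ?_⟩
  have hat := hf.continuousAt (ho.mem_nhds ht)
  exact intervalIntegral.integral_hasDerivAt_right
    ((hf.mono (hc.uIcc_subset hcs ht)).intervalIntegrable)
    (hf.stronglyMeasurableAtFilter ho t ht) hat

namespace Trajectory

variable {n k : ℕ} {h : ℝ} {ξ p : ℝ → ℝ} {s : Set ℝ}

theorem radialV_pos (ξ : ℝ → ℝ) {r : ℝ} (hr : 0 < r) : 0 < radialV ξ r :=
  mul_pos hr (Real.exp_pos _)

theorem continuousOn_radialV (H : Trajectory n k h ξ p s) :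
    ContinuousOn (radialV ξ) (radii s) :=
  fun _ hr => (H.hasDerivAt_radialV hr).continuousAt.continuousWithinAt

theorem exists_arclength (H : Trajectory n k h ξ p s) :
    ∃ Ψ : ℝ → ℝ, ∀ t ∈ s, HasDerivAt Ψ (Real.exp (-ξ t)) t :=
  exists_hasDerivAt_of_continuousOn H.isOpen H.ordConnected
    (Real.continuous_exp.comp_continuousOn H.continuousOn.neg)

theorem hasDerivAt_arclength_log {Ψ : ℝ → ℝ}
    (hΨ : ∀ t ∈ s, HasDerivAt Ψ (Real.exp (-ξ t)) t) {r : ℝ} (hr : r ∈ radii s) :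
    HasDerivAt (fun r => Ψ (Real.log r)) (1 / radialV ξ r) r := by
  have := (hΨ _ hr.2).comp r (Real.hasDerivAt_log hr.1.ne')
  refine this.congr_deriv ?_
  rw [radialV, Real.exp_neg, one_div, mul_inv, mul_comm]

theorem nonneg_of_pos (H : Trajectory n k h ξ p s) (hk : 0 < k) (hD : ∀ t ∈ s, 0 < 1 - p t ^ 2)
    (hh : 0 < h) {t : ℝ} (ht : t ∈ s) : 0 ≤ ξ t := by
  have h1 := H.energy t ht
  have h2 : (1 - p t ^ 2) ^ k ≤ 1 := pow_le_one₀ (hD t ht).le (by linarith [sq_nonneg (p t)])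
  have h3 : 1 < Real.exp (2 * k * ξ t) := by
    have := mul_pos hh (Real.exp_pos (n * ξ t))
    nlinarith [Real.exp_pos (2 * k * ξ t)]
  have h4 := Real.one_lt_exp_iff.1 h3
  exact (pos_of_mul_pos_right h4 (by positivity)).le

/-- If `2k ≥ n` and `h > 0`, then the velocity increases. -/
theorem vel_strictMono (H : Trajectory n k h ξ p univ) (hk : 0 < k) (h2k : n ≤ 2 * k)
    (hD : ∀ t ∈ univ, 0 < 1 - p t ^ 2) (hh : 0 < h) : StrictMono p := by
  refine strictMono_of_hasDerivAt_pos (fun t => H.hasDerivAt_vel t (mem_univ t)) fun t => ?_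
  refine mul_pos (hD t (mem_univ t)) ?_
  have h1 : (n : ℝ) / (2 * k) ≤ 1 := div_le_one_of_le₀ (by exact_mod_cast h2k) (by positivity)
  have hY : 0 < h * Real.exp (n * ξ t) := by positivity
  have h2 : massRatio n h (ξ t) < 1 := by
    rw [massRatio, div_lt_one (by positivity)]; linarith
  have h3 : 0 < massRatio n h (ξ t) := by unfold massRatio; positivity
  nlinarith

/-- If `2k ≥ n` and `h > 0`, the velocity is bounded by a negative constant near `-∞`; otherwise `ξ` would
be increasing, and the acceleration bounded from below by a positive constant. -/
theorem exists_vel_le_neg (H : Trajectory n k h ξ p univ) (hk : 0 < k) (h2k : n ≤ 2 * k)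
    (hD : ∀ t ∈ univ, 0 < 1 - p t ^ 2) (hh : 0 < h) :
    ∃ c δ, 0 < δ ∧ ∀ t ≤ c, p t ≤ -δ := by
  have hmono := H.vel_strictMono hk h2k hD hh
  by_contra hcon
  have hp0 : ∀ t, 0 ≤ p t := fun t => by
    by_contra hneg
    exact hcon ⟨t, -p t, by linarith, fun u hu => by linarith [hmono.monotone hu]⟩
  have hξmono : Monotone ξ :=
    monotone_of_hasDerivAt_nonneg (fun t => H.hasDerivAt t (mem_univ t)) hp0
  set m := (1 - p 0 ^ 2) * (1 + h * Real.exp (n * ξ 0))⁻¹ with hm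
  have hD0 := hD 0 (mem_univ 0)
  have hmpos : 0 < m := by positivity
  have hlow : ∀ t ≤ 0, m ≤ (1 - p t ^ 2) * (1 - n / (2 * k) * massRatio n h (ξ t)) := fun t ht => by
    have h1 := H.one_sub_massRatio (mem_univ t)
    have h2 : (1 + h * Real.exp (n * ξ 0))⁻¹ ≤ (1 + h * Real.exp (n * ξ t))⁻¹ := by
      have := hξmono ht
      gcongr
    have h3 : 0 ≤ massRatio n h (ξ t) := by unfold massRatio; positivity
    have h4 : (n : ℝ) / (2 * k) ≤ 1 := div_le_one_of_le₀ (by exact_mod_cast h2k) (by positivity)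
    have h5 := hmono.monotone ht
    have h6 := hp0 t
    refine mul_le_mul (by nlinarith) (by nlinarith) (by positivity) (hD t (mem_univ t)).le
  have h1 := le_of_deriv_le_neg (f := fun t => -p t) (c := 0) (m := m)
    (t := -(p 0 + 1) / m) (fun t _ => (H.hasDerivAt_vel t (mem_univ t)).fun_neg)
    (fun t ht => neg_le_neg (hlow t ht)) (by
      have := hp0 0
      rw [neg_div]; exact neg_nonpos.2 (by positivity))
  have h2 : m * (0 - -(p 0 + 1) / m) = p 0 + 1 := by field_simp; ring
  rw [h2] at h1
  have := hp0 (-(p 0 + 1) / m)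
  linarith

theorem exists_linear_lower_bound (H : Trajectory n k h ξ p univ) (hk : 0 < k) (h2k : n ≤ 2 * k)
    (hD : ∀ t ∈ univ, 0 < 1 - p t ^ 2) (hh : 0 < h) :
    ∃ C δ, 0 < δ ∧ ∀ t ≤ 0, -C - δ * t ≤ ξ t := by
  obtain ⟨c, δ, hδ, hp⟩ := H.exists_vel_le_neg hk h2k hD hh
  refine ⟨|ξ c| + δ * |c|, δ, hδ, fun t ht => ?_⟩
  rcases le_total t c with htc | htc
  · have := le_of_deriv_le_neg (fun u _ => H.hasDerivAt u (mem_univ u)) hp htc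
    nlinarith [neg_abs_le (ξ c), neg_abs_le c]
  · have := H.nonneg_of_pos hk hD hh (mem_univ t)
    nlinarith [neg_abs_le c, abs_nonneg (ξ c)]

theorem tendsto_atBot_atTop (H : Trajectory n k h ξ p univ) (hk : 0 < k) (h2k : n ≤ 2 * k)
    (hD : ∀ t ∈ univ, 0 < 1 - p t ^ 2) (hh : 0 < h) : Tendsto ξ atBot atTop := by
  obtain ⟨C, δ, hδ, hl⟩ := H.exists_linear_lower_bound hk h2k hD hh
  refine tendsto_atTop_mono' atBot ((eventually_le_atBot 0).mono hl) ?_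
  have : Tendsto (fun t : ℝ => -δ * t) atBot atTop :=
    tendsto_id.const_mul_atBot_of_neg (by linarith)
  simpa [sub_eq_add_neg] using tendsto_atTop_add_const_left atBot (-C) this

theorem vel_nonpos_atBot (H : Trajectory n k h ξ p univ) (hk : 0 < k) (h2k : n ≤ 2 * k)
    (hD : ∀ t ∈ univ, 0 < 1 - p t ^ 2) (hh : 0 < h) : ∀ᶠ t in atBot, p t ≤ 0 := by
  obtain ⟨c, δ, hδ, hp⟩ := H.exists_vel_le_neg hk h2k hD hh
  filter_upwards [eventually_le_atBot c] with t ht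
  linarith [hp t ht]

theorem neg_univ (H : Trajectory n k h ξ p univ) :
    Trajectory n k h (fun t => ξ (-t)) (fun t => -p (-t)) univ := H.neg

theorem pos_neg_univ (hD : ∀ t ∈ univ, 0 < 1 - p t ^ 2) :
    ∀ t ∈ univ, 0 < 1 - (-p (-t)) ^ 2 := pos_neg hD

theorem rootExpansion_of_pos (H : Trajectory n k h ξ p univ) (hk : 0 < k) (hkn : k ≤ n)
    (h2k : n < 2 * k) (hD : ∀ t ∈ univ, 0 < 1 - p t ^ 2) (hh : 0 < h) :
    RootExpansion n k (-h ^ (1 / (k : ℝ))) (radialV ξ) := by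
  have := H.rootExpansion hk hkn h2k (c := 0) one_ne_zero
    (fun t ht => H.eq_gap_of_pos hk hD ht) hh.ne' (subset_univ _)
    (H.tendsto_atBot_atTop hk h2k.le hD hh) (H.vel_nonpos_atBot hk h2k.le hD hh)
  rwa [neg_one_mul, abs_of_pos hh] at this

/-- `v⁻² = e^{-2(ξ + t)}` is differentiable in `r^α`, `α = 2 - n/k`, with a bounded derivative. -/
theorem extendsHolder (H : Trajectory n k h ξ p univ) (hk : 0 < k) (hkn : k ≤ n)
    (h2k : n < 2 * k) (hD : ∀ t ∈ univ, 0 < 1 - p t ^ 2) (hh : 0 < h) :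
    ExtendsHolder n (2 - (n : ℝ) / k) (radialV ξ) := by
  have hn : 0 < n := by omega
  have hk0 : (0 : ℝ) < k := by positivity
  set α := 2 - (n : ℝ) / k with hαdef
  have hα : 0 < α := by
    have : (n : ℝ) < 2 * k := by exact_mod_cast h2k
    rw [hαdef, sub_pos, div_lt_iff₀ hk0]; exact this
  have hα1 : α ≤ 1 := by
    have : 1 ≤ (n : ℝ) / k := by rw [one_le_div hk0]; exact_mod_cast hkn
    linarith
  obtain ⟨-, l, hl, -⟩ := H.exists_tendsto_add_id hn hk h2k
    (fun t ht => H.eq_gap_of_pos hk hD ht) (subset_univ (Iic 0))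
    (H.tendsto_atBot_atTop hk h2k.le hD hh) (H.vel_nonpos_atBot hk h2k.le hD hh)
  have hp1 : ∀ t, -1 < p t ∧ p t < 1 := fun t => abs_lt.1 (abs_vel_lt_one hD (mem_univ t))
  have hmono : Monotone fun t => ξ t + t :=
    monotone_of_hasDerivAt_nonneg (f' := fun t => p t + 1)
      (fun t => (H.hasDerivAt t (mem_univ t)).add (hasDerivAt_id t)) fun t => by
      change 0 ≤ p t + 1; linarith [hp1 t]
  have hlow : ∀ t, l ≤ ξ t + t := fun t =>
    le_of_tendsto hl ((eventually_le_atBot t).mono fun u hu => hmono hu)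
  have hpm := (H.vel_strictMono hk h2k.le hD hh).monotone
  -- a bound for the derivative in `t`
  have hbound : ∀ T : ℝ, ∃ M : ℝ, 0 ≤ M ∧ ∀ t ≤ T,
      |Real.exp (-2 * (ξ t + t)) * (-2 * (p t + 1))| ≤ M * Real.exp (α * t) := fun T => by
    have hT : 0 < 1 - p T := by linarith [hp1 T]
    refine ⟨Real.exp (-2 * l) * (2 * ((1 + h) ^ (1 / (k : ℝ)) * Real.exp (-α * l) / (1 - p T))),
      by positivity, fun t ht => ?_⟩
    have h1 : 0 < 1 - p t := by linarith [hp1 t]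
    have e1 : p t + 1 = gap n k h (ξ t) / (1 - p t) := by
      rw [eq_div_iff h1.ne', ← one_mul (gap _ _ _ _), ← H.eq_gap_of_pos hk hD (mem_univ t)]; ring
    have h2 : gap n k h (ξ t) ≤
        (1 + h) ^ (1 / (k : ℝ)) * (Real.exp (-α * l) * Real.exp (α * t)) := by
      have e2 : gap n k h (ξ t) =
          |Real.exp (-n * ξ t) + h| ^ (1 / (k : ℝ)) * Real.exp (-α * ξ t) := by
        rw [← gap_mul_exp hk, ← hαdef, mul_assoc, ← Real.exp_add]; simp
      rw [e2, ← Real.exp_add]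
      have h3 := H.nonneg_of_pos hk hD hh (mem_univ t)
      have h4 : Real.exp (-n * ξ t) ≤ 1 := Real.exp_le_one_iff.2 (by
        rw [neg_mul]; exact neg_nonpos.2 (by positivity))
      gcongr
      · rw [abs_of_pos (by positivity)]; linarith
      · nlinarith [hlow t]
    have h5 : 0 ≤ p t + 1 := by linarith [hp1 t]
    rw [abs_mul, abs_of_pos (Real.exp_pos _), abs_mul, abs_of_nonneg h5, abs_neg,
      abs_of_pos (two_pos (α := ℝ))]
    calc Real.exp (-2 * (ξ t + t)) * (2 * (p t + 1))
        ≤ Real.exp (-2 * l) * (2 * ((1 + h) ^ (1 / (k : ℝ)) *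
          (Real.exp (-α * l) * Real.exp (α * t)) / (1 - p T))) := by
          rw [e1]
          refine mul_le_mul (Real.exp_le_exp.2 (by linarith [hlow t])) ?_
            (mul_nonneg two_pos.le (div_nonneg (gap_nonneg _ _ _ _) h1.le)) (Real.exp_pos _).le
          gcongr
          exact hpm ht
      _ = _ := by ring
  have hF : ∀ t, HasDerivAt (fun t => Real.exp (-2 * (ξ t + t)))
      (Real.exp (-2 * (ξ t + t)) * (-2 * (p t + 1))) t := fun t =>
    (((H.hasDerivAt t (mem_univ t)).add (hasDerivAt_id t)).const_mul (-2)).exp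
  have hdiff : ∀ T M : ℝ, 0 ≤ M → (∀ t ≤ T,
      |Real.exp (-2 * (ξ t + t)) * (-2 * (p t + 1))| ≤ M * Real.exp (α * t)) →
      ∀ u t, u ≤ t → t ≤ T → |Real.exp (-2 * (ξ t + t)) - Real.exp (-2 * (ξ u + u))| ≤
        M / α * (Real.exp (α * t) - Real.exp (α * u)) := by
    intro T M hM hb u t hut htT
    have hE : ∀ t, HasDerivAt (fun t => M / α * Real.exp (α * t)) (M * Real.exp (α * t)) t :=
      fun t => by
        refine (((hasDerivAt_id t).const_mul α).exp.const_mul (M / α)).congr_deriv ?_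
        simp only [id]
        field_simp
    have hm : ∀ ε : ℝ, |ε| = 1 → MonotoneOn (fun t => M / α * Real.exp (α * t) +
        ε * Real.exp (-2 * (ξ t + t))) (Iic T) := fun ε hε => by
      have hd : ∀ t, HasDerivAt (fun t => M / α * Real.exp (α * t) +
        ε * Real.exp (-2 * (ξ t + t))) _ t := fun t => (hE t).add ((hF t).const_mul ε)
      refine monotoneOn_of_deriv_nonneg (convex_Iic T)
        (fun t _ => (hd t).continuousAt.continuousWithinAt)
        (fun t _ => (hd t).differentiableAt.differentiableWithinAt) fun t ht => ?_
      have ht := mem_Iic.1 (interior_subset ht)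
      rw [(hd t).deriv]
      have h1 := hb t ht
      have h2 := neg_abs_le (ε * (Real.exp (-2 * (ξ t + t)) * (-2 * (p t + 1))))
      rw [abs_mul, hε, one_mul] at h2
      linarith
    have h1 := hm 1 (by simp) (mem_Iic.2 (hut.trans htT)) (mem_Iic.2 htT) hut
    have h2 := hm (-1) (by simp) (mem_Iic.2 (hut.trans htT)) (mem_Iic.2 htT) hut
    simp only at h1 h2
    rw [abs_le]
    constructor <;> linarith
  let G : ℝ → ℝ := fun r => if r = 0 then Real.exp (-2 * l) else radialV ξ r ^ (-2 : ℤ)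
  have hGpos : ∀ r, 0 < r → G r = Real.exp (-2 * (ξ (Real.log r) + Real.log r)) := fun r hr => by
    simp only [G, hr.ne', if_false]
    exact radialV_zpow hr
  have hG0 : Tendsto G (𝓝[>] 0) (𝓝 (G 0)) := by
    have h1 : Tendsto (fun t => Real.exp (-2 * (ξ t + t))) atBot (𝓝 (G 0)) := by
      simp only [G, if_true]
      exact (Real.continuous_exp.tendsto _).comp (hl.const_mul (-2))
    refine (h1.comp Real.tendsto_log_nhdsGT_zero).congr' ?_
    filter_upwards [self_mem_nhdsWithin] with r hr
    exact (hGpos r hr).symm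
  have hGH : ∀ R : ℝ, 0 < R → ∃ K : ℝ, 0 ≤ K ∧ ∀ r u, 0 ≤ r → r ≤ u → u ≤ R →
      |G u - G r| ≤ K * (u - r) ^ α := by
    intro R hR
    obtain ⟨M, hM, hb⟩ := hbound (Real.log R)
    have hpos : ∀ r u, 0 < r → r ≤ u → u ≤ R → |G u - G r| ≤ M / α * (u - r) ^ α := by
      intro r u hr hru huR
      have hu := hr.trans_le hru
      rw [hGpos r hr, hGpos u hu]
      refine (hdiff _ M hM hb _ _ (Real.log_le_log hr hru) (Real.log_le_log hu huR)).trans ?_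
      rw [mul_comm α, mul_comm α, ← Real.rpow_def_of_pos hr, ← Real.rpow_def_of_pos hu]
      have := Real.rpow_add_le_add_rpow hr.le (sub_nonneg.2 hru) hα.le hα1
      rw [add_sub_cancel] at this
      have h0 : 0 ≤ M / α := by positivity
      exact mul_le_mul_of_nonneg_left (by linarith) h0
    refine ⟨M / α, by positivity, fun r u hr hru huR => ?_⟩
    rcases hr.eq_or_lt with rfl | hr
    · rcases hru.eq_or_lt with rfl | hu
      · simp [Real.zero_rpow hα.ne']
      · have h1 : Tendsto (fun r => M / α * (u - r) ^ α) (𝓝[>] 0) (𝓝 (M / α * (u - 0) ^ α)) := by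
          refine Tendsto.const_mul _ (Tendsto.rpow_const ?_ (Or.inr hα.le))
          exact (tendsto_id.mono_left nhdsWithin_le_nhds).const_sub u
        refine le_of_tendsto_of_tendsto ((hG0.const_sub (G u)).abs) h1 ?_
        filter_upwards [Ioo_mem_nhdsGT hu] with r hr
        exact hpos r u hr.1 hr.2.le huR
    · exact hpos r u hr hru huR
  refine ⟨fun x => G ‖x‖, fun x => ?_, fun x hx => ?_, fun R => ?_⟩
  · change 0 < G ‖x‖
    by_cases hx : ‖x‖ = 0
    · simp only [G, hx, if_true]; exact Real.exp_pos _
    · rw [hGpos _ ((norm_nonneg x).lt_of_ne' hx)]; exact Real.exp_pos _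
  · simp only [G, norm_ne_zero_iff.2 hx, if_false]
  · obtain ⟨K, hK, hKG⟩ := hGH (max R 1) (by positivity)
    refine ⟨K.toNNReal, fun x hx y hy => ?_⟩
    have hx' : ‖x‖ ≤ max R 1 := (mem_closedBall_zero_iff.1 hx).trans (le_max_left _ _)
    have hy' : ‖y‖ ≤ max R 1 := (mem_closedBall_zero_iff.1 hy).trans (le_max_left _ _)
    have key : |G ‖x‖ - G ‖y‖| ≤ K * |‖x‖ - ‖y‖| ^ α := by
      rcases le_total ‖x‖ ‖y‖ with hxy | hxy
      · rw [abs_sub_comm, abs_sub_comm ‖x‖, abs_of_nonneg (sub_nonneg.2 hxy)]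
        exact hKG _ _ (norm_nonneg _) hxy hy'
      · rw [abs_of_nonneg (sub_nonneg.2 hxy)]
        exact hKG _ _ (norm_nonneg _) hxy hx'
    rw [Real.coe_toNNReal _ hα.le, edist_dist, edist_dist, Real.dist_eq,
      ENNReal.ofReal_rpow_of_nonneg dist_nonneg hα.le]
    change _ ≤ ENNReal.ofReal K * _
    rw [← ENNReal.ofReal_mul hK]
    refine ENNReal.ofReal_le_ofReal (key.trans ?_)
    have := abs_norm_sub_norm_le x y
    rw [dist_eq_norm]
    gcongr

end Trajectory

/-! ### Case I with `h > 0` and `2k = n` -/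

theorem simConst_atTop_of_neg {ξ : ℝ → ℝ} {β : ℝ}
    (h : SimConst (𝓝[>] 0) (fun r => radialV (fun t => ξ (-t)) r ^ (-2 : ℤ))
      (fun r => r ^ (2 * (β - 1)))) :
    SimConst atTop (fun r => radialV ξ r ^ (-2 : ℤ)) (fun r => r ^ (-2 * (1 + β))) := by
  obtain ⟨c, hc, hlim⟩ := h
  refine ⟨c, hc, (hlim.comp tendsto_inv_atTop_nhdsGT_zero).congr' ?_⟩
  filter_upwards [eventually_gt_atTop 0] with r hr
  simp only [Function.comp_apply]
  rw [radialV_zpow hr, radialV_zpow (inv_pos.2 hr), Real.rpow_def_of_pos hr,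
    Real.rpow_def_of_pos (inv_pos.2 hr), ← Real.exp_sub, ← Real.exp_sub, Real.log_inv]
  ring_nf

/-- The volume is finite as soon as `ξ` grows linearly at both ends. -/
theorem gVolume_lt_top {n : ℕ} (hn : 0 < n) {ξ : ℝ → ℝ} (hξ : Continuous ξ) {C C' δ δ' : ℝ}
    (hδ : 0 < δ) (hδ' : 0 < δ') (h1 : ∀ t ≤ 0, -C - δ * t ≤ ξ t)
    (h2 : ∀ t ≥ 0, -C' + δ' * t ≤ ξ t) : gVolume n (radialV ξ) (Ioi 0) < ⊤ := by
  have hn0 : (0 : ℝ) < n := by positivity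
  have e1 : ∀ y : ℝ, 0 < y → y ^ (n - 1) * (radialV ξ y)⁻¹ ^ n =
      Real.exp (-n * ξ (Real.log y)) / y := fun y hy => by
    have e2 : y ^ n = y ^ (n - 1) * y := by rw [← pow_succ]; congr 1; omega
    rw [radialV, inv_pow, mul_pow, ← Real.exp_nat_mul, e2, neg_mul, Real.exp_neg]
    field_simp
  have hint : IntegrableOn (fun y : ℝ => y ^ (n - 1) • (radialV ξ y)⁻¹ ^ n) (Ioi 0) := by
    have hcont : ContinuousOn (fun y : ℝ => Real.exp (-n * ξ (Real.log y)) / y) (Ioi 0) := by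
      have hl : ContinuousOn Real.log (Ioi 0) :=
        Real.continuousOn_log.mono fun y hy => (mem_Ioi.1 hy).ne'
      exact ((Real.continuous_exp.comp_continuousOn
        ((hξ.comp_continuousOn hl).const_mul (-(n : ℝ))))).div continuousOn_id
          fun y hy => (mem_Ioi.1 hy).ne'
    have hexp : ∀ c δ y : ℝ, 0 < y → Real.exp (-n * (-c + δ * Real.log y)) / y =
        Real.exp (n * c) * y ^ (-n * δ - 1) := fun c δ y hy => by
      rw [Real.rpow_def_of_pos hy]
      nth_rw 2 [← Real.exp_log hy]
      rw [← Real.exp_sub, ← Real.exp_add]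
      ring_nf
    have hbd : ∀ c δ y : ℝ, 0 < y → -c + δ * Real.log y ≤ ξ (Real.log y) →
        ‖Real.exp (-n * ξ (Real.log y)) / y‖ ≤ Real.exp (n * c) * y ^ (-n * δ - 1) :=
      fun c δ y hy hle => by
        rw [← hexp c δ y hy, Real.norm_eq_abs, abs_of_pos (by positivity)]
        refine div_le_div_of_nonneg_right (Real.exp_le_exp.2 ?_) hy.le
        nlinarith
    have hsplit : IntegrableOn (fun y : ℝ => Real.exp (-n * ξ (Real.log y)) / y) (Ioi 0) := by
      rw [← Ioc_union_Ioi_eq_Ioi (zero_le_one (α := ℝ))]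
      refine IntegrableOn.union ?_ ?_
      · have hi : IntegrableOn (fun y : ℝ => Real.exp (n * C) * y ^ (-n * -δ - 1)) (Ioc 0 1) := by
          have := intervalIntegral.intervalIntegrable_rpow' (a := 0) (b := 1)
            (r := -n * -δ - 1) (by have := mul_pos hn0 hδ; linarith)
          exact ((intervalIntegrable_iff_integrableOn_Ioc_of_le zero_le_one).1 this).const_mul _
        refine Integrable.mono' hi ((hcont.mono fun y hy => hy.1).aestronglyMeasurable
          measurableSet_Ioc) ?_
        filter_upwards [self_mem_ae_restrict measurableSet_Ioc] with y hy
        refine hbd C (-δ) y hy.1 ?_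
        have := h1 _ (Real.log_nonpos hy.1.le hy.2)
        linarith
      · have hi : IntegrableOn (fun y : ℝ => Real.exp (n * C') * y ^ (-n * δ' - 1)) (Ioi 1) := by
          exact (integrableOn_Ioi_rpow_of_lt (by have := mul_pos hn0 hδ'; linarith)
            one_pos).const_mul _
        refine Integrable.mono' hi ((hcont.mono fun y hy =>
          zero_lt_one.trans (mem_Ioi.1 hy)).aestronglyMeasurable measurableSet_Ioi) ?_
        filter_upwards [self_mem_ae_restrict measurableSet_Ioi] with y hy
        have hy1 : 1 < y := hy
        exact hbd C' δ' y (zero_lt_one.trans hy1) (h2 _ (Real.log_nonneg hy1.le))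
    refine hsplit.congr_fun (fun y hy => ?_) measurableSet_Ioi
    rw [smul_eq_mul, e1 y hy]
  have : Nontrivial (EuclideanSpace ℝ (Fin n)) := by
    have : Nonempty (Fin n) := ⟨⟨0, hn⟩⟩
    infer_instance
  have hfin := (integrable_fun_norm_addHaar (E := EuclideanSpace ℝ (Fin n)) volume
    (f := fun y => (radialV ξ y)⁻¹ ^ n)).2 (by simpa using hint)
  refine lt_of_le_of_lt (setLIntegral_le_lintegral _ _) ?_
  refine lt_of_le_of_lt (lintegral_mono fun x => ?_) hfin.2
  exact Real.ofReal_le_enorm _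

namespace Trajectory

variable {n k : ℕ} {h : ℝ} {ξ p : ℝ → ℝ} {s : Set ℝ}

theorem catalog_of_pos_of_eq (H : Trajectory n k h ξ p univ) (hk : 0 < k) (h2k : 2 * k = n)
    (hD : ∀ t ∈ univ, 0 < 1 - p t ^ 2) (hh : 0 < h) : h < 1 ∧
      SimConst (𝓝[>] 0) (fun r => radialV ξ r ^ (-2 : ℤ))
        (fun r => r ^ (-2 * (1 - √(1 - h ^ (1 / (k : ℝ)))))) ∧
      SimConst atTop (fun r => radialV ξ r ^ (-2 : ℤ))
        (fun r => r ^ (-2 * (1 + √(1 - h ^ (1 / (k : ℝ)))))) ∧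
      ¬ IsCompleteMetric n (radialV ξ) (Ioi 0) ∧ gVolume n (radialV ξ) (Ioi 0) < ⊤ := by
  have hn : 0 < n := by omega
  have h1 : h < 1 := by
    have e := H.energy 0 (mem_univ 0)
    have e2 : (2 : ℝ) * k = n := by exact_mod_cast h2k
    rw [e2] at e
    have h2 : (1 - p 0 ^ 2) ^ k ≤ 1 :=
      pow_le_one₀ (hD 0 (mem_univ 0)).le (by linarith [sq_nonneg (p 0)])
    have h3 := Real.exp_pos (n * ξ 0)
    by_contra hcon
    nlinarith
  have hroot : h ^ (1 / (k : ℝ)) < 1 := Real.rpow_lt_one hh.le h1 (by positivity)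
  set β := √(1 - h ^ (1 / (k : ℝ))) with hβdef
  have hβ : 0 < β := Real.sqrt_pos.2 (by linarith)
  have hβ2 : β ^ 2 = 1 - 1 * |h| ^ (1 / (k : ℝ)) := by
    rw [hβdef, Real.sq_sqrt (by linarith), abs_of_pos hh, one_mul]
  have h2k' : n ≤ 2 * k := h2k.ge
  obtain ⟨C, δ, hδ, hl⟩ := H.exists_linear_lower_bound hk h2k' hD hh
  obtain ⟨C', δ', hδ', hl'⟩ := H.neg_univ.exists_linear_lower_bound hk h2k' (pos_neg_univ hD) hh
  have hξc : Continuous ξ := continuousOn_univ.1 H.continuousOn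
  refine ⟨h1, ?_, ?_, ?_, ?_⟩
  · have := H.simConst_of_eq hk h2k (c := 0) (fun t ht => H.eq_gap_of_pos hk hD ht) hh.ne'
      hβ hβ2 (subset_univ _) (H.tendsto_atBot_atTop hk h2k' hD hh)
      (H.vel_nonpos_atBot hk h2k' hD hh)
    rwa [show -2 * (1 - β) = 2 * (β - 1) by ring]
  · exact simConst_atTop_of_neg (H.neg_univ.simConst_of_eq hk h2k (c := 0)
      (fun t ht => H.neg_univ.eq_gap_of_pos hk (pos_neg_univ hD) ht) hh.ne'
      hβ hβ2 (subset_univ _) (H.neg_univ.tendsto_atBot_atTop hk h2k' (pos_neg_univ hD) hh)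
      (H.neg_univ.vel_nonpos_atBot hk h2k' (pos_neg_univ hD) hh))
  · obtain ⟨Ψ, hΨ⟩ := H.exists_arclength
    obtain ⟨L, hL⟩ := exists_tendsto_atBot_of_exp_bound (c := 0) (C := Real.exp C) hδ
      (fun t _ => hΨ t (mem_univ t)) (Real.continuous_exp.comp hξc.neg).continuousOn
      (fun t ht => by
        rw [abs_of_pos (Real.exp_pos _), ← Real.exp_add]
        exact Real.exp_le_exp.2 (by linarith [hl t ht]))
    have hI : radii univ = Ioi 0 := radii_univ
    refine not_isCompleteMetric hn (fun r hr => radialV_pos ξ hr) (hI ▸ H.continuousOn_radialV)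
      (fun r hr => hasDerivAt_arclength_log hΨ (hI ▸ hr)) (L := L) ?_
    exact hL.comp Real.tendsto_log_nhdsGT_zero
  · refine gVolume_lt_top hn hξc (C' := C') hδ hδ' hl fun t ht => ?_
    have := hl' (-t) (by linarith)
    rw [neg_neg] at this
    linarith

end Trajectory

/-! ### Case I with `h > 0` and `2k < n`: periodic solutions -/

theorem eq_zero_of_tendsto_deriv_of_bounded {f f' : ℝ → ℝ} {q c M : ℝ}
    (hf : ∀ t ≤ c, HasDerivAt f (f' t) t) (hq : Tendsto f' atBot (𝓝 q))
    (hM : ∀ t ≤ c, |f t| ≤ M) : q = 0 := by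
  have key : ∀ (g g' : ℝ → ℝ) (q : ℝ), (∀ t ≤ c, HasDerivAt g (g' t) t) →
      Tendsto g' atBot (𝓝 q) → (∀ t ≤ c, |g t| ≤ M) → ¬ q < 0 := by
    intro g g' q hg hq hM hneg
    obtain ⟨d, hd⟩ := eventually_atBot.1 ((hq.eventually_le_const
      (show q < -(-q / 2) by linarith)).and (eventually_le_atBot c))
    have hlow := fun t ht => le_of_deriv_le_neg (f := g) (t := t) (c := d)
      (fun u hu => hg u (hd u hu).2) (fun u hu => (hd u hu).1) ht
    have hM0 : 0 ≤ M := (abs_nonneg _).trans (hM d (hd d le_rfl).2)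
    have ht : d - (2 * M + 1) / (-q / 2) ≤ d := by
      have : 0 < -q / 2 := by linarith
      have : 0 ≤ (2 * M + 1) / (-q / 2) := by positivity
      linarith
    have h1 := hlow _ ht
    have h2 : -q / 2 * (d - (d - (2 * M + 1) / (-q / 2))) = 2 * M + 1 := by
      have : -q / 2 ≠ 0 := by linarith
      rw [sub_sub_cancel, mul_div_cancel₀ _ this]
    have h3 := abs_le.1 (hM d (hd d le_rfl).2)
    have h4 := abs_le.1 (hM _ (hd _ ht).2)
    rw [h2] at h1
    linarith
  have h1 := key f f' q hf hq hM
  have h2 := key (fun t => -f t) (fun t => -f' t) (-q) (fun t ht => (hf t ht).fun_neg) hq.neg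
    (fun t ht => by rw [abs_neg]; exact hM t ht)
  linarith

/-- The mass of the cylindrical metric is the maximal one: Bernoulli's inequality for the exponent
`θ = n / (2k)`, with equality at `e^{2kx} = n / (n - 2k)` only. -/
theorem exp_sub_one_le_mass {n k : ℕ} (hk : 0 < k) (h2k : 2 * k < n) (x : ℝ) :
    Real.exp (2 * k * x) - 1 ≤ 2 * k / (n - 2 * k) *
      (((n : ℝ) - 2 * k) / n) ^ ((n : ℝ) / (2 * k)) * Real.exp (n * x) ∧
    (Real.exp (2 * k * x) - 1 = 2 * k / (n - 2 * k) *
      (((n : ℝ) - 2 * k) / n) ^ ((n : ℝ) / (2 * k)) * Real.exp (n * x) →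
      Real.exp (2 * k * x) = n / (n - 2 * k)) := by
  have hk0 : (0 : ℝ) < k := by positivity
  have h2k' : (2 : ℝ) * k < n := by exact_mod_cast h2k
  have hn0 : (0 : ℝ) < n := by linarith
  have hd : (0 : ℝ) < n - 2 * k := by linarith
  set θ := (n : ℝ) / (2 * k) with hθ
  have hθ1 : 1 < θ := by rw [hθ, one_lt_div (by positivity)]; exact h2k'
  set u := Real.exp (2 * k * x) with hu
  have hu0 : 0 < u := Real.exp_pos _
  have e1 : Real.exp (n * x) = u ^ θ := by
    rw [hu, ← Real.exp_mul, hθ]; congr 1; field_simp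
  have e2 : (((n : ℝ) - 2 * k) / n) ^ θ * Real.exp (n * x) =
      (1 + (u * ((n - 2 * k) / n) - 1)) ^ θ := by
    rw [e1, ← Real.mul_rpow (by positivity) hu0.le]; congr 1; ring
  have e3 : u - 1 = 2 * k / (n - 2 * k) * (1 + θ * (u * ((n - 2 * k) / n) - 1)) := by
    rw [hθ]; field_simp; ring
  have hc : (0 : ℝ) < 2 * k / (n - 2 * k) := by positivity
  have hs : -1 ≤ u * ((n - 2 * k) / n) - 1 := by
    have : 0 < u * ((n - 2 * k) / n) := by positivity
    linarith
  have hlt : u * ((n - 2 * k) / n) - 1 ≠ 0 → u - 1 < 2 * k / (n - 2 * k) *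
      (((n : ℝ) - 2 * k) / n) ^ θ * Real.exp (n * x) := fun h => by
    rw [mul_assoc, e2, e3]
    exact mul_lt_mul_of_pos_left (one_add_mul_self_lt_rpow_one_add hs h hθ1) hc
  by_cases h : u * ((n - 2 * k) / n) - 1 = 0
  · refine ⟨?_, fun _ => ?_⟩
    · rw [mul_assoc, e2, e3, h]; simp
    · rw [eq_div_iff hd.ne']
      field_simp at h
      linarith
  · exact ⟨(hlt h).le, fun heq => absurd heq (hlt h).ne⟩

namespace Trajectory

variable {n k : ℕ} {h : ℝ} {ξ p : ℝ → ℝ} {s : Set ℝ}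

theorem mass_mul_exp_le (H : Trajectory n k h ξ p s) (hD : ∀ t ∈ s, 0 < 1 - p t ^ 2) {t : ℝ}
    (ht : t ∈ s) : h * Real.exp (n * ξ t) ≤ Real.exp (2 * k * ξ t) - 1 := by
  have h1 : (1 - p t ^ 2) ^ k ≤ 1 := pow_le_one₀ (hD t ht).le (by linarith [sq_nonneg (p t)])
  have h2 := H.energy t ht
  nlinarith [Real.exp_pos (2 * k * ξ t)]

theorem exists_upper_bound (H : Trajectory n k h ξ p s) (h2k : 2 * k < n)
    (hD : ∀ t ∈ s, 0 < 1 - p t ^ 2) (hh : 0 < h) : ∃ X, ∀ t ∈ s, ξ t ≤ X := by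
  have h2k' : (2 : ℝ) * k < n := by exact_mod_cast h2k
  have hd : (0 : ℝ) < n - 2 * k := by linarith
  refine ⟨Real.log (1 / h) / (n - 2 * k), fun t ht => ?_⟩
  rw [le_div_iff₀ hd, Real.le_log_iff_exp_le (by positivity), le_div_iff₀ hh]
  have h1 := H.mass_mul_exp_le hD ht
  have h2 : Real.exp (n * ξ t) = Real.exp (ξ t * (n - 2 * k)) * Real.exp (2 * k * ξ t) := by
    rw [← Real.exp_add]; ring_nf
  rw [h2] at h1
  have h3 := Real.exp_pos (2 * k * ξ t)
  refine le_of_mul_le_mul_right ?_ h3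
  nlinarith

/-- If `ξ` is bounded above, the arclength `∫ e^{-ξ} dt` diverges at both ends. -/
theorem isCompleteMetric_of_upper_bound (H : Trajectory n k h ξ p univ) {X : ℝ}
    (hX : ∀ t ∈ univ, ξ t ≤ X) : IsCompleteMetric n (radialV ξ) (Ioi 0) := by
  obtain ⟨Ψ, hΨ⟩ := H.exists_arclength
  have hI : radii univ = Ioi 0 := radii_univ
  refine isCompletePart_of_isClosed_image isOpen_Ioi ordConnected_Ioi Subset.rfl
    (fun r hr => radialV_pos ξ hr) (hI ▸ H.continuousOn_radialV)
    (fun r hr => hasDerivAt_arclength_log hΨ (hI ▸ hr)) Subset.rfl ?_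
  have hmono : Monotone fun t => Ψ t - Real.exp (-X) * t :=
    monotone_of_hasDerivAt_nonneg (f' := fun t => Real.exp (-ξ t) - Real.exp (-X))
      (fun t => ((hΨ t (mem_univ t)).sub ((hasDerivAt_id t).const_mul _)).congr_deriv (by ring))
      fun t => sub_nonneg.2 (Real.exp_le_exp.2 (by linarith [hX t (mem_univ t)]))
  have hc : Continuous Ψ :=
    continuous_iff_continuousAt.2 fun t => (hΨ t (mem_univ t)).continuousAt
  have htop : Tendsto Ψ atTop atTop := by
    refine tendsto_atTop_mono' atTop ((eventually_ge_atTop 0).mono fun t ht => ?_)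
      (tendsto_atTop_add_const_left atTop (Ψ 0)
        (tendsto_id.const_mul_atTop (Real.exp_pos (-X))))
    have := hmono ht
    simp only [mul_zero, sub_zero] at this
    simp only [id]
    linarith
  have hbot : Tendsto Ψ atBot atBot := by
    refine tendsto_atBot_mono' atBot ((eventually_le_atBot 0).mono fun t ht => ?_)
      (tendsto_atBot_add_const_left atBot (Ψ 0)
        (tendsto_id.const_mul_atBot (Real.exp_pos (-X))))
    have := hmono ht
    simp only [mul_zero, sub_zero] at this
    simp only [id]
    linarith
  have hsurj : (fun r => Ψ (Real.log r)) '' Ioi 0 = univ := by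
    refine eq_univ_of_forall fun y => ?_
    obtain ⟨t, ht⟩ := hc.surjective htop hbot y
    exact ⟨Real.exp t, Real.exp_pos t, by simpa using ht⟩
  rw [hsurj]
  exact isClosed_univ

/-- If `ξ_t` has no zeros near `-∞`, then `ξ` converges to an equilibrium, and `h` is the mass of
the cylindrical metric. -/
theorem exists_vel_eq_zero (H : Trajectory n k h ξ p univ) (hk : 0 < k) (h2k : 2 * k < n)
    (hD : ∀ t ∈ univ, 0 < 1 - p t ^ 2) (hh : 0 < h)
    (hne : h ≠ 2 * k / (n - 2 * k) * (((n : ℝ) - 2 * k) / n) ^ ((n : ℝ) / (2 * k))) (T : ℝ) :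
    ∃ t < T, p t = 0 := by
  have hk0 : (0 : ℝ) < k := by positivity
  have h2k' : (2 : ℝ) * k < n := by exact_mod_cast h2k
  by_contra! hcon
  obtain ⟨X, hX⟩ := H.exists_upper_bound h2k hD hh
  have h0 : ∀ t, 0 ≤ ξ t := fun t => H.nonneg_of_pos hk hD hh (mem_univ t)
  have hpc : Continuous p := continuousOn_univ.1 H.continuousOn_vel
  obtain ⟨ε, hε, hsign⟩ : ∃ ε : ℝ, (ε = 1 ∨ ε = -1) ∧ ∀ t < T, 0 ≤ ε * p t := by
    obtain ⟨hoc⟩ := (isPreconnected_Iio (a := T)).image p hpc.continuousOn |>.ordConnected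
    by_cases hall : ∀ t < T, 0 ≤ p t
    · exact ⟨1, Or.inl rfl, fun t ht => by linarith [hall t ht]⟩
    · push Not at hall
      obtain ⟨u, hu, hpu⟩ := hall
      refine ⟨-1, Or.inr rfl, fun t ht => ?_⟩
      by_contra! hcon'
      obtain ⟨w, hw, hw0⟩ := hoc (mem_image_of_mem p hu) (mem_image_of_mem p ht)
        (show (0 : ℝ) ∈ Icc (p u) (p t) from ⟨hpu.le, by linarith⟩)
      exact hcon w hw hw0
  have hε2 : ε * ε = 1 := by rcases hε with rfl | rfl <;> norm_num
  have hεa : |ε| = 1 := by rcases hε with rfl | rfl <;> norm_num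
  -- `ε ξ` is monotone on `(-∞, T - 1]`, hence `ξ` converges
  obtain ⟨x, hx⟩ : ∃ x, Tendsto ξ atBot (𝓝 x) := by
    have hm : MonotoneOn (fun t => ε * ξ t) (Iic (T - 1)) := by
      have hd : ∀ t, HasDerivAt (fun t => ε * ξ t) (ε * p t) t := fun t =>
        (H.hasDerivAt t (mem_univ t)).const_mul ε
      refine monotoneOn_of_deriv_nonneg (convex_Iic _)
        (fun t _ => (hd t).continuousAt.continuousWithinAt)
        (fun t _ => (hd t).differentiableAt.differentiableWithinAt) fun t ht => ?_
      have ht := mem_Iic.1 (interior_subset ht)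
      rw [(hd t).deriv]
      exact hsign t (by linarith)
    have hm' : Monotone fun t => ε * ξ (min t (T - 1)) := fun a b hab =>
      hm (mem_Iic.2 (min_le_right _ _)) (mem_Iic.2 (min_le_right _ _)) (min_le_min_right _ hab)
    have hb : BddBelow (range fun t => ε * ξ (min t (T - 1))) := by
      refine ⟨-X, ?_⟩
      rintro _ ⟨t, rfl⟩
      have h1 := neg_abs_le (ε * ξ (min t (T - 1)))
      rw [abs_mul, hεa, one_mul, abs_of_nonneg (h0 _)] at h1
      have := hX (min t (T - 1)) (mem_univ _)
      simp only
      linarith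
    refine ⟨_, ((tendsto_atBot_ciInf hm' hb).const_mul ε).congr' ?_⟩
    filter_upwards [eventually_le_atBot (T - 1)] with t ht
    rw [min_eq_left ht, ← mul_assoc, hε2, one_mul]
  have hg : Tendsto (fun t => gap n k h (ξ t)) atBot (𝓝 (gap n k h x)) :=
    ((continuous_gap n k h).tendsto x).comp hx
  have hgap : ∀ t, 1 - p t ^ 2 = gap n k h (ξ t) := fun t => by
    rw [H.eq_gap_of_pos hk hD (mem_univ t), one_mul]
  have hpl : Tendsto p atBot (𝓝 (ε * √(1 - gap n k h x))) := by
    refine ((hg.const_sub 1).sqrt.const_mul ε).congr' ?_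
    filter_upwards [eventually_lt_atBot T] with t ht
    rw [← hgap, sub_sub_cancel, Real.sqrt_sq_eq_abs]
    have := abs_of_nonneg (hsign t ht)
    rw [abs_mul, hεa, one_mul] at this
    rw [this, ← mul_assoc, hε2, one_mul]
  have hp0 := eq_zero_of_tendsto_deriv_of_bounded (c := 0) (M := X)
    (fun t _ => H.hasDerivAt t (mem_univ t)) hpl
    (fun t _ => by rw [abs_of_nonneg (h0 t)]; exact hX t (mem_univ t))
  rw [hp0] at hpl
  have hg1 : gap n k h x = 1 := by
    have := tendsto_nhds_unique hg (((hpl.pow 2).const_sub 1).congr hgap)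
    simpa using this
  have hMc : ContinuousAt (massRatio n h) x := by
    unfold massRatio
    have : 1 + h * Real.exp (n * x) ≠ 0 := by positivity
    fun_prop (disch := assumption)
  have hacc : Tendsto (fun t => (1 - p t ^ 2) * (1 - n / (2 * k) * massRatio n h (ξ t))) atBot
      (𝓝 ((1 - 0 ^ 2) * (1 - n / (2 * k) * massRatio n h x))) :=
    ((hpl.pow 2).const_sub 1).mul (((hMc.tendsto.comp hx).const_mul _).const_sub 1)
  have hq := eq_zero_of_tendsto_deriv_of_bounded (c := 0) (M := 1)
    (fun t _ => H.hasDerivAt_vel t (mem_univ t)) hacc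
    (fun t _ => (abs_vel_lt_one hD (mem_univ t)).le)
  have hY : 0 < h * Real.exp (n * x) := by positivity
  have hd : (0 : ℝ) < n - 2 * k := by linarith
  have hYv : h * Real.exp (n * x) = 2 * k / (n - 2 * k) := by
    unfold massRatio at hq
    have h1 : 1 + h * Real.exp (n * x) ≠ 0 := by positivity
    rw [eq_div_iff hd.ne']
    field_simp at hq
    linarith
  have hu : Real.exp (2 * k * x) = n / (n - 2 * k) := by
    have e1 : (gap n k h x) ^ k = (1 + h * Real.exp (n * x)) * Real.exp (-(2 * k * x)) := by
      rw [gap, mul_pow, abs_of_pos (by positivity), one_div,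
        Real.rpow_inv_natCast_pow (by positivity) hk.ne', ← Real.exp_nat_mul]
      ring_nf
    rw [hg1, one_pow, Real.exp_neg, hYv] at e1
    have := (Real.exp_pos (2 * k * x)).ne'
    field_simp at e1 ⊢
    linarith
  refine hne ?_
  have hn0 : (0 : ℝ) < n := by linarith
  have e2 : Real.exp (n * x) = (n / (n - 2 * k)) ^ ((n : ℝ) / (2 * k)) := by
    rw [← hu, ← Real.exp_mul]; congr 1; field_simp
  rw [e2] at hYv
  rw [← hYv, mul_assoc, ← Real.mul_rpow (by positivity) (by positivity), div_mul_div_cancel₀ hd.ne',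
    div_self hn0.ne', Real.one_rpow, mul_one]

/-- A zero of the velocity is a centre of symmetry, by uniqueness for the autonomous equation. -/
theorem reflect_of_vel_eq_zero (H : Trajectory n k h ξ p univ) (hk : 0 < k) (h2k : 2 * k < n)
    (hD : ∀ t ∈ univ, 0 < 1 - p t ^ 2) (hh : 0 < h) {a : ℝ} (ha : p a = 0) (t : ℝ) :
    ξ (2 * a - t) = ξ t := by
  obtain ⟨X, hX⟩ := H.exists_upper_bound h2k hD hh
  let V : ℝ × ℝ → ℝ × ℝ := fun y => (y.2, (1 + h * Real.exp (n * y.1)) ^ (1 / (k : ℝ)) *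
    Real.exp (-2 * y.1) * (1 - n / (2 * k) *
      (h * Real.exp (n * y.1) / (1 + h * Real.exp (n * y.1)))))
  have hV : ContDiff ℝ 1 V := by
    have hne : ∀ y : ℝ × ℝ, 1 + h * Real.exp (n * y.1) ≠ 0 := fun y => by positivity
    have h1 : ContDiff ℝ 1 fun y : ℝ × ℝ => 1 + h * Real.exp (n * y.1) := by fun_prop
    have h2 : ContDiff ℝ 1 fun y : ℝ × ℝ => h * Real.exp (n * y.1) := by fun_prop
    have h3 : ContDiff ℝ 1 fun y : ℝ × ℝ => Real.exp (-2 * y.1) := by fun_prop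
    exact contDiff_snd.prodMk (((h1.rpow_const_of_ne hne).mul h3).mul
      (contDiff_const.sub (contDiff_const.mul (h2.div h1 hne))))
  have hS : IsCompact (Icc (0 : ℝ) X ×ˢ Icc (-1 : ℝ) 1) := isCompact_Icc.prod isCompact_Icc
  obtain ⟨K, hK⟩ := LocallyLipschitzOn.exists_lipschitzOnWith_of_compact hS
    (hV.locallyLipschitz.locallyLipschitzOn)
  have hmem : ∀ t, ξ t ∈ Icc 0 X ∧ |p t| ≤ 1 := fun t =>
    ⟨⟨H.nonneg_of_pos hk hD hh (mem_univ t), hX t (mem_univ t)⟩,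
      (abs_vel_lt_one hD (mem_univ t)).le⟩
  have hVξ : ∀ t w, V (ξ t, w) = (w, (1 - p t ^ 2) * (1 - n / (2 * k) * massRatio n h (ξ t))) :=
    fun t w => by
      have hY : 0 < 1 + h * Real.exp (n * ξ t) := by positivity
      simp only [V]
      rw [H.eq_gap_of_pos hk hD (mem_univ t), one_mul, gap, massRatio, abs_of_pos hY]
  have hf : ∀ t, HasDerivAt (fun t => (ξ t, p t)) (V (ξ t, p t)) t ∧
      (ξ t, p t) ∈ Icc (0 : ℝ) X ×ˢ Icc (-1 : ℝ) 1 := fun t => by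
    refine ⟨?_, (hmem t).1, abs_le.1 (hmem t).2⟩
    rw [hVξ]
    exact (H.hasDerivAt t (mem_univ t)).prodMk (H.hasDerivAt_vel t (mem_univ t))
  have hg : ∀ t, HasDerivAt (fun t => (ξ (2 * a - t), -p (2 * a - t)))
      (V (ξ (2 * a - t), -p (2 * a - t))) t ∧
      (ξ (2 * a - t), -p (2 * a - t)) ∈ Icc (0 : ℝ) X ×ˢ Icc (-1 : ℝ) 1 := fun t => by
    refine ⟨?_, (hmem _).1, abs_le.1 (by rw [abs_neg]; exact (hmem _).2)⟩
    rw [hVξ]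
    have hd : HasDerivAt (fun t => 2 * a - t) (-1) t := (hasDerivAt_id t).const_sub _
    have h1 := (H.hasDerivAt (2 * a - t) (mem_univ _)).comp t hd
    have h2 := ((H.hasDerivAt_vel (2 * a - t) (mem_univ _)).comp t hd).fun_neg
    exact (h1.congr_deriv (by ring)).prodMk (h2.congr_deriv (by ring))
  have heq := ODE_solution_unique_univ (v := fun _ => V) (t₀ := a)
    (s := fun _ => Icc (0 : ℝ) X ×ˢ Icc (-1 : ℝ) 1) (fun _ => hK) hf hg (by
      have : 2 * a - a = a := by ring
      rw [this, ha, neg_zero])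
  exact (congrArg Prod.fst (congrFun heq t)).symm

theorem catalog_of_pos_of_lt (H : Trajectory n k h ξ p univ) (hk : 0 < k) (h2k : 2 * k < n)
    (hD : ∀ t ∈ univ, 0 < 1 - p t ^ 2) (hh : 0 < h) :
    let hstar : ℝ := 2 * k / (n - 2 * k) * (((n : ℝ) - 2 * k) / n) ^ ((n : ℝ) / (2 * k))
    h ≤ hstar ∧ (∃ T : ℝ, 0 < T ∧ Function.Periodic ξ T) ∧
      IsCompleteMetric n (radialV ξ) (Ioi 0) ∧
      (h = hstar → ∀ r ∈ Ioi (0 : ℝ), radialV ξ r ^ (-2 : ℤ) =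
        (((n : ℝ) - 2 * k) / n) ^ (1 / (k : ℝ)) * r ^ (-2 : ℤ)) := by
  intro hstar
  have hk0 : (0 : ℝ) < k := by positivity
  have h2k' : (2 : ℝ) * k < n := by exact_mod_cast h2k
  have hd : (0 : ℝ) < n - 2 * k := by linarith
  have hn0 : (0 : ℝ) < n := by linarith
  have hle : ∀ t, h * Real.exp (n * ξ t) ≤ hstar * Real.exp (n * ξ t) := fun t =>
    (H.mass_mul_exp_le hD (mem_univ t)).trans (exp_sub_one_le_mass hk h2k (ξ t)).1
  have hcyl : h = hstar → ∀ t, Real.exp (2 * k * ξ t) = n / (n - 2 * k) := fun he t => by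
    refine (exp_sub_one_le_mass hk h2k (ξ t)).2
      (le_antisymm (exp_sub_one_le_mass hk h2k (ξ t)).1 ?_)
    have := H.mass_mul_exp_le hD (mem_univ t)
    rwa [he] at this
  obtain ⟨X, hX⟩ := H.exists_upper_bound h2k hD hh
  refine ⟨le_of_mul_le_mul_right (hle 0) (Real.exp_pos _), ?_,
    H.isCompleteMetric_of_upper_bound hX, fun he r hr => ?_⟩
  · by_cases he : h = hstar
    · refine ⟨1, one_pos, fun t => ?_⟩
      have h1 := Real.exp_injective ((hcyl he (t + 1)).trans (hcyl he t).symm)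
      exact mul_left_cancel₀ (by positivity) h1
    · obtain ⟨b, -, hb⟩ := H.exists_vel_eq_zero hk h2k hD hh he 0
      obtain ⟨a, hab, ha⟩ := H.exists_vel_eq_zero hk h2k hD hh he b
      refine ⟨2 * (b - a), by linarith, fun t => ?_⟩
      rw [← H.reflect_of_vel_eq_zero hk h2k hD hh ha t,
        ← H.reflect_of_vel_eq_zero hk h2k hD hh hb (2 * a - t)]
      congr 1; ring
  · have hr0 : 0 < r := hr
    have h1 := hcyl he (Real.log r)
    have h2 : ((n : ℝ) - 2 * k) / n = Real.exp (-(2 * k * ξ (Real.log r))) := by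
      rw [Real.exp_neg, h1, inv_div]
    have h3 : r ^ (-2 : ℤ) = Real.exp (-2 * Real.log r) := by
      rw [← exp_zpow_neg_two, Real.exp_log hr0]
    rw [h2, ← Real.exp_mul, radialV_zpow hr0, h3, ← Real.exp_add]
    congr 1
    field_simp
    ring

theorem catalogI (H : Trajectory n k h ξ p s) (hk : 1 < k) (hkn : k ≤ n)
    (hD : ∀ t ∈ s, 0 < 1 - p t ^ 2) : CatalogI n k ξ s h := by
  have hk0 : 0 < k := by omega
  have hn : 0 < n := by omega
  refine ⟨H.inGammaPlus hk0 hkn hD, ?_, H.catalog_of_mass_neg hn hk hD, ?_⟩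
  · rintro rfl
    obtain ⟨ρ, hρ, hv⟩ := H.round_of_mass_zero hk0 hD
    refine ⟨?_, ρ, hρ, hv, isRoundMetric_of_pos hρ⟩
    rw [H.eq_univ_of_nonneg hk0 hD le_rfl, radii_univ]
  · intro hh
    obtain rfl := H.eq_univ_of_nonneg hk0 hD hh.le
    rw [radii_univ]
    refine ⟨rfl, fun h2k => H.catalog_of_pos_of_lt hk0 h2k hD hh,
      fun h2k => H.catalog_of_pos_of_eq hk0 h2k hD hh, fun h2k => ?_⟩
    rw [ExtendsHolderSphere, invV_radialV]
    exact ⟨H.rootExpansion_of_pos hk0 hkn h2k hD hh,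
      H.neg_univ.rootExpansion_of_pos hk0 hkn h2k (pos_neg_univ hD) hh,
      H.extendsHolder hk0 hkn h2k hD hh,
      H.neg_univ.extendsHolder hk0 hkn h2k (pos_neg_univ hD) hh⟩

end Trajectory

/-! ### Solutions with `ξ_t < -1`: the left end -/

theorem le_of_deriv_le_neg_right {f f' : ℝ → ℝ} {c m : ℝ}
    (hf : ∀ t, c ≤ t → HasDerivAt f (f' t) t) (hm : ∀ t, c ≤ t → f' t ≤ -m) {t : ℝ} (ht : c ≤ t) :
    f t ≤ f c - m * (t - c) := by
  have := le_of_deriv_le_neg (f := fun u => -f (-u)) (f' := fun u => f' (-u)) (c := -c) (m := m)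
    (t := -t) (fun u hu => by
      exact (((hf (-u) (by linarith)).scomp u (hasDerivAt_neg u)).fun_neg).congr_deriv (by simp))
    (fun u hu => hm (-u) (by linarith)) (by linarith)
  simp only [neg_neg] at this
  linarith

/-- For `2k ≥ n` the gap is bounded on half-lines, since it is `|e^{-nx} + h|^{1/k} e^{-(2 - n/k) x}`. -/
theorem gap_le_of_le {n k : ℕ} (hk : 0 < k) (h2k : n ≤ 2 * k) (h : ℝ) {x₁ x : ℝ} (hx : x₁ ≤ x) :
    gap n k h x ≤ (Real.exp (-n * x₁) + |h|) ^ (1 / (k : ℝ)) *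
      Real.exp (-(2 - (n : ℝ) / k) * x₁) := by
  have hk0 : (0 : ℝ) < k := by positivity
  have hα : 0 ≤ 2 - (n : ℝ) / k := by
    rw [sub_nonneg, div_le_iff₀ hk0]; exact_mod_cast h2k
  have e : gap n k h x = |Real.exp (-n * x) + h| ^ (1 / (k : ℝ)) *
      Real.exp (-(2 - (n : ℝ) / k) * x) := by
    rw [← gap_mul_exp hk, mul_assoc, ← Real.exp_add, neg_mul, add_neg_cancel, Real.exp_zero,
      mul_one]
  rw [e]
  have h1 : |Real.exp (-n * x) + h| ≤ Real.exp (-n * x₁) + |h| := by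
    refine (abs_add_le _ _).trans ?_
    rw [abs_of_pos (Real.exp_pos _)]
    have : -(n : ℝ) * x ≤ -n * x₁ :=
      mul_le_mul_of_nonpos_left hx (neg_nonpos.2 (Nat.cast_nonneg n))
    gcongr
  refine mul_le_mul (Real.rpow_le_rpow (abs_nonneg _) h1 (by positivity))
    (Real.exp_le_exp.2 ?_) (Real.exp_pos _).le (by positivity)
  exact mul_le_mul_of_nonpos_left hx (neg_nonpos.2 hα)

namespace Trajectory

variable {n k : ℕ} {h : ℝ} {ξ p : ℝ → ℝ} {s : Set ℝ}

theorem vel_lt_or_gt (H : Trajectory n k h ξ p s) (hD : ∀ t ∈ s, 1 - p t ^ 2 < 0) :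
    (∀ t ∈ s, p t < -1) ∨ ∀ t ∈ s, 1 < p t := by
  have hlt : ∀ t ∈ s, p t < 0 → p t < -1 := fun t ht h0 => by nlinarith [hD t ht]
  have hgt : ∀ t ∈ s, 0 ≤ p t → 1 < p t := fun t ht h0 => by nlinarith [hD t ht]
  by_contra! hcon
  obtain ⟨⟨u, hu, hpu⟩, w, hw, hpw⟩ := hcon
  have hu0 : 0 ≤ p u := by
    by_contra! h0; linarith [hlt u hu h0]
  have hw0 : p w ≤ 0 := by
    by_contra! h0; linarith [hgt w hw h0.le]
  obtain ⟨t, ht, ht0⟩ := (H.ordConnected.isPreconnected.image p H.continuousOn_vel).ordConnected.out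
    (mem_image_of_mem p hw) (mem_image_of_mem p hu) (show (0 : ℝ) ∈ Icc (p w) (p u) from ⟨hw0, hu0⟩)
  linarith [hgt t ht ht0.ge]

theorem one_sub_sq_neg (hp : ∀ t ∈ s, p t < -1) : ∀ t ∈ s, 1 - p t ^ 2 < 0 := fun t ht => by
  nlinarith [hp t ht]

theorem antitoneOn (H : Trajectory n k h ξ p s) (hp : ∀ t ∈ s, p t < -1) : AntitoneOn ξ s := by
  refine antitoneOn_of_deriv_nonpos H.ordConnected.convex H.continuousOn
    (fun t ht => (H.hasDerivAt t (interior_subset ht)).differentiableAt.differentiableWithinAt)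
    fun t ht => ?_
  rw [(H.hasDerivAt t (interior_subset ht)).deriv]
  linarith [hp t (interior_subset ht)]

theorem abs_vel_le_of_gap_le (H : Trajectory n k h ξ p s) (hk : 0 < k) {M t : ℝ} (ht : t ∈ s)
    (hM : gap n k h (ξ t) ≤ M) : |p t| ≤ 1 + M := by
  rw [← H.abs_one_sub_sq hk ht] at hM
  have h1 := neg_abs_le (1 - p t ^ 2)
  have h2 := sq_abs (p t)
  by_contra! hcon
  have h3 := abs_nonneg (1 - p t ^ 2)
  nlinarith

theorem exists_abs_vel_le (H : Trajectory n k h ξ p s) (hk : 0 < k) (x₁ x₂ : ℝ) :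
    ∃ C, ∀ t ∈ s, ξ t ∈ Icc x₁ x₂ → |p t| ≤ C := by
  obtain ⟨M, hM⟩ := isCompact_Icc.bddAbove_image (K := Icc x₁ x₂)
    (continuous_gap n k h).continuousOn
  exact ⟨1 + M, fun t ht hx => H.abs_vel_le_of_gap_le hk ht (hM (mem_image_of_mem _ hx))⟩

theorem le_of_tendsto_left (H : Trajectory n k h ξ p s) (hp : ∀ t ∈ s, p t < -1) {a c x₀ : ℝ}
    (ha : IsGLB s a) (hc : c ∈ s) (hx₀ : Tendsto ξ (𝓝[>] a) (𝓝 x₀)) : ξ c ≤ x₀ := by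
  refine ge_of_tendsto hx₀ ?_
  filter_upwards [Ioo_mem_nhdsGT (H.isOpen.lt_of_isGLB ha hc)] with t ht
  exact H.antitoneOn hp (H.ordConnected.Ioc_subset_of_isGLB ha hc ⟨ht.1, ht.2.le⟩) hc ht.2.le

/-- If the velocity stays bounded to the left and the equation does not degenerate there, then the
solution exists for all negative times. -/
theorem Iic_subset_of_gap_le (H : Trajectory n k h ξ p s) (hk : 0 < k) (hp : ∀ t ∈ s, p t < -1)
    (hE : ∀ t ∈ s, ∀ x ≥ ξ t, 1 + h * Real.exp (n * x) ≠ 0) {c M : ℝ} (hc : c ∈ s)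
    (hM : ∀ x ≥ ξ c, gap n k h x ≤ M) : ∀ t ∈ s, Iic t ⊆ s := by
  refine (H.ordConnected.Iic_subset_or_isGLB H.nonempty).resolve_right ?_
  rintro ⟨a, ha⟩
  obtain ⟨x₀, hx₀, h0⟩ := H.exists_tendsto_left hk
    (fun t ht => H.eq_gap_of_neg hk (one_sub_sq_neg hp) ht) ha hc (C := 1 + M) fun t ht => by
      have hts := H.ordConnected.Ioc_subset_of_isGLB ha hc ⟨ht.1, ht.2.le⟩
      exact H.abs_vel_le_of_gap_le hk hts (hM _ (H.antitoneOn hp hts hc ht.2.le))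
  exact hE c hc x₀ (H.le_of_tendsto_left hp ha hc hx₀) h0

theorem tendsto_atBot_of_Iic_subset (H : Trajectory n k h ξ p s) (hp : ∀ t ∈ s, p t < -1)
    (hs : ∀ t ∈ s, Iic t ⊆ s) : Tendsto ξ atBot atTop := by
  obtain ⟨c, hc⟩ := H.nonempty
  refine tendsto_atTop_mono' atBot ((eventually_le_atBot c).mono fun t ht =>
    le_of_deriv_le_neg (m := 1) (fun u hu => H.hasDerivAt u (hs c hc hu))
      (fun u hu => (hp u (hs c hc hu)).le) ht) ?_
  have : Tendsto (fun t : ℝ => 1 * (c - t)) atBot atTop := by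
    simpa [sub_eq_add_neg] using tendsto_atTop_add_const_left atBot c tendsto_neg_atBot_atTop
  exact tendsto_atTop_add_const_left atBot (ξ c) this

theorem tendsto_nhdsGT_atTop (H : Trajectory n k h ξ p s) (hk : 0 < k) (hp : ∀ t ∈ s, p t < -1)
    (hE : ∀ t ∈ s, ∀ x ≥ ξ t, 1 + h * Real.exp (n * x) ≠ 0) {a : ℝ} (ha : IsGLB s a) :
    Tendsto ξ (𝓝[>] a) atTop := by
  obtain ⟨c, hc⟩ := H.nonempty
  have hsub : Ioc a c ⊆ s := H.ordConnected.Ioc_subset_of_isGLB ha hc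
  have hanti := H.antitoneOn hp
  rw [tendsto_atTop]
  by_contra hcon
  push Not at hcon
  obtain ⟨X, hX⟩ := hcon
  have hbdd : ∀ t ∈ Ioo a c, ξ t ≤ X := fun t ht => by
    obtain ⟨u, hu1, hu2⟩ := (hX.and_eventually (Ioo_mem_nhdsGT ht.1)).exists
    have hus : u ∈ s := hsub ⟨hu2.1, (hu2.2.trans ht.2).le⟩
    exact (hanti hus (hsub ⟨ht.1, ht.2.le⟩) hu2.2.le).trans hu1.le
  obtain ⟨C, hC⟩ := H.exists_abs_vel_le hk (ξ c) X
  obtain ⟨x₀, hx₀, h0⟩ := H.exists_tendsto_left hk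
    (fun t ht => H.eq_gap_of_neg hk (one_sub_sq_neg hp) ht) ha hc (C := C) fun t ht => by
      have hts := hsub ⟨ht.1, ht.2.le⟩
      exact hC t hts ⟨hanti hts hc ht.2.le, hbdd t ht⟩
  exact hE c hc x₀ (H.le_of_tendsto_left hp ha hc hx₀) h0

/-- If `2k < n`, the function `e^{-mξ}`, `m = (n - 2k) / (2k)`, has a derivative bounded from below
by a positive constant for large `ξ`, so that `ξ` becomes infinite in finite time. -/
theorem exists_isGLB_of_lt (H : Trajectory n k h ξ p s) (hk : 0 < k) (h2k : 2 * k < n)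
    (hp : ∀ t ∈ s, p t < -1) (hh : h ≠ 0) : ∃ a, IsGLB s a := by
  refine (H.ordConnected.Iic_subset_or_isGLB H.nonempty).resolve_left fun hs => ?_
  have hn : 0 < n := by omega
  have hk0 : (0 : ℝ) < k := by positivity
  have h2k' : (2 : ℝ) * k < n := by exact_mod_cast h2k
  have hξ := H.tendsto_atBot_of_Iic_subset hp hs
  set m := (n : ℝ) / (2 * k) - 1 with hm
  have hm0 : 0 < m := by rw [hm, sub_pos, one_lt_div (by positivity)]; exact h2k'
  have hA : 0 < |h| ^ (1 / (k : ℝ)) := Real.rpow_pos_of_pos (abs_pos.2 hh) _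
  obtain ⟨c, hc⟩ := H.nonempty
  obtain ⟨d, hd⟩ := eventually_atBot.1 ((eventually_le_atBot c).and
    (((tendsto_gap_mul_exp hn hk h).comp hξ).eventually_const_le
      (show |h| ^ (1 / (k : ℝ)) / 2 < |h| ^ (1 / (k : ℝ)) by linarith)))
  have hds : ∀ t ≤ d, t ∈ s := fun t ht => hs c hc (hd t ht).1
  set A := √(|h| ^ (1 / (k : ℝ)) / 2) with hAdef
  have hA0 : 0 < A := Real.sqrt_pos.2 (by linarith)
  have hvel : ∀ t ≤ d, A ≤ -(p t) * Real.exp (-m * ξ t) := fun t ht => by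
    have h1 := (hd t ht).2
    have hts := hds t ht
    have h2 := H.eq_gap_of_neg hk (one_sub_sq_neg hp) hts
    have h3 := hp t hts
    refine Real.sqrt_le_iff.2 ⟨mul_nonneg (by linarith) (Real.exp_pos _).le, h1.trans ?_⟩
    have e : Real.exp ((2 - (n : ℝ) / k) * ξ t) = Real.exp (-m * ξ t) ^ 2 := by
      rw [← Real.exp_nat_mul]; congr 1; rw [hm]; push_cast; field_simp; ring
    simp only [Function.comp_apply]
    rw [e, mul_pow]
    refine mul_le_mul_of_nonneg_right ?_ (by positivity)
    nlinarith
  have hder : ∀ t ≤ d, HasDerivAt (fun t => -Real.exp (-m * ξ t))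
      (-(Real.exp (-m * ξ t) * (-m * p t))) t := fun t ht =>
    (((H.hasDerivAt t (hds t ht)).const_mul (-m)).exp).fun_neg
  have hlow := fun t ht => le_of_deriv_le_neg (m := m * A) (t := t) hder
    (fun t ht => by nlinarith [hvel t ht]) ht
  have ht : d - Real.exp (-m * ξ d) / (m * A) ≤ d := by
    have := Real.exp_pos (-m * ξ d)
    have : 0 ≤ Real.exp (-m * ξ d) / (m * A) := by positivity
    linarith
  have h1 := hlow _ ht
  have h2 := Real.exp_pos (-m * ξ (d - Real.exp (-m * ξ d) / (m * A)))
  rw [sub_sub_cancel, mul_div_cancel₀ _ (mul_pos hm0 hA0).ne'] at h1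
  linarith

theorem left_end_catalog (H : Trajectory n k h ξ p s) (hk : 0 < k) (hkn : k ≤ n)
    (hp : ∀ t ∈ s, p t < -1) (hh : h ≠ 0)
    (hE : ∀ t ∈ s, ∀ x ≥ ξ t, 1 + h * Real.exp (n * x) ≠ 0) {b : ℝ} (hb : IsLUB s b) :
    (2 * k < n → ∃ r₁ : ℝ, 0 < r₁ ∧ r₁ < Real.exp b ∧ radii s = Ioo r₁ (Real.exp b) ∧
      SimConst (𝓝[>] r₁) (fun r => radialV ξ r ^ (-2 : ℤ))
        (fun r => (r - r₁) ^ (4 * (k : ℝ) / (n - 2 * k)))) ∧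
    (2 * k = n → radii s = Ioo 0 (Real.exp b) ∧
      SimConst (𝓝[>] 0) (fun r => radialV ξ r ^ (-2 : ℤ))
        (fun r => r ^ (2 * (√(1 + |h| ^ (1 / (k : ℝ))) - 1)))) ∧
    (n < 2 * k → radii s = Ioo 0 (Real.exp b) ∧
      RootExpansion n k (|h| ^ (1 / (k : ℝ))) (radialV ξ)) := by
  obtain ⟨c, hc⟩ := H.nonempty
  have hσ : ∀ t ∈ s, 1 - p t ^ 2 = (-1) * gap n k h (ξ t) :=
    fun t ht => H.eq_gap_of_neg hk (one_sub_sq_neg hp) ht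
  have hroot : 0 ≤ |h| ^ (1 / (k : ℝ)) := by positivity
  have hcomplete : n ≤ 2 * k → (∀ t ∈ s, Iic t ⊆ s) ∧ radii s = Ioo 0 (Real.exp b) := fun h2k => by
    have hs := H.Iic_subset_of_gap_le hk hp hE hc fun x hx => gap_le_of_le hk h2k h hx
    refine ⟨hs, ?_⟩
    rw [eq_Iio_of_isLUB H.isOpen H.ordConnected H.nonempty hs hb, radii_Iio]
  refine ⟨fun h2k => ?_, fun h2k => ?_, fun h2k => ?_⟩
  · obtain ⟨a, ha⟩ := H.exists_isGLB_of_lt hk h2k hp hh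
    refine ⟨Real.exp a, Real.exp_pos _, Real.exp_lt_exp.2
      ((H.isOpen.lt_of_isGLB ha hc).trans (H.isOpen.lt_of_isLUB hb hc)), ?_, ?_⟩
    · rw [eq_Ioo_of_isGLB_isLUB H.isOpen H.ordConnected H.nonempty ha hb, radii_Ioo]
    · exact H.simConst_of_lt hk h2k hσ hh ha (H.tendsto_nhdsGT_atTop hk hp hE ha)
        fun t ht => by linarith [hp t ht]
  · obtain ⟨hs, hI⟩ := hcomplete h2k.ge
    refine ⟨hI, H.simConst_of_eq hk h2k (c := c) hσ hh (Real.sqrt_pos.2 (by linarith)) ?_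
      (hs c hc) (H.tendsto_atBot_of_Iic_subset hp hs) ?_⟩
    · rw [Real.sq_sqrt (by linarith)]; ring
    · filter_upwards [eventually_le_atBot c] with t ht
      linarith [hp t (hs c hc ht)]
  · obtain ⟨hs, hI⟩ := hcomplete h2k.le
    refine ⟨hI, ?_⟩
    have := H.rootExpansion hk hkn h2k (c := c) (σ := -1) (by norm_num) hσ hh (hs c hc)
      (H.tendsto_atBot_of_Iic_subset hp hs) ((eventually_le_atBot c).mono fun t ht => by
        linarith [hp t (hs c hc ht)])
    rwa [neg_neg, one_mul] at this

/-- At an end where the equation degenerates, `ξ_t → -1`. -/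
theorem tendsto_vel_neg_one (H : Trajectory n k h ξ p s) (hk : 0 < k) (hp : ∀ t ∈ s, p t < -1)
    {l : Filter ℝ} {x₀ : ℝ} (hs : ∀ᶠ t in l, t ∈ s) (hξ : Tendsto ξ l (𝓝 x₀))
    (h0 : 1 + h * Real.exp (n * x₀) = 0) : Tendsto p l (𝓝 (-1)) := by
  have hg : Tendsto (fun t => gap n k h (ξ t)) l (𝓝 0) := by
    have := ((continuous_gap n k h).tendsto x₀).comp hξ
    rwa [(gap_eq_zero_iff hk).2 h0] at this
  have := tendsto_vel_of_neg hs (fun t ht => H.eq_gap_of_neg hk (one_sub_sq_neg hp) ht) hg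
    (hs.mono fun t ht => by linarith [hp t ht])
  simpa using this

theorem tendsto_radialV {l l' : Filter ℝ} {r₀ x₀ : ℝ} (hl : Tendsto id l (𝓝 r₀))
    (hlog : Tendsto Real.log l l') (hξ : Tendsto ξ l' (𝓝 x₀)) :
    Tendsto (radialV ξ) l (𝓝 (r₀ * Real.exp x₀)) :=
  hl.mul ((Real.continuous_exp.tendsto _).comp (hξ.comp hlog))

theorem tendsto_deriv_radialV_zero (H : Trajectory n k h ξ p s) {l l' : Filter ℝ} {x₀ : ℝ}
    (hlog : Tendsto Real.log l l') (hrad : ∀ᶠ r in l, r ∈ radii s) (hξ : Tendsto ξ l' (𝓝 x₀))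
    (hp : Tendsto p l' (𝓝 (-1))) : Tendsto (deriv (radialV ξ)) l (𝓝 0) := by
  have h1 : Tendsto (fun t => Real.exp (ξ t) * (1 + p t)) l' (𝓝 (Real.exp x₀ * (1 + -1))) :=
    ((Real.continuous_exp.tendsto _).comp hξ).mul (hp.const_add 1)
  rw [add_neg_cancel, mul_zero] at h1
  refine (h1.comp hlog).congr' ?_
  filter_upwards [hrad] with r hr
  exact (H.deriv_radialV hr).symm

end Trajectory

/-! ### Solutions with `ξ_t < -1`, `k` odd -/

namespace Trajectory

variable {n k : ℕ} {h : ℝ} {ξ p : ℝ → ℝ} {s : Set ℝ}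

theorem one_add_neg_of_odd (H : Trajectory n k h ξ p s) (hp : ∀ t ∈ s, p t < -1) (hk : Odd k) {t : ℝ}
    (ht : t ∈ s) : 1 + h * Real.exp (n * ξ t) < 0 := by
  rw [← H.energy t ht]
  exact mul_neg_of_neg_of_pos (hk.pow_neg (one_sub_sq_neg hp t ht)) (Real.exp_pos _)

theorem mass_neg_of_odd (H : Trajectory n k h ξ p s) (hp : ∀ t ∈ s, p t < -1) (hk : Odd k) :
    h < 0 := by
  obtain ⟨t, ht⟩ := H.nonempty
  by_contra! hh
  have := H.one_add_neg_of_odd hp hk ht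
  have : 0 ≤ h * Real.exp (n * ξ t) := by positivity
  linarith

theorem right_end_of_odd (H : Trajectory n k h ξ p s) (hn : 0 < n) (hk : 0 < k)
    (hp : ∀ t ∈ s, p t < -1) (hko : Odd k) :
    ∃ b x₀, IsLUB s b ∧ Tendsto ξ (𝓝[<] b) (𝓝 x₀) ∧ 1 + h * Real.exp (n * x₀) = 0 := by
  have hn0 : (0 : ℝ) < n := by positivity
  have hh := H.mass_neg_of_odd hp hko
  obtain ⟨c, hc⟩ := H.nonempty
  have hlow : ∀ t ∈ s, Real.log (1 / -h) / n ≤ ξ t := fun t ht => by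
    have h1 := H.one_add_neg_of_odd hp hko ht
    rw [div_le_iff₀ hn0, Real.log_le_iff_le_exp (one_div_pos.2 (neg_pos.2 hh)),
      div_le_iff₀ (neg_pos.2 hh), mul_comm (ξ t)]
    linarith
  obtain ⟨b, hb⟩ := (H.ordConnected.Ici_subset_or_isLUB H.nonempty).resolve_left fun hs => by
    have hle : c ≤ c + (|ξ c| + |Real.log (1 / -h) / n| + 1) := le_add_of_nonneg_right (by positivity)
    have h1 := le_of_deriv_le_neg_right (m := 1) (fun u hu => H.hasDerivAt u (hs c hc hu))
      (fun u hu => (hp u (hs c hc hu)).le) hle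
    have h2 := hlow _ (hs c hc hle)
    have h3 := neg_abs_le (Real.log (1 / -h) / n)
    have h4 := le_abs_self (ξ c)
    linarith
  have hsub := H.ordConnected.Ico_subset_of_isLUB hb hc
  obtain ⟨C, hC⟩ := H.exists_abs_vel_le hk (Real.log (1 / -h) / n) (ξ c)
  obtain ⟨x₀, hx₀, h0⟩ := H.exists_tendsto_right hk
    (fun t ht => H.eq_gap_of_neg hk (one_sub_sq_neg hp) ht) hb hc (C := C) fun t ht => by
      have hts := hsub ⟨ht.1.le, ht.2⟩
      exact hC t hts ⟨hlow t hts, H.antitoneOn hp hc hts ht.1.le⟩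
  exact ⟨b, x₀, hb, hx₀, h0⟩

theorem catalog_of_odd (H : Trajectory n k h ξ p s) (hk : 1 < k) (hkn : k ≤ n)
    (hp : ∀ t ∈ s, p t < -1) (hko : Odd k) : ∃ R : ℝ, 0 < R ∧
    (∃ C : ℝ, ∀ᶠ r in 𝓝[<] R, |radialV ξ r| ≤ C ∧ |deriv (radialV ξ) r| ≤ C) ∧
    BlowsUp2 (𝓝[<] R) (radialV ξ) ∧
    (2 * k < n → ∃ r₁ : ℝ, 0 < r₁ ∧ r₁ < R ∧ radii s = Ioo r₁ R ∧
      SimConst (𝓝[>] r₁) (fun r => radialV ξ r ^ (-2 : ℤ))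
        (fun r => (r - r₁) ^ (4 * (k : ℝ) / (n - 2 * k)))) ∧
    (2 * k = n → radii s = Ioo 0 R ∧
      SimConst (𝓝[>] 0) (fun r => radialV ξ r ^ (-2 : ℤ))
        (fun r => r ^ (2 * (√(1 + |h| ^ (1 / (k : ℝ))) - 1)))) ∧
    (n < 2 * k → radii s = Ioo 0 R ∧ RootExpansion n k (|h| ^ (1 / (k : ℝ))) (radialV ξ)) := by
  have hk0 : 0 < k := by omega
  have hn : 0 < n := by omega
  have hh := H.mass_neg_of_odd hp hko
  obtain ⟨b, x₀, hb, hx₀, h0⟩ := H.right_end_of_odd hn hk0 hp hko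
  obtain ⟨c, hc⟩ := H.nonempty
  have hcb := H.isOpen.lt_of_isLUB hb hc
  have hs : ∀ᶠ t in 𝓝[<] b, t ∈ s := by
    filter_upwards [Ioo_mem_nhdsLT hcb] with t ht
    exact H.ordConnected.Ico_subset_of_isLUB hb hc ⟨ht.1.le, ht.2⟩
  have hlog := tendsto_log_nhdsLT_exp b
  have hrad : ∀ᶠ r in 𝓝[<] (Real.exp b), r ∈ radii s := by
    filter_upwards [hlog.eventually hs, Ioo_mem_nhdsLT (Real.exp_pos b)] with r h1 h2
    exact ⟨h2.1, h1⟩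
  have hid : Tendsto id (𝓝[<] (Real.exp b)) (𝓝 (Real.exp b)) :=
    tendsto_id.mono_left nhdsWithin_le_nhds
  have hp1 := H.tendsto_vel_neg_one hk0 hp hs hx₀ h0
  refine ⟨Real.exp b, Real.exp_pos b, ?_, ?_, ?_⟩
  · obtain ⟨C, hC⟩ := (tendsto_radialV hid hlog hx₀).abs.isBoundedUnder_le
    obtain ⟨C', hC'⟩ := (H.tendsto_deriv_radialV_zero hlog hrad hx₀ hp1).abs.isBoundedUnder_le
    refine ⟨max C C', ?_⟩
    filter_upwards [eventually_map.1 hC, eventually_map.1 hC'] with r h1 h2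
    exact ⟨h1.trans (le_max_left _ _), h2.trans (le_max_right _ _)⟩
  · exact H.blowsUp2_of_tendsto hn hk (Real.exp_pos b) hid hlog hrad hx₀ h0 hp1 (by norm_num)
  · refine H.left_end_catalog hk0 hkn hp hh.ne (fun t ht x hx => ?_) hb
    have h1 := H.one_add_neg_of_odd hp hko ht
    have h2 : Real.exp (n * ξ t) ≤ Real.exp (n * x) := by gcongr
    nlinarith

theorem catalogIII (H : Trajectory n k h ξ p s) (hk : 1 < k) (hkn : k ≤ n)
    (hD : ∀ t ∈ s, 1 - p t ^ 2 < 0) (hko : Odd k) : CatalogIII n k ξ s h := by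
  rcases H.vel_lt_or_gt hD with hp | hp
  · exact ⟨H.mass_neg_of_odd hp hko, radialV ξ, radii s, Or.inl ⟨rfl, rfl⟩,
      H.catalog_of_odd hk hkn hp hko⟩
  · have hp' : ∀ t ∈ Neg.neg ⁻¹' s, -p (-t) < -1 := fun t ht => neg_lt_neg (hp (-t) ht)
    exact ⟨H.neg.mass_neg_of_odd hp' hko, _, _,
      Or.inr ⟨(invV_radialV ξ).symm, (invRadii_radii s).symm⟩,
      H.neg.catalog_of_odd hk hkn hp' hko⟩

end Trajectory

/-! ### Solutions with `ξ_t < -1`, `k` even -/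

namespace Trajectory

variable {n k : ℕ} {h : ℝ} {ξ p : ℝ → ℝ} {s : Set ℝ}

theorem one_add_pos_of_even (H : Trajectory n k h ξ p s) (hk : Even k) {t : ℝ} (ht : t ∈ s) :
    0 < 1 + h * Real.exp (n * ξ t) := by
  rw [← H.energy t ht]
  exact mul_pos (hk.pow_pos (H.ne_zero t ht)) (Real.exp_pos _)

theorem exp_mul_vel_sq (H : Trajectory n k h ξ p s) (hk : 0 < k) (hp : ∀ t ∈ s, p t < -1) {t : ℝ}
    (ht : t ∈ s) : (Real.exp (ξ t) * p t) ^ 2 =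
      Real.exp (ξ t) ^ 2 + |1 + h * Real.exp (n * ξ t)| ^ (1 / (k : ℝ)) := by
  have h1 := H.eq_gap_of_neg hk (one_sub_sq_neg hp) ht
  have h2 : Real.exp (ξ t) ^ 2 * gap n k h (ξ t) =
      |1 + h * Real.exp (n * ξ t)| ^ (1 / (k : ℝ)) := by
    rw [gap, mul_left_comm, ← Real.exp_nat_mul, ← Real.exp_add]
    push_cast
    simp
  rw [← h2]
  linear_combination -(Real.exp (ξ t) ^ 2) * h1

/-- For even `k`, `e^ξ` reaches `0` in finite time, with derivative `-1`. -/
theorem right_end_of_even (H : Trajectory n k h ξ p s) (hn : 0 < n) (hk : 0 < k)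
    (hp : ∀ t ∈ s, p t < -1) (hke : Even k) :
    ∃ b, IsLUB s b ∧ Tendsto ξ (𝓝[<] b) atBot ∧
      Tendsto (fun t => Real.exp (ξ t) * p t) (𝓝[<] b) (𝓝 (-1)) := by
  have hn0 : (0 : ℝ) < n := by positivity
  have hanti := H.antitoneOn hp
  obtain ⟨c, hc⟩ := H.nonempty
  -- `1 + h e^{nξ}` stays away from `0` to the right of `c`
  set m := min 1 (1 + h * Real.exp (n * ξ c)) with hm
  have hm0 : 0 < m := lt_min one_pos (H.one_add_pos_of_even hke hc)
  have hmle : ∀ x ≤ ξ c, m ≤ 1 + h * Real.exp (n * x) := fun x hx => by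
    rcases le_or_gt 0 h with hh | hh
    · have : 0 ≤ h * Real.exp (n * x) := by positivity
      exact (min_le_left _ _).trans (by linarith)
    · have h2 : Real.exp (n * x) ≤ Real.exp (n * ξ c) := by gcongr
      exact (min_le_right _ _).trans (by nlinarith)
  set A := √(m ^ (1 / (k : ℝ))) with hA
  have hA0 : 0 < A := Real.sqrt_pos.2 (Real.rpow_pos_of_pos hm0 _)
  have hvel : ∀ t ∈ s, c ≤ t → Real.exp (ξ t) * p t ≤ -A := fun t ht hct => by
    have h1 := H.exp_mul_vel_sq hk hp ht
    have h2 := hmle _ (hanti hc ht hct)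
    have h3 : m ^ (1 / (k : ℝ)) ≤ |1 + h * Real.exp (n * ξ t)| ^ (1 / (k : ℝ)) :=
      Real.rpow_le_rpow hm0.le (h2.trans (le_abs_self _)) (by positivity)
    have h4 : A ≤ -(Real.exp (ξ t) * p t) := by
      refine Real.sqrt_le_iff.2 ⟨?_, ?_⟩
      · have := mul_neg_of_pos_of_neg (Real.exp_pos (ξ t))
          (show p t < 0 by linarith [hp t ht])
        linarith
      · rw [neg_sq, h1]
        have := sq_nonneg (Real.exp (ξ t))
        linarith
    linarith
  obtain ⟨b, hb⟩ := (H.ordConnected.Ici_subset_or_isLUB H.nonempty).resolve_left fun hs => by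
    have hle : c ≤ c + Real.exp (ξ c) / A := by
      have : 0 < Real.exp (ξ c) / A := div_pos (Real.exp_pos _) hA0
      linarith
    have h1 := le_of_deriv_le_neg_right (m := A) (fun u hu => (H.hasDerivAt u (hs c hc hu)).exp)
      (fun u hu => hvel u (hs c hc hu) hu) hle
    rw [add_sub_cancel_left, mul_div_cancel₀ _ hA0.ne', sub_self] at h1
    exact absurd (Real.exp_pos _) (not_lt.2 h1)
  have hsub := H.ordConnected.Ico_subset_of_isLUB hb hc
  have hcb := H.isOpen.lt_of_isLUB hb hc
  have hs : ∀ᶠ t in 𝓝[<] b, t ∈ s := by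
    filter_upwards [Ioo_mem_nhdsLT hcb] with t ht
    exact hsub ⟨ht.1.le, ht.2⟩
  have hξ : Tendsto ξ (𝓝[<] b) atBot := by
    rw [tendsto_atBot]
    by_contra hcon
    push Not at hcon
    obtain ⟨X, hX⟩ := hcon
    have hbdd : ∀ t ∈ Ioo c b, X ≤ ξ t := fun t ht => by
      obtain ⟨u, hu1, hu2⟩ := (hX.and_eventually (Ioo_mem_nhdsLT ht.2)).exists
      exact hu1.le.trans (hanti (hsub ⟨ht.1.le, ht.2⟩) (hsub ⟨(ht.1.trans hu2.1).le, hu2.2⟩)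
        hu2.1.le)
    obtain ⟨C, hC⟩ := H.exists_abs_vel_le hk X (ξ c)
    obtain ⟨x₀, hx₀, h0⟩ := H.exists_tendsto_right hk
      (fun t ht => H.eq_gap_of_neg hk (one_sub_sq_neg hp) ht) hb hc (C := C) fun t ht => by
        have hts := hsub ⟨ht.1.le, ht.2⟩
        exact hC t hts ⟨hbdd t ht, hanti hc hts ht.1.le⟩
    have hle : x₀ ≤ ξ c := by
      refine le_of_tendsto hx₀ ?_
      filter_upwards [Ioo_mem_nhdsLT hcb] with t ht
      exact hanti hc (hsub ⟨ht.1.le, ht.2⟩) ht.1.le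
    linarith [hmle x₀ hle]
  refine ⟨b, hb, hξ, ?_⟩
  have hz : Tendsto (fun t => Real.exp (ξ t)) (𝓝[<] b) (𝓝 0) := Real.tendsto_exp_atBot.comp hξ
  have hE : Tendsto (fun t => |1 + h * Real.exp (n * ξ t)|) (𝓝[<] b) (𝓝 1) := by
    have h1 : Tendsto (fun t => Real.exp (n * ξ t)) (𝓝[<] b) (𝓝 0) :=
      Real.tendsto_exp_atBot.comp (hξ.const_mul_atBot hn0)
    simpa using ((h1.const_mul h).const_add 1).abs
  have h1 := ((hz.pow 2).add (hE.rpow_const (p := 1 / (k : ℝ)) (Or.inr (by positivity)))).sqrt.neg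
  simp only [Real.one_rpow, zero_pow two_ne_zero, zero_add, Real.sqrt_one] at h1
  refine h1.congr' ?_
  filter_upwards [hs] with t ht
  rw [← H.exp_mul_vel_sq hk hp ht, Real.sqrt_sq_eq_abs, abs_of_nonpos, neg_neg]
  exact mul_nonpos_of_nonneg_of_nonpos (Real.exp_pos _).le (by linarith [hp t ht])

theorem tendsto_radialV_div (H : Trajectory n k h ξ p s) {b : ℝ} (hb : IsLUB s b)
    (hξ : Tendsto ξ (𝓝[<] b) atBot)
    (hz' : Tendsto (fun t => Real.exp (ξ t) * p t) (𝓝[<] b) (𝓝 (-1))) :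
    Tendsto (radialV ξ) (𝓝[<] (Real.exp b)) (𝓝 0) ∧
    Tendsto (fun r => radialV ξ r / (Real.exp b - r)) (𝓝[<] (Real.exp b)) (𝓝 1) := by
  obtain ⟨c, hc⟩ := H.nonempty
  have hcb := H.isOpen.lt_of_isLUB hb hc
  have hlog := tendsto_log_nhdsLT_exp b
  have hz : Tendsto (fun t => Real.exp (ξ t)) (𝓝[<] b) (𝓝 0) := Real.tendsto_exp_atBot.comp hξ
  have hid : Tendsto id (𝓝[<] (Real.exp b)) (𝓝 (Real.exp b)) :=
    tendsto_id.mono_left nhdsWithin_le_nhds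
  have hrad : ∀ᶠ r in 𝓝[<] (Real.exp b), r ∈ radii s := by
    filter_upwards [hlog (Ioo_mem_nhdsLT hcb), Ioo_mem_nhdsLT (Real.exp_pos b)] with r h1 h2
    exact ⟨h2.1, H.ordConnected.Ico_subset_of_isLUB hb hc ⟨h1.1.le, h1.2⟩⟩
  have hv0 : Tendsto (radialV ξ) (𝓝[<] (Real.exp b)) (𝓝 0) := by
    have := hid.mul (hz.comp hlog)
    rwa [mul_zero] at this
  refine ⟨hv0, ?_⟩
  refine HasDerivAt.lhopital_zero_nhdsLT (f' := deriv (radialV ξ)) (g' := fun _ => -1) ?_ ?_ ?_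
    hv0 ?_ ?_
  · filter_upwards [hrad] with r hr
    exact (H.hasDerivAt_radialV hr).differentiableAt.hasDerivAt
  · exact Eventually.of_forall fun r => (hasDerivAt_id r).const_sub _
  · exact Eventually.of_forall fun r => by norm_num
  · simpa using hid.const_sub (Real.exp b)
  · have h1 := ((hz.add hz').comp hlog).div_const (-1)
    norm_num at h1
    refine h1.congr' ?_
    filter_upwards [hrad] with r hr
    rw [H.deriv_radialV hr]
    ring

/-- The arclength `∫ e^{-ξ} dt` diverges at the right end, since `(-ξ)_t ≤ 2 e^{-ξ}` there. -/
theorem isCompleteNear (H : Trajectory n k h ξ p s) {b : ℝ} (hb : IsLUB s b)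
    (hξ : Tendsto ξ (𝓝[<] b) atBot)
    (hz' : Tendsto (fun t => Real.exp (ξ t) * p t) (𝓝[<] b) (𝓝 (-1))) :
    IsCompleteNear n (radialV ξ) (radii s) (Real.exp b) := by
  obtain ⟨Ψ, hΨ⟩ := H.exists_arclength
  obtain ⟨c, hc⟩ := H.nonempty
  have hcb := H.isOpen.lt_of_isLUB hb hc
  obtain ⟨d, hd, hdsub⟩ := (mem_nhdsLT_iff_exists_Ioo_subset' hcb).1
    ((hz'.eventually_const_le (show (-2 : ℝ) < -1 by norm_num)).and (Ioo_mem_nhdsLT hcb))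
  have hd : d < b := hd
  have hds : ∀ t ∈ Ioo d b, t ∈ s ∧ 0 ≤ 2 * Real.exp (-ξ t) + p t := fun t ht => by
    obtain ⟨h1, h2⟩ := hdsub ht
    refine ⟨H.ordConnected.Ico_subset_of_isLUB hb hc ⟨h2.1.le, h2.2⟩, ?_⟩
    have h3 := Real.exp_pos (ξ t)
    have h4 : 0 ≤ (Real.exp (ξ t) * p t + 2) * Real.exp (-ξ t) :=
      mul_nonneg (by linarith [show (-2 : ℝ) ≤ Real.exp (ξ t) * p t from h1]) (Real.exp_pos _).le
    rw [Real.exp_neg] at h4 ⊢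
    have h5 : (Real.exp (ξ t) * p t + 2) * (Real.exp (ξ t))⁻¹ =
        2 * (Real.exp (ξ t))⁻¹ + p t := by field_simp; ring
    rwa [h5] at h4
  have hder : ∀ t ∈ Ioo d b, HasDerivAt (fun t => 2 * Ψ t + ξ t) (2 * Real.exp (-ξ t) + p t) t :=
    fun t ht => ((hΨ t (hds t ht).1).const_mul 2).add (H.hasDerivAt t (hds t ht).1)
  have hmono : MonotoneOn (fun t => 2 * Ψ t + ξ t) (Ioo d b) := by
    refine monotoneOn_of_deriv_nonneg (convex_Ioo d b)
      (fun t ht => (hder t ht).continuousAt.continuousWithinAt)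
      (fun t ht => (hder t (interior_subset ht)).differentiableAt.differentiableWithinAt)
      fun t ht => ?_
    rw [(hder t (interior_subset ht)).deriv]
    exact (hds t (interior_subset ht)).2
  have hΨtop : Tendsto Ψ (𝓝[<] b) atTop := by
    have he : d < (d + b) / 2 ∧ (d + b) / 2 < b := ⟨by linarith, by linarith⟩
    have h1 : Tendsto (fun t => (2 * Ψ ((d + b) / 2) + ξ ((d + b) / 2)) / 2 + -ξ t * (1 / 2))
        (𝓝[<] b) atTop :=
      tendsto_atTop_add_const_left _ _
        ((tendsto_neg_atBot_atTop.comp hξ).atTop_mul_const (by norm_num))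
    refine tendsto_atTop_mono' _ ?_ h1
    filter_upwards [Ioo_mem_nhdsLT he.2] with t ht
    have := hmono ⟨he.1, he.2⟩ ⟨he.1.trans ht.1, ht.2⟩ ht.1.le
    simp only at this
    linarith
  intro r₀ hr₀
  have hIsub : Ico r₀ (Real.exp b) ⊆ radii s := fun r hr => by
    have hr0 : 0 < r := hr₀.1.trans_le hr.1
    exact ⟨hr0, H.ordConnected.Ico_subset_of_isLUB hb hr₀.2
      ⟨Real.log_le_log hr₀.1 hr.1, (Real.log_lt_iff_lt_exp hr0).2 hr.2⟩⟩
  have hIc : (radii s).OrdConnected := ⟨fun x hx y hy z hz => by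
    have hz0 : 0 < z := hx.1.trans_le hz.1
    exact ⟨hz0, H.ordConnected.out hx.2 hy.2
      ⟨Real.log_le_log hx.1 hz.1, Real.log_le_log hz0 hz.2⟩⟩⟩
  have hΦ : ∀ r ∈ radii s, HasDerivAt (fun r => Ψ (Real.log r)) (1 / radialV ξ r) r :=
    fun r hr => hasDerivAt_arclength_log hΨ hr
  have hvpos : ∀ r ∈ radii s, 0 < radialV ξ r := fun r hr => radialV_pos ξ hr.1
  refine isCompletePart_of_isClosed_image (isOpen_radii H.isOpen) hIc (fun r hr => hr.1)
    hvpos H.continuousOn_radialV hΦ hIsub ?_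
  have hr₀b : r₀ < Real.exp b :=
    (Real.log_lt_iff_lt_exp hr₀.1).1 (H.isOpen.lt_of_isLUB hb hr₀.2)
  have himage : (fun r => Ψ (Real.log r)) '' Ico r₀ (Real.exp b) = Ici (Ψ (Real.log r₀)) := by
    refine Subset.antisymm ?_ ?_
    · rintro _ ⟨r, hr, rfl⟩
      exact (strictMonoOn_of_hasDerivAt_one_div (isOpen_radii H.isOpen) hIc hvpos hΦ).monotoneOn
        hr₀ (hIsub hr) hr.1
    · exact isPreconnected_Ico.intermediate_value_Ici (f := fun r => Ψ (Real.log r))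
        (left_mem_Ico.2 hr₀b) (l := 𝓝[<] (Real.exp b))
        (le_principal_iff.2 (Ico_mem_nhdsLT hr₀b))
        (fun r hr => (hΦ r (hIsub hr)).continuousAt.continuousWithinAt)
        (hΨtop.comp (tendsto_log_nhdsLT_exp b))
  rw [himage]
  exact isClosed_Ici

theorem left_end_of_even_of_neg (H : Trajectory n k h ξ p s) (hn : 0 < n) (hk : 0 < k)
    (hp : ∀ t ∈ s, p t < -1) (hke : Even k) (hh : h < 0) :
    ∃ a x₀, IsGLB s a ∧ Tendsto ξ (𝓝[>] a) (𝓝 x₀) ∧ 1 + h * Real.exp (n * x₀) = 0 := by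
  have hn0 : (0 : ℝ) < n := by positivity
  obtain ⟨c, hc⟩ := H.nonempty
  have hup : ∀ t ∈ s, ξ t ≤ Real.log (1 / -h) / n := fun t ht => by
    have h1 := H.one_add_pos_of_even hke ht
    rw [le_div_iff₀ hn0, Real.le_log_iff_exp_le (one_div_pos.2 (neg_pos.2 hh)),
      le_div_iff₀ (neg_pos.2 hh), mul_comm (ξ t)]
    linarith
  obtain ⟨a, ha⟩ := (H.ordConnected.Iic_subset_or_isGLB H.nonempty).resolve_left fun hs => by
    obtain ⟨t, ht1, ht2⟩ := (((H.tendsto_atBot_of_Iic_subset hp hs).eventually_gt_atTop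
      (Real.log (1 / -h) / n)).and (eventually_le_atBot c)).exists
    linarith [hup t (hs c hc ht2)]
  have hsub := H.ordConnected.Ioc_subset_of_isGLB ha hc
  obtain ⟨C, hC⟩ := H.exists_abs_vel_le hk (ξ c) (Real.log (1 / -h) / n)
  obtain ⟨x₀, hx₀, h0⟩ := H.exists_tendsto_left hk
    (fun t ht => H.eq_gap_of_neg hk (one_sub_sq_neg hp) ht) ha hc (C := C) fun t ht => by
      have hts := hsub ⟨ht.1, ht.2.le⟩
      exact hC t hts ⟨H.antitoneOn hp hts hc ht.2.le, hup t hts⟩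
  exact ⟨a, x₀, ha, hx₀, h0⟩

theorem hyperbolic_of_mass_zero (H : Trajectory n k 0 ξ p s) (hk : 0 < k)
    (hp : ∀ t ∈ s, p t < -1) {b : ℝ} (hb : IsLUB s b)
    (hv0 : Tendsto (radialV ξ) (𝓝[<] (Real.exp b)) (𝓝 0)) :
    radii s = Ioo 0 (Real.exp b) ∧ ∀ r ∈ radii s, radialV ξ r ^ (-2 : ℤ) =
      (2 * Real.exp b / (Real.exp b ^ 2 - r ^ 2)) ^ 2 := by
  obtain ⟨c, hc⟩ := H.nonempty
  have hs := H.Iic_subset_of_gap_le hk hp (fun _ _ _ _ => by simp) hc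
    (M := Real.exp (-2 * ξ c)) fun x hx => by
      rw [gap, zero_mul, add_zero, abs_one, Real.one_rpow, one_mul]
      exact Real.exp_le_exp.2 (by linarith)
  have hI : radii s = Ioo 0 (Real.exp b) := by
    rw [eq_Iio_of_isLUB H.isOpen H.ordConnected H.nonempty hs hb, radii_Iio]
  obtain ⟨B, -, hB, hv⟩ := H.radialV_of_mass_zero (σ := -1) (by norm_num)
    (fun t ht => H.eq_gap_of_neg hk (one_sub_sq_neg hp) ht)
  have hB0 : 0 < B := by
    rw [← hB c hc]
    have := hp c hc
    have h2 : 0 < 1 - p c := by linarith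
    positivity
  have hR := Real.exp_pos b
  have hlim : Tendsto (radialV ξ) (𝓝[<] (Real.exp b))
      (𝓝 ((-1 * Real.exp b ^ 2 + B ^ 2) / (2 * B))) := by
    have hid : Tendsto id (𝓝[<] (Real.exp b)) (𝓝 (Real.exp b)) :=
      tendsto_id.mono_left nhdsWithin_le_nhds
    refine ((((hid.pow 2).const_mul (-1)).add_const (B ^ 2)).div_const (2 * B)).congr' ?_
    filter_upwards [Ioo_mem_nhdsLT hR] with r hr
    exact (hv r (hI ▸ hr)).symm
  have hBR : Real.exp b = B := by
    have h1 := tendsto_nhds_unique hlim hv0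
    rw [div_eq_zero_iff, or_iff_left (by positivity)] at h1
    exact (pow_left_inj₀ hR.le hB0.le two_ne_zero).1 (by linarith)
  refine ⟨hI, fun r hr => ?_⟩
  rw [hv r hr, hBR, zpow_neg, ← inv_zpow, inv_div, show -1 * r ^ 2 + B ^ 2 = B ^ 2 - r ^ 2 by ring]
  norm_cast

theorem catalog_of_even (H : Trajectory n k h ξ p s) (hk : 1 < k) (hkn : k ≤ n)
    (hp : ∀ t ∈ s, p t < -1) (hke : Even k) : ∃ R : ℝ, 0 < R ∧
    Asymptotics.IsEquivalent (𝓝[<] R) (fun r => radialV ξ r ^ (-2 : ℤ))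
      (fun r => (R - r) ^ (-2 : ℤ)) ∧
    (h = 0 → radii s = Ioo 0 R ∧
      ∀ r ∈ radii s, radialV ξ r ^ (-2 : ℤ) = (2 * R / (R ^ 2 - r ^ 2)) ^ 2) ∧
    (h < 0 → ∃ r₁ : ℝ, 0 < r₁ ∧ r₁ < R ∧ radii s = Ioo r₁ R ∧
      (∃ L : ℝ, 0 < L ∧ Tendsto (radialV ξ) (𝓝[>] r₁) (𝓝 L)) ∧
      Tendsto (deriv (radialV ξ)) (𝓝[>] r₁) (𝓝 0) ∧ BlowsUp2 (𝓝[>] r₁) (radialV ξ) ∧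
      IsCompleteNear n (radialV ξ) (radii s) R) ∧
    (0 < h →
      (2 * k < n → ∃ r₁ : ℝ, 0 < r₁ ∧ r₁ < R ∧ radii s = Ioo r₁ R ∧
        SimConst (𝓝[>] r₁) (fun r => radialV ξ r ^ (-2 : ℤ))
          (fun r => (r - r₁) ^ (4 * (k : ℝ) / (n - 2 * k)))) ∧
      (2 * k = n → radii s = Ioo 0 R ∧
        SimConst (𝓝[>] 0) (fun r => radialV ξ r ^ (-2 : ℤ))
          (fun r => r ^ (2 * (√(1 + h ^ (1 / (k : ℝ))) - 1)))) ∧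
      (n < 2 * k → radii s = Ioo 0 R ∧ RootExpansion n k (h ^ (1 / (k : ℝ))) (radialV ξ)) ∧
      IsCompleteNear n (radialV ξ) (radii s) R) := by
  have hk0 : 0 < k := by omega
  have hn : 0 < n := by omega
  obtain ⟨b, hb, hξ, hz'⟩ := H.right_end_of_even hn hk0 hp hke
  obtain ⟨hv0, hvR⟩ := H.tendsto_radialV_div hb hξ hz'
  have hnear := H.isCompleteNear hb hξ hz'
  obtain ⟨c, hc⟩ := H.nonempty
  refine ⟨Real.exp b, Real.exp_pos b, ?_, ?_, ?_, ?_⟩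
  · refine Asymptotics.isEquivalent_of_tendsto_one ?_
    have h1 := hvR.zpow₀ (-2) (Or.inl one_ne_zero)
    rw [one_zpow] at h1
    refine h1.congr fun r => ?_
    rw [Pi.div_apply, div_zpow]
  · rintro rfl
    exact H.hyperbolic_of_mass_zero hk0 hp hb hv0
  · intro hh
    obtain ⟨a, x₀, ha, hx₀, h0⟩ := H.left_end_of_even_of_neg hn hk0 hp hke hh
    have hac := H.isOpen.lt_of_isGLB ha hc
    have hab := hac.trans (H.isOpen.lt_of_isLUB hb hc)
    have hI : radii s = Ioo (Real.exp a) (Real.exp b) := by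
      rw [eq_Ioo_of_isGLB_isLUB H.isOpen H.ordConnected H.nonempty ha hb, radii_Ioo]
    have hs : ∀ᶠ t in 𝓝[>] a, t ∈ s := by
      filter_upwards [Ioo_mem_nhdsGT hac] with t ht
      exact H.ordConnected.Ioc_subset_of_isGLB ha hc ⟨ht.1, ht.2.le⟩
    have hlog := tendsto_log_nhdsGT_exp a
    have hrad : ∀ᶠ r in 𝓝[>] (Real.exp a), r ∈ radii s := by
      rw [hI]; exact Ioo_mem_nhdsGT (Real.exp_lt_exp.2 hab)
    have hid : Tendsto id (𝓝[>] (Real.exp a)) (𝓝 (Real.exp a)) :=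
      tendsto_id.mono_left nhdsWithin_le_nhds
    have hp1 := H.tendsto_vel_neg_one hk0 hp hs hx₀ h0
    exact ⟨Real.exp a, Real.exp_pos a, Real.exp_lt_exp.2 hab, hI,
      ⟨_, mul_pos (Real.exp_pos a) (Real.exp_pos x₀), tendsto_radialV hid hlog hx₀⟩,
      H.tendsto_deriv_radialV_zero hlog hrad hx₀ hp1,
      H.blowsUp2_of_tendsto hn hk (Real.exp_pos a) hid hlog hrad hx₀ h0 hp1 (by norm_num), hnear⟩
  · intro hh
    obtain ⟨h1, h2, h3⟩ := H.left_end_catalog hk0 hkn hp hh.ne'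
      (fun t _ x _ => by positivity) hb
    rw [abs_of_pos hh] at h2 h3
    exact ⟨h1, h2, h3, hnear⟩

theorem catalogII (H : Trajectory n k h ξ p s) (hk : 1 < k) (hkn : k ≤ n)
    (hD : ∀ t ∈ s, 1 - p t ^ 2 < 0) (hke : Even k) : CatalogII n k ξ s h := by
  refine ⟨H.inGammaMinus (by omega) hkn hke hD, ?_⟩
  rcases H.vel_lt_or_gt hD with hp | hp
  · exact ⟨radialV ξ, radii s, Or.inl ⟨rfl, rfl⟩, H.catalog_of_even hk hkn hp hke⟩
  · have hp' : ∀ t ∈ Neg.neg ⁻¹' s, -p (-t) < -1 := fun t ht => neg_lt_neg (hp (-t) ht)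
    exact ⟨_, _, Or.inr ⟨(invV_radialV ξ).symm, (invRadii_radii s).symm⟩,
      H.neg.catalog_of_even hk hkn hp' hke⟩

theorem pos_or_neg (H : Trajectory n k h ξ p s) :
    (∀ t ∈ s, 0 < 1 - p t ^ 2) ∨ ∀ t ∈ s, 1 - p t ^ 2 < 0 := by
  by_contra! hcon
  obtain ⟨⟨u, hu, hDu⟩, w, hw, hDw⟩ := hcon
  have hc : ContinuousOn (fun t => 1 - p t ^ 2) s := continuousOn_const.sub (H.continuousOn_vel.pow 2)
  obtain ⟨t, ht, ht0⟩ := (H.ordConnected.isPreconnected.image _ hc).ordConnected.out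
    (mem_image_of_mem _ hu) (mem_image_of_mem _ hw)
    (show (0 : ℝ) ∈ Icc (1 - p u ^ 2) (1 - p w ^ 2) from ⟨hDu, hDw⟩)
  exact H.ne_zero t ht ht0

end Trajectory

/-! ### The classification -/

theorem theorem1 (n k : ℕ) (hn : 3 ≤ n) (hk : 1 < k) (hkn : k ≤ n) (ξ : ℝ → ℝ) (s : Set ℝ)
    (hξ : IsMaximalSolution n k ξ s) :
    (∀ x ∈ shell n (radii s),
      sigmaCurv (fun y => radialV ξ ‖y‖) k x = 2 ^ (-(k : ℝ)) * (n.choose k : ℝ)) ∧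
    ((∀ t ∈ s, 0 < 1 - deriv ξ t ^ 2) ∨ (∀ t ∈ s, 1 - deriv ξ t ^ 2 < 0)) ∧
    ∃ h : ℝ, (∀ t ∈ s, firstIntegral n k ξ t = h) ∧
      ((∀ t ∈ s, 0 < 1 - deriv ξ t ^ 2) → CatalogI n k ξ s h) ∧
      ((∀ t ∈ s, 1 - deriv ξ t ^ 2 < 0) → Even k → CatalogII n k ξ s h) ∧
      ((∀ t ∈ s, 1 - deriv ξ t ^ 2 < 0) → Odd k → CatalogIII n k ξ s h) := by
  have hn0 : 0 < n := by omega
  obtain ⟨h, hh, H⟩ := hξ.exists_trajectory hn0 hk hkn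
  exact ⟨fun x hx => H.sigmaCurv_self hn0 (by omega) hx, H.pos_or_neg, h, hh,
    H.catalogI hk hkn, H.catalogII hk hkn, H.catalogIII hk hkn⟩
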